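/- Let $c>0$ and let $\lambda\in C^1((0,\infty),[0,\infty))$ satisfy $\Lambda(t)=\int_0^t\lambda(s)\,ds<\infty$ for all $t>0$. Let $\{(X(t),Y(t))\}_{t\ge 0}$ be the standard orthogonal planar random motion: a particle starts at the origin and moves with speed $c$ along one of the directions $d_k=(\cos(k\pi/2),\sin(k\pi/2))$, $k=0,1,2,3$; the initial direction is uniform on $\{d_0,\dots,d_3\}$; at each event of a non-homogeneous Poisson process with rate function $\lambda(t)$ the particle switches from its current direction $d_k$ to $d_{k+1}$ or $d_{k-1}$ (indices mod $4$) with probability $1/2$ each; the Poisson process, the initial direction and the successive choices are independent. Then on the region $\{(\eta,t): |\eta|<ct\}$ there is a continuous density $f(\eta,t)$ of $X(t)-Y(t)$ on the first-quadrant edge $X(t)+Y(t)=ct$, i.e. for every $t>0$ the function $f(\cdot,t)$ is integrable on $(-ct,ct)$ and $$P\{X(t)+Y(t)=ct,\ X(t)-Y(t)\in B\}=\int_B f(\eta,t)\,d\eta\qquad\text{for all Borel } B\subseteq(-ct,ct).$$ Every such $f$ is of class $C^1$ on the region $|\eta|<ct$ and satisfies $$\begin{cases}\dfrac{\partial^2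 f}{\partial t^2}+2\lambda(t)\dfrac{\partial f}{\partial t}+\dfrac12\Bigl(\dfrac32\lambda(t)^2+\lambda'(t)\Bigr)f=c^2\dfrac{\partial^2 f}{\partial\eta^2}, & |\eta|<ct,\\[2mm] f(\eta,t)\ge 0, & |\eta|<ct,\\[1mm] \displaystyle\int_{-ct}^{ct}f(\eta,t)\,d\eta=\tfrac12\bigl(e^{-\Lambda(t)/2}-e^{-\Lambda(t)}\bigr), & t>0,\end{cases}$$ where the differential equation holds in the sense of distributions on $\{|\eta|<ct\}$. If moreover $\lambda\in C^2((0,\infty))$, then $f$ is of class $C^2$ on this region and the differential equation holds at every point of it. -/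

import Mathlib

open MeasureTheory ProbabilityTheory Set
open scoped NNReal

noncomputable section

namespace OrthogonalMotion

/-- `N` is a (non-homogeneous) Poisson process with rate function `lam` on `(0, ∞)`: a counting
process with right-continuous nondecreasing paths started at `0`, with independent increments, the
increment over `(s, t]` having the Poisson law of mean `∫ r in s..t, lam r`. -/
structure IsPoissonProcess {Ω : Type*} [MeasurableSpace Ω] (P : Measure Ω) (lam : ℝ → ℝ)
    (N : ℝ≥0 → Ω → ℕ) : Prop where
  measurable : ∀ t, Measurable (N t)
  zero : ∀ ω, N 0 ω = 0
  mono : ∀ ω, Monotone fun t => N t ω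
  rightCts : ∀ ω t, ContinuousWithinAt (fun s => N s ω) (Ici t) t
  indep : HasIndepIncrements N P
  law : ∀ s t : ℝ≥0, s ≤ t →
    HasLaw (fun ω => N t ω - N s ω) (poissonMeasure (∫ r in (s : ℝ)..t, lam r).toNNReal) P

/-- The random ingredients of the standard orthogonal planar motion. Directions are labelled by
`k : ZMod 4`, the direction `k` being the unit vector `(cos (k π / 2), sin (k π / 2))`.
`N` is the Poisson process of the changes of direction, `D₀` the (uniform) initial direction, and
`ε i` the `i`-th turn, which is `+1` or `-1` with probability `1/2` each; `N`, `D₀` and all the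
`ε i` are independent. -/
structure IsStandardMotion {Ω : Type*} [MeasurableSpace Ω] (P : Measure Ω) (lam : ℝ → ℝ)
    (N : ℝ≥0 → Ω → ℕ) (D₀ : Ω → ZMod 4) (ε : ℕ → Ω → ZMod 4) : Prop where
  poisson : IsPoissonProcess P lam N
  measurable_init : Measurable D₀
  measurable_turn : ∀ i, Measurable (ε i)
  init : ∀ k, P {ω | D₀ ω = k} = 1 / 4
  turn_left : ∀ i, P {ω | ε i ω = 1} = 1 / 2
  turn_right : ∀ i, P {ω | ε i ω = -1} = 1 / 2
  indep_turn : iIndepFun ε P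
  indep_init : IndepFun D₀ (fun ω i => ε i ω) P
  indep_poisson : IndepFun (fun ω t => N t ω) (fun ω => (D₀ ω, fun i => ε i ω)) P

/-- The (label of the) direction at time `t`: at each Poisson event the particle turns by a
right angle, to one of the two directions orthogonal to the current one. -/
def dir {Ω : Type*} (N : ℝ≥0 → Ω → ℕ) (D₀ : Ω → ZMod 4) (ε : ℕ → Ω → ZMod 4)
    (t : ℝ≥0) (ω : Ω) : ZMod 4 :=
  D₀ ω + ∑ i ∈ Finset.range (N t ω), ε i ω

/-- First coordinate of the particle at time `t`, which moves with speed `c` from the origin. -/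
def posX {Ω : Type*} (c : ℝ) (N : ℝ≥0 → Ω → ℕ) (D₀ : Ω → ZMod 4) (ε : ℕ → Ω → ZMod 4)
    (t : ℝ≥0) (ω : Ω) : ℝ :=
  ∫ s in (0 : ℝ)..t, c * Real.cos ((dir N D₀ ε s.toNNReal ω).val * (Real.pi / 2))

/-- Second coordinate of the particle at time `t`. -/
def posY {Ω : Type*} (c : ℝ) (N : ℝ≥0 → Ω → ℕ) (D₀ : Ω → ZMod 4) (ε : ℕ → Ω → ZMod 4)
    (t : ℝ≥0) (ω : Ω) : ℝ :=
  ∫ s in (0 : ℝ)..t, c * Real.sin ((dir N D₀ ε s.toNNReal ω).val * (Real.pi / 2))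

/-- The open region of pairs `(η, t)` with `|η| < c t`. -/
def frontRegion (c : ℝ) : Set (ℝ × ℝ) := {p | |p.1| < c * p.2}

/-- `f` is the (continuous version of the) density of `X - Y` on the edge `X + Y = c t`:
`f (η, t) dη = P {X t + Y t = c t, X t - Y t ∈ dη}` for `|η| < c t`. -/
structure IsEdgeDensity {Ω : Type*} [MeasurableSpace Ω] (P : Measure Ω) (c : ℝ)
    (X Y : ℝ≥0 → Ω → ℝ) (f : ℝ → ℝ → ℝ) : Prop where
  continuousOn : ContinuousOn (fun p : ℝ × ℝ => f p.1 p.2) (frontRegion c)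
  integrableOn : ∀ t : ℝ≥0, 0 < t → IntegrableOn (fun η => f η t) (Ioo (-(c * t)) (c * t))
  prob_eq : ∀ t : ℝ≥0, 0 < t → ∀ B : Set ℝ, MeasurableSet B → B ⊆ Ioo (-(c * t)) (c * t) →
    P.real {ω | X t ω + Y t ω = c * t ∧ X t ω - Y t ω ∈ B} = ∫ η in B, f η t

/-- `f_tt + 2 λ f_t + (1/2) (3/2 λ² + λ') f = c² f_ηη` at the point `(η, t)`. -/
def SolvesAt (c : ℝ) (lam : ℝ → ℝ) (f : ℝ → ℝ → ℝ) (η t : ℝ) : Prop :=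
  iteratedDeriv 2 (fun s => f η s) t + 2 * lam t * deriv (fun s => f η s) t
      + 1 / 2 * (3 / 2 * lam t ^ 2 + deriv lam t) * f η t
    = c ^ 2 * iteratedDeriv 2 (fun x => f x t) η

/-- The same equation in the sense of distributions on the region `|η| < c t`: all derivatives of
`f` are moved to smooth test functions with compact support in the region. -/
def SolvesWeakly (c : ℝ) (lam : ℝ → ℝ) (f : ℝ → ℝ → ℝ) : Prop :=
  ∀ φ : ℝ × ℝ → ℝ, ContDiff ℝ (⊤ : ℕ∞) φ → HasCompactSupport φ → tsupport φ ⊆ frontRegion c →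
    ∫ p in frontRegion c, f p.1 p.2 *
      (iteratedDeriv 2 (fun s => φ (p.1, s)) p.2
        - 2 * deriv (fun s => lam s * φ (p.1, s)) p.2
        + 1 / 2 * (3 / 2 * lam p.2 ^ 2 + deriv lam p.2) * φ p
        - c ^ 2 * iteratedDeriv 2 (fun x => φ (x, p.2)) p.1) = 0

end OrthogonalMotion

end

open OrthogonalMotion

namespace OrthogonalMotion

noncomputable section

open Filter Topology
open scoped ENNReal

/-! ### Independence of an increment from the whole past -/

section increments
variable {Ω : Type*} [mΩ : MeasurableSpace Ω] {P : Measure Ω} {lam : ℝ → ℝ} {N : ℝ≥0 → Ω → ℕ}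

/-! The particle is on the edge `X + Y = c t` exactly when it has only used the directions `0` and
`1`: it starts in one of them and every turn leads to the other. For a given start and `n` turns
this has probability `1/4 * 2⁻ⁿ`, independently of the Poisson process, and then `X - Y = ± c (t - 2
W)`, where `W = offTime N t` is the time spent in the direction not used at time `t`. So the joint
law of `N t` and `W` decides everything.

Write `Λ` for `cumRate lam`. Between events `W` is constant, and an event at time `t` replaces `W`
by `t - W`. Conditioning over a short time step shows that `exp Λ(t) * E[g(W); N t = n + 1]` has
right derivative `lam t * exp Λ(t) * E[g(t - W); N t = n]`; integrated, this is
`IsPoissonProcess.levelMean_succ`. Iterating it gives the density of `W` on each level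
(`IsPoissonProcess.map_offTime`). Summing the kernels with the weights `2⁻ⁿ` produces a function `G`
with `G u v = lam u / 2 + ∫₀ᵛ lam (u + x) / 2 * G x u dx` (`edgeKernelE_eq`), and the edge density
is `exp(-Λ(t)) / (8c) * (G u v + G v u)` at `u = (t - η/c)/2`, `v = (t + η/c)/2`.

The integral equation yields `∂_v G u v = lam (u + v) / 2 * G v u`, which is a derivative along a
characteristic. Hence the two summands `R`, `L` of the density satisfy `R_t + c R_η = -lam R +
(lam/2) L` and its mirror image. Their sum `F` and difference `H` solve `F_t + c H_η = -(lam/2) F`,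
`H_t + c F_η = -(3 lam/2) H` (`isTelegraphPair`), and eliminating `H` gives the second-order
equation: pointwise for `C²` functions (`IsTelegraphPair.solvesAt`), against test functions for `C¹`
ones (`IsTelegraphPair.solvesWeakly`).

Regularity of `G` comes from the same integral equation, each derivative of `G` costing one of
`lam`. Since `lam` may be unbounded at `0`, `G x u` is controlled near `x = 0` only in `L¹`; that
control comes from the probabilistic meaning of the mass of `G` on diagonals. Finally, continuous
densities are unique (`IsEdgeDensity.eqOn`), so everything need only be proved for this one, and its
mass is the sum over `n ≥ 1` of `2 * (1/4) * 2⁻ⁿ * exp(-Λ) Λⁿ / n!`. -/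

theorem _root_.ProbabilityTheory.HasIndepIncrements.indepFun_past [IsProbabilityMeasure P]
    (hind : HasIndepIncrements N P) (hmeas : ∀ t, Measurable (N t)) (hzero : ∀ ω, N 0 ω = 0)
    (hmono : ∀ ω, Monotone fun t => N t ω) {t r : ℝ≥0} (htr : t ≤ r) :
    IndepFun (fun ω (s : Iic t) => N s ω) (fun ω => N r ω - N t ω) P := by
  refine IndepFun.process_indepFun (X := fun (s : Iic t) ω => N s ω) (fun s => hmeas s)
    ((hmeas r).sub (hmeas t)) fun I => ?_
  classical
  -- Finitely many past times suffice. Adjoining the time `0`, where the process vanishes, makes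
  -- each past value a sum of consecutive increments.
  let s : Finset ℝ≥0 := insert 0 (I.image (fun x : Iic t => (x : ℝ≥0)))
  have hs : ∀ x ∈ s, x ≤ t := by
    intro x hx
    simp only [s, Finset.mem_insert, Finset.mem_image] at hx
    rcases hx with rfl | ⟨y, -, rfl⟩
    · exact zero_le
    · exact y.2
  have hpos : 0 < s.card := Finset.card_pos.2 ⟨0, Finset.mem_insert_self _ _⟩
  let e := s.orderEmbOfFin rfl
  -- The times are listed in increasing order, followed by `t` and then by `r` forever. The
  -- increments of index below `s.card` thus lie in the past, and the one of index `s.card` is the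
  -- increment from `t` to `r`.
  let τ : ℕ → ℝ≥0 := fun k => if h : k < s.card then e ⟨k, h⟩ else if k = s.card then t else r
  have he : ∀ k, e k ∈ s := fun k => s.orderEmbOfFin_mem rfl k
  have hτ : Monotone τ := by
    intro a b hab
    simp only [τ]
    split_ifs with h1 h2 h3 h4 h5 h6 h7 h8
    · exact e.monotone (by simpa using hab)
    · exact hs _ (he _)
    · exact (hs _ (he _)).trans htr
    all_goals first | omega | exact le_rfl
  have hτ0 : τ 0 = 0 := by
    simp only [τ, hpos, dif_pos]
    have : e ⟨0, hpos⟩ = s.min' ⟨0, Finset.mem_insert_self _ _⟩ := Finset.orderEmbOfFin_zero rfl hpos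
    rw [this]
    exact le_antisymm (Finset.min'_le _ _ (Finset.mem_insert_self _ _)) zero_le
  have hI : iIndepFun (fun i ω => N (τ (i + 1)) ω - N (τ i) ω) P := hind.nat hτ
  have h2 := hI.indepFun_finset (Finset.range s.card) {s.card} (by simp)
    (fun i => (hmeas _).sub (hmeas _))
  have hidx : ∀ x : I, ∃ k : Fin s.card, e k = (x : Iic t) := by
    intro x
    have : ((x : Iic t) : ℝ≥0) ∈ Set.range e := by
      rw [Finset.range_orderEmbOfFin]
      simp only [s, Finset.coe_insert, Set.mem_insert_iff, Finset.mem_coe, Finset.mem_image]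
      exact Or.inr ⟨x, x.2, rfl⟩
    exact this
  choose k hk using hidx
  have hsum : ∀ ω j, N (τ j) ω = ∑ i ∈ Finset.range j, (N (τ (i + 1)) ω - N (τ i) ω) := by
    intro ω j
    induction j with
    | zero => simp [hτ0, hzero]
    | succ j ih =>
      rw [Finset.sum_range_succ, ← ih, add_tsub_cancel_of_le (hmono ω (hτ (Nat.le_succ j)))]
  have hψ : Measurable (fun f : ({s.card} : Finset ℕ) → ℕ => f ⟨s.card, by simp⟩) :=
    measurable_pi_apply _
  have := h2.comp (φ := fun f (x : I) => ∑ i ∈ Finset.range s.card,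
      if h : i ∈ Finset.range s.card then if i < k x then f ⟨i, h⟩ else 0 else 0)
    (by
      refine measurable_pi_iff.2 fun x => Finset.measurable_sum _ fun i _ => ?_
      split_ifs <;> fun_prop) hψ
  convert this using 1
  · ext ω x
    have h3 : τ (k x) = (x : Iic t) := by
      simp only [τ, (k x).2, dif_pos]
      exact hk x
    rw [← h3, hsum]
    simp only [Function.comp]
    rw [← Finset.sum_subset (Finset.range_subset_range.2 (k x).2.le)]
    · refine Finset.sum_congr rfl fun i hi => ?_
      have : i < k x := by simpa using hi
      rw [dif_pos (Finset.mem_range.2 (this.trans (k x).2)), if_pos this]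
    · intro i hi hni
      rw [dif_pos hi, if_neg (by simpa using hni)]
  · ext ω
    simp [τ]
end increments

/-! ### Measurability and pathwise behaviour of the off time -/

/-- The time spent during `[0, t]` in the parity class of `N` opposite to the one at time `t`. -/
def offTime {Ω : Type*} (N : ℝ≥0 → Ω → ℕ) (t : ℝ≥0) (ω : Ω) : ℝ :=
  ∫ s in (0 : ℝ)..t, if Even (N s.toNNReal ω + N t ω) then (0 : ℝ) else 1

section paths
variable {Ω : Type*} {N : ℝ≥0 → Ω → ℕ}

/-- By right continuity the path is a limit of paths sampled at grid times just after the current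
one. The sampling times are capped at `t`, so only the variables `N s` with `s ≤ t` enter; the off
time is therefore measurable for the σ-algebra of the past, which the conditioning below needs. -/
theorem measurable_stopped_path [MeasurableSpace Ω] {t : ℝ≥0}
    (hmeas : ∀ s ≤ t, Measurable (N s))
    (hright : ∀ ω t, ContinuousWithinAt (fun s => N s ω) (Ici t) t) :
    Measurable (fun p : ℝ × Ω => N (min t p.1.toNNReal) p.2) := by
  let q : ℕ → ℝ → ℝ≥0 := fun k s => min t ((⌈s.toNNReal * (k + 1)⌉₊ : ℝ≥0) / (k + 1))
  have hle : ∀ k s, min t s.toNNReal ≤ q k s := by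
    intro k s
    refine min_le_min le_rfl ?_
    rw [le_div_iff₀ (by positivity)]
    exact Nat.le_ceil _
  have htend : ∀ s, Tendsto (fun k => q k s) atTop (𝓝 (min t s.toNNReal)) := by
    intro s
    refine tendsto_const_nhds.min ?_
    have h0 : Tendsto (fun k : ℕ => s.toNNReal + 1 / ((k : ℝ≥0) + 1)) atTop (𝓝 s.toNNReal) := by
      simpa using tendsto_const_nhds.add (tendsto_one_div_add_atTop_nhds_zero_nat (𝕜 := ℝ≥0))
    refine tendsto_of_tendsto_of_tendsto_of_le_of_le tendsto_const_nhds h0 (fun k => ?_) fun k => ?_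
    · simp only
      rw [le_div_iff₀ (by positivity)]
      exact Nat.le_ceil _
    · simp only
      rw [div_le_iff₀ (by positivity), add_mul, one_div, inv_mul_cancel₀ (by positivity)]
      exact (Nat.ceil_lt_add_one zero_le).le
  refine measurable_of_tendsto_metrizable (f := fun k (p : ℝ × Ω) => N (q k p.1) p.2) ?_ ?_
  · intro k
    have h1 : Measurable (fun p : ℕ × Ω => N (min t ((p.1 : ℝ≥0) / (k + 1))) p.2) :=
      measurable_from_prod_countable_right fun j =>
        hmeas (min t ((j : ℝ≥0) / (k + 1))) (min_le_left _ _)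
    have h2 : Measurable (fun p : ℝ × Ω => ((⌈p.1.toNNReal * (k + 1)⌉₊ : ℕ), p.2)) :=
      (Nat.measurable_ceil.comp (by fun_prop)).prodMk measurable_snd
    simpa only [Function.comp_def, q] using h1.comp h2
  · rw [tendsto_pi_nhds]
    rintro ⟨s, ω⟩
    refine (hright ω (min t s.toNNReal)).tendsto.comp ?_
    exact tendsto_nhdsWithin_iff.2 ⟨htend s, Eventually.of_forall fun k => hle k s⟩

theorem measurable_path [MeasurableSpace Ω] {t : ℝ≥0} (hmeas : ∀ s ≤ t, Measurable (N s))
    (hright : ∀ ω t, ContinuousWithinAt (fun s => N s ω) (Ici t) t) (ω : Ω) :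
    Measurable (fun s : ℝ => N (min t s.toNNReal) ω) :=
  (measurable_stopped_path hmeas hright).comp (measurable_id.prodMk measurable_const)

theorem measurable_offTime [MeasurableSpace Ω] {t : ℝ≥0} (hmeas : ∀ s ≤ t, Measurable (N s))
    (hright : ∀ ω t, ContinuousWithinAt (fun s => N s ω) (Ici t) t) :
    Measurable (offTime N t) := by
  have h1 : Measurable (fun p : Ω × ℝ => if Even (N (min t p.2.toNNReal) p.1 + N t p.1)
      then (0 : ℝ) else 1) := by
    have h2 := ((measurable_stopped_path hmeas hright).comp measurable_swap).add
      ((hmeas t le_rfl).comp (measurable_fst (β := ℝ)))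
    exact (Measurable.of_discrete (f := fun n : ℕ => if Even n then (0 : ℝ) else 1)).comp h2
  have h3 := (h1.stronglyMeasurable.integral_prod_right' (ν := volume.restrict (Ioc (0 : ℝ) t))).measurable
  convert h3 using 2 with ω
  rw [offTime, intervalIntegral.integral_of_le t.coe_nonneg]
  refine setIntegral_congr_fun measurableSet_Ioc fun s hs => ?_
  have : s.toNNReal ≤ t := Real.toNNReal_le_iff_le_coe.2 hs.2
  simp [min_eq_right this]

theorem measurable_real_path [MeasurableSpace Ω] (hmeas : ∀ s, Measurable (N s))
    (hright : ∀ ω t, ContinuousWithinAt (fun s => N s ω) (Ici t) t) (ω : Ω) :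
    Measurable (fun s : ℝ => N s.toNNReal ω) := by
  refine measurable_of_tendsto_metrizable
    (f := fun k (s : ℝ) => N (min (k : ℝ≥0) s.toNNReal) ω)
    (fun k => measurable_path (fun s _ => hmeas s) hright ω) ?_
  rw [tendsto_pi_nhds]
  intro s
  refine tendsto_const_nhds.congr' ?_
  filter_upwards [eventually_ge_atTop ⌈s.toNNReal⌉₊] with k hk
  rw [min_eq_right (Nat.ceil_le.1 hk)]

theorem measurable_parity_path [MeasurableSpace Ω] (hmeas : ∀ s, Measurable (N s))
    (hright : ∀ ω t, ContinuousWithinAt (fun s => N s ω) (Ici t) t) (ω : Ω) (n : ℕ) :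
    Measurable (fun s : ℝ => if Even (N s.toNNReal ω + n) then (0 : ℝ) else 1) :=
  (Measurable.of_discrete (f := fun m : ℕ => if Even (m + n) then (0 : ℝ) else 1)).comp
    (measurable_real_path hmeas hright ω)

theorem intervalIntegrable_of_measurable_of_mem_Icc {f : ℝ → ℝ} (hf : Measurable f)
    (h0 : ∀ s, 0 ≤ f s) (h1 : ∀ s, f s ≤ 1) (a b : ℝ) : IntervalIntegrable f volume a b := by
  refine (intervalIntegrable_const (c := (1 : ℝ))).mono_fun hf.aestronglyMeasurable ?_
  refine Eventually.of_forall fun s => ?_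
  simp only [Real.norm_eq_abs, abs_one, abs_of_nonneg (h0 s)]
  exact h1 s

theorem ite_mem_Icc (p : Prop) [Decidable p] : 0 ≤ (if p then (0 : ℝ) else 1) ∧
    (if p then (0 : ℝ) else 1) ≤ 1 := by split_ifs <;> norm_num

theorem offTime_of_eq_zero (hmono : ∀ ω, Monotone fun t => N t ω) {t : ℝ≥0} {ω : Ω}
    (h : N t ω = 0) : offTime N t ω = 0 := by
  rw [offTime]
  refine (intervalIntegral.integral_congr (g := fun _ => (0 : ℝ)) fun s hs => ?_).trans (by simp)
  rw [uIcc_of_le t.coe_nonneg] at hs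
  have : N s.toNNReal ω ≤ N t ω := hmono ω (Real.toNNReal_le_iff_le_coe.2 hs.2)
  rw [if_pos]
  simp [h, show N s.toNNReal ω = 0 by omega]

theorem offTime_eq_of_eq [MeasurableSpace Ω] (hmeas : ∀ s, Measurable (N s))
    (hright : ∀ ω t, ContinuousWithinAt (fun s => N s ω) (Ici t) t)
    (hmono : ∀ ω, Monotone fun t => N t ω) {s t : ℝ≥0} (hst : s ≤ t) {ω : Ω}
    (h : N t ω = N s ω) : offTime N t ω = offTime N s ω := by
  have hint := fun a b => intervalIntegrable_of_measurable_of_mem_Icc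
        (measurable_parity_path hmeas hright ω (N s ω)) (fun s => (ite_mem_Icc _).1)
        (fun s => (ite_mem_Icc _).2) a b
  rw [offTime, offTime, h, ← intervalIntegral.integral_add_adjacent_intervals
    (hint 0 s) (hint s t), add_eq_left]
  refine (intervalIntegral.integral_congr (g := fun _ => (0 : ℝ)) fun x hx => ?_).trans (by simp)
  rw [uIcc_of_le (by exact_mod_cast hst)] at hx
  have h1 : N x.toNNReal ω ≤ N t ω := hmono ω (Real.toNNReal_le_iff_le_coe.2 hx.2)
  have h2 : N s ω ≤ N x.toNNReal ω := hmono ω (NNReal.le_toNNReal_of_coe_le hx.1)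
  simp only
  rw [if_pos]
  rw [show N x.toNNReal ω = N s ω by omega]
  exact Even.add_self _

/-- An event exchanges the two parity classes, so what counted as on-time before `s` counts as
off-time at `t`. The error is at most the length of `(s, t]`, where the location of the event is
unknown. -/
theorem abs_offTime_sub_le [MeasurableSpace Ω] (hmeas : ∀ s, Measurable (N s))
    (hright : ∀ ω t, ContinuousWithinAt (fun s => N s ω) (Ici t) t)
    {s t : ℝ≥0} (hst : s ≤ t) {ω : Ω}
    (h : N t ω = N s ω + 1) : |offTime N t ω - (s - offTime N s ω)| ≤ t - s := by
  have hint := fun n a b => intervalIntegrable_of_measurable_of_mem_Icc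
        (measurable_parity_path hmeas hright ω n) (fun s => (ite_mem_Icc _).1)
        (fun s => (ite_mem_Icc _).2) a b
  have hst' : (s : ℝ) ≤ t := by exact_mod_cast hst
  have h1 : (s : ℝ) - offTime N s ω =
      ∫ x in (0 : ℝ)..s, if Even (N x.toNNReal ω + N t ω) then (0 : ℝ) else 1 := by
    have : (s : ℝ) = ∫ x in (0 : ℝ)..s, (1 : ℝ) := by simp
    conv_lhs => rw [this]
    rw [offTime, ← intervalIntegral.integral_sub (by simp) (hint _ _ _)]
    refine intervalIntegral.integral_congr fun x _ => ?_
    simp only [h, ← add_assoc, Nat.even_add_one]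
    split_ifs <;> norm_num
  rw [h1, offTime, ← intervalIntegral.integral_add_adjacent_intervals
    (hint _ 0 s) (hint _ s t), add_sub_cancel_left, abs_of_nonneg
    (intervalIntegral.integral_nonneg hst' fun s _ => (ite_mem_Icc _).1)]
  have := intervalIntegral.integral_mono_on (a := (s : ℝ)) (b := t) hst' (hint (N t ω) s t)
    (intervalIntegrable_const (c := (1 : ℝ))) (fun s _ => (ite_mem_Icc _).2)
  simpa using this

end paths

/-! ### The cumulative rate -/

/-- The cumulative rate `∫₀ᵗ lam`. -/
def cumRate (lam : ℝ → ℝ) (t : ℝ) : ℝ := ∫ s in (0 : ℝ)..t, lam s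

section rate
variable {lam : ℝ → ℝ}

theorem intervalIntegrable_rate (hLam : ∀ t, 0 < t → IntegrableOn lam (Ioc 0 t)) {s t : ℝ}
    (hs : 0 ≤ s) (ht : 0 ≤ t) : IntervalIntegrable lam volume s t := by
  have h0 : ∀ {t : ℝ}, 0 ≤ t → IntervalIntegrable lam volume 0 t := by
    intro t ht
    rcases ht.eq_or_lt with rfl | ht
    · exact IntervalIntegrable.refl
    · exact (intervalIntegrable_iff_integrableOn_Ioc_of_le ht.le).2 (hLam t ht)
  exact (h0 hs).symm.trans (h0 ht)

theorem integral_rate_eq_sub (hLam : ∀ t, 0 < t → IntegrableOn lam (Ioc 0 t)) {s t : ℝ}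
    (hs : 0 ≤ s) (ht : 0 ≤ t) : ∫ r in s..t, lam r = cumRate lam t - cumRate lam s := by
  rw [cumRate, cumRate, intervalIntegral.integral_interval_sub_left]
  · exact intervalIntegrable_rate hLam le_rfl ht
  · exact intervalIntegrable_rate hLam le_rfl hs

theorem cumRate_zero : cumRate lam 0 = 0 := intervalIntegral.integral_same

theorem cumRate_mono (hLam : ∀ t, 0 < t → IntegrableOn lam (Ioc 0 t))
    (h0 : ∀ t, 0 < t → 0 ≤ lam t) {s t : ℝ} (hs : 0 ≤ s) (hst : s ≤ t) :
    cumRate lam s ≤ cumRate lam t := by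
  rw [← sub_nonneg, ← integral_rate_eq_sub hLam hs (hs.trans hst),
    intervalIntegral.integral_of_le hst]
  exact setIntegral_nonneg measurableSet_Ioc fun x hx => h0 x (hs.trans_lt hx.1)

theorem cumRate_nonneg (hLam : ∀ t, 0 < t → IntegrableOn lam (Ioc 0 t))
    (h0 : ∀ t, 0 < t → 0 ≤ lam t) {t : ℝ} (ht : 0 ≤ t) : 0 ≤ cumRate lam t := by
  simpa [cumRate_zero] using cumRate_mono hLam h0 le_rfl ht

theorem continuousOn_cumRate (hLam : ∀ t, 0 < t → IntegrableOn lam (Ioc 0 t)) (T : ℝ) :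
    ContinuousOn (cumRate lam) (Icc 0 T) := by
  rcases lt_or_ge T 0 with hT | hT
  · simp [Icc_eq_empty (not_le.2 hT)]
  have := intervalIntegral.continuousOn_primitive_interval (μ := volume) (f := lam) (a := 0) (b := T)
    (by rw [uIcc_of_le hT, integrableOn_Icc_iff_integrableOn_Ioc]
        exact (intervalIntegrable_iff_integrableOn_Ioc_of_le hT).1
          (intervalIntegrable_rate hLam le_rfl hT))
  rwa [uIcc_of_le hT] at this

theorem hasDerivAt_cumRate (hLam : ∀ t, 0 < t → IntegrableOn lam (Ioc 0 t))
    (hc : ContinuousOn lam (Ioi 0)) {t : ℝ} (ht : 0 < t) :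
    HasDerivAt (cumRate lam) (lam t) t :=
  intervalIntegral.integral_hasDerivAt_right (intervalIntegrable_rate hLam le_rfl ht.le)
    (hc.stronglyMeasurableAtFilter isOpen_Ioi t ht) (hc.continuousAt (Ioi_mem_nhds ht))

end rate

theorem measurable_pair_offTime {Ω : Type*} {N : ℝ≥0 → Ω → ℕ} [MeasurableSpace Ω] {t : ℝ≥0}
    (hmeas : ∀ s ≤ t, Measurable (N s))
    (hright : ∀ ω t, ContinuousWithinAt (fun s => N s ω) (Ici t) t) :
    Measurable (fun ω => (N t ω, offTime N t ω)) :=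
  (hmeas t le_rfl).prodMk (measurable_offTime hmeas hright)

/-! ### Short-time probabilities and conditioning on the past -/

section law
variable {Ω : Type*} [MeasurableSpace Ω] {P : Measure Ω} {lam : ℝ → ℝ}
  {N : ℝ≥0 → Ω → ℕ}

theorem IsPoissonProcess.measureReal_sub_eq (hN : IsPoissonProcess P lam N)
    (hLam : ∀ t, 0 < t → IntegrableOn lam (Ioc 0 t)) (h0 : ∀ t, 0 < t → 0 ≤ lam t)
    {s t : ℝ≥0} (hst : s ≤ t) (k : ℕ) :
    P.real {ω | N t ω - N s ω = k} = Real.exp (-(cumRate lam t - cumRate lam s))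
      * (cumRate lam t - cumRate lam s) ^ k / k.factorial := by
  have := (hN.law s t hst).measureReal_eq (p := fun n => n = k) (MeasurableSet.of_discrete)
  rw [this]
  simp only [ofPred_eq_eq_singleton]
  rw [poissonMeasure_real_singleton, integral_rate_eq_sub hLam s.coe_nonneg t.coe_nonneg, Real.coe_toNNReal]
  exact sub_nonneg.2 (cumRate_mono hLam h0 s.2 hst)

theorem IsPoissonProcess.measureReal_eq (hN : IsPoissonProcess P lam N)
    (hLam : ∀ t, 0 < t → IntegrableOn lam (Ioc 0 t)) (h0 : ∀ t, 0 < t → 0 ≤ lam t)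
    (t : ℝ≥0) (k : ℕ) :
    P.real {ω | N t ω = k} = Real.exp (-(cumRate lam t)) * cumRate lam t ^ k / k.factorial := by
  simpa [hN.zero, cumRate_zero] using hN.measureReal_sub_eq hLam h0 (zero_le (a := t)) k

variable [IsProbabilityMeasure P]

theorem IsPoissonProcess.measureReal_one_le_sub (hN : IsPoissonProcess P lam N)
    (hLam : ∀ t, 0 < t → IntegrableOn lam (Ioc 0 t)) (h0 : ∀ t, 0 < t → 0 ≤ lam t)
    {s t : ℝ≥0} (hst : s ≤ t) :
    P.real {ω | 1 ≤ N t ω - N s ω} ≤ cumRate lam t - cumRate lam s := by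
  have hm := (hN.measurable t).sub (hN.measurable s)
  have hm0 : MeasurableSet {ω | N t ω - N s ω = 0} := hm (MeasurableSet.of_discrete (s := {0}))
  have h1 : {ω | 1 ≤ N t ω - N s ω} = {ω | N t ω - N s ω = 0}ᶜ := by
    ext ω; simp only [mem_ofPred_eq, mem_compl_iff]; omega
  rw [h1, probReal_compl_eq_one_sub hm0,
    hN.measureReal_sub_eq hLam h0 hst]
  have := Real.add_one_le_exp (-(cumRate lam t - cumRate lam s))
  simp only [pow_zero, mul_one, Nat.factorial_zero, Nat.cast_one, div_one]
  linarith

theorem IsPoissonProcess.measureReal_two_le_sub (hN : IsPoissonProcess P lam N)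
    (hLam : ∀ t, 0 < t → IntegrableOn lam (Ioc 0 t)) (h0 : ∀ t, 0 < t → 0 ≤ lam t)
    {s t : ℝ≥0} (hst : s ≤ t) :
    P.real {ω | 2 ≤ N t ω - N s ω} ≤ (cumRate lam t - cumRate lam s) ^ 2 := by
  have hm := (hN.measurable t).sub (hN.measurable s)
  have h1 : {ω | 2 ≤ N t ω - N s ω} = ({ω | N t ω - N s ω = 0} ∪ {ω | N t ω - N s ω = 1})ᶜ := by
    ext ω; simp only [mem_ofPred_eq, mem_compl_iff, mem_union]; omega
  have hm0 : MeasurableSet {ω | N t ω - N s ω = 0} := hm (MeasurableSet.of_discrete (s := {0}))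
  have hm1 : MeasurableSet {ω | N t ω - N s ω = 1} := hm (MeasurableSet.of_discrete (s := {1}))
  rw [h1, probReal_compl_eq_one_sub (hm0.union hm1), measureReal_union _ hm1,
    hN.measureReal_sub_eq hLam h0 hst, hN.measureReal_sub_eq hLam h0 hst]
  -- From `exp (-r) ≥ 1 - r` follows `1 - exp (-r) * (1 + r) ≤ 1 - (1 - r) * (1 + r) = r ^ 2`.
  · have h2 := Real.add_one_le_exp (-(cumRate lam t - cumRate lam s))
    have h3 := cumRate_mono hLam h0 s.2 hst
    set r := cumRate lam t - cumRate lam s with hr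
    have hr0 : 0 ≤ r := sub_nonneg.2 h3
    simp only [pow_zero, mul_one, Nat.factorial_zero, Nat.cast_one, div_one, Nat.factorial_one,
      pow_one]
    nlinarith
  · rw [Set.disjoint_left]
    intro ω h h'
    simp only [mem_ofPred_eq] at h h'
    omega

theorem IsPoissonProcess.setIntegral_past (hN : IsPoissonProcess P lam N) {s t : ℝ≥0}
    (hst : s ≤ t) (k : ℕ) {F : ℕ × ℝ → ℝ} (hF : Measurable F) :
    ∫ ω in {ω | N t ω - N s ω = k}, F (N s ω, offTime N s ω) ∂P
      = P.real {ω | N t ω - N s ω = k} * ∫ ω, F (N s ω, offTime N s ω) ∂P := by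
  have hind := hN.indep.indepFun_past hN.measurable hN.zero hN.mono hst
  -- Measurability is taken for the σ-algebra generated by the path up to time `s`, from which the
  -- increment is independent.
  have hpair := @measurable_pair_offTime Ω N
    (MeasurableSpace.comap (fun ω (s' : Iic s) => N s' ω) inferInstance) s
    (fun s' hs' => (measurable_pi_apply (X := fun _ => ℕ) (⟨s', hs'⟩ : Iic s)).comp
      (comap_measurable (fun ω (s' : Iic s) => N s' ω))) hN.rightCts
  have hi2 : Indep (MeasurableSpace.comap (fun ω => N t ω - N s ω) inferInstance)
      (MeasurableSpace.comap (fun ω => (N s ω, offTime N s ω)) inferInstance) P :=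
    indep_of_indep_of_le_right hind.symm hpair.comap_le
  exact Indep.setIntegral_eq_mul
    ((hN.measurable t).sub (hN.measurable s)).comap_le hi2
    (measurable_pair_offTime (fun s' _ => hN.measurable s') hN.rightCts).aemeasurable
    ⟨{k}, MeasurableSet.of_discrete, rfl⟩ hF.aestronglyMeasurable

end law

/-- The expectation of `g (offTime N t)` on the event `N t = n`. -/
def levelMean {Ω : Type*} [MeasurableSpace Ω] (P : Measure Ω) (N : ℝ≥0 → Ω → ℕ) (n : ℕ)
    (g : ℝ → ℝ) (t : ℝ≥0) : ℝ :=
  ∫ ω, (if N t ω = n then g (offTime N t ω) else 0) ∂P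

/-! ### One short time step -/

section recursion
variable {Ω : Type*} [MeasurableSpace Ω] {P : Measure Ω} {lam : ℝ → ℝ}
  {N : ℝ≥0 → Ω → ℕ}

theorem measurable_level (n : ℕ) {g : ℝ → ℝ} (hg : Measurable g) :
    Measurable fun p : ℕ × ℝ => if p.1 = n then g p.2 else 0 :=
  Measurable.ite (measurable_fst (MeasurableSet.of_discrete (s := {n}))) (hg.comp measurable_snd)
    measurable_const

theorem IsPoissonProcess.measurable_level (hN : IsPoissonProcess P lam N) (t : ℝ≥0) (n : ℕ)
    {g : ℝ → ℝ} (hg : Measurable g) :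
    Measurable fun ω => if N t ω = n then g (offTime N t ω) else 0 :=
  (OrthogonalMotion.measurable_level n hg).comp
    (measurable_pair_offTime (fun s _ => hN.measurable s) hN.rightCts)

variable [IsProbabilityMeasure P]

theorem IsPoissonProcess.integrable_level (hN : IsPoissonProcess P lam N) (t : ℝ≥0) (n : ℕ)
    {g : ℝ → ℝ} (hg : Measurable g) {C : ℝ} (hC : ∀ x, |g x| ≤ C) :
    Integrable (fun ω => if N t ω = n then g (offTime N t ω) else 0) P := by
  refine Integrable.of_bound (hN.measurable_level t n hg).aestronglyMeasurable C
    (Eventually.of_forall fun ω => ?_)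
  split_ifs
  · exact hC _
  · simpa using (abs_nonneg _).trans (hC 0)

/-- Comparison of the values at two times of the mean of a time-dependent test function. -/
theorem IsPoissonProcess.abs_levelMean_sub_le (hN : IsPoissonProcess P lam N)
    (hLam : ∀ t, 0 < t → IntegrableOn lam (Ioc 0 t)) (h0 : ∀ t, 0 < t → 0 ≤ lam t) (n : ℕ)
    {g g' : ℝ → ℝ} (hg : Measurable g) (hg' : Measurable g') {C D : ℝ} (hC : ∀ x, |g x| ≤ C)
    (hC' : ∀ x, |g' x| ≤ C) (hD : ∀ x, |g' x - g x| ≤ D) {s t : ℝ≥0} (hst : s ≤ t) :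
    |levelMean P N n g' t - levelMean P N n g s|
      ≤ D + 2 * C * (cumRate lam t - cumRate lam s) := by
  have hC0 : 0 ≤ C := (abs_nonneg _).trans (hC 0)
  have hD0 : 0 ≤ D := (abs_nonneg _).trans (hD 0)
  have hm : MeasurableSet {ω | 1 ≤ N t ω - N s ω} :=
    ((hN.measurable t).sub (hN.measurable s)) (MeasurableSet.of_discrete (s := {k | 1 ≤ k}))
  rw [levelMean, levelMean, ← integral_sub (hN.integrable_level t n hg' hC')
    (hN.integrable_level s n hg hC)]
  have hb : Integrable (fun ω => D + {ω | 1 ≤ N t ω - N s ω}.indicator (fun _ => 2 * C) ω) P :=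
    (integrable_const D).add ((integrable_const (2 * C)).indicator hm)
  have h1 := norm_integral_le_of_norm_le (μ := P) hb (f := fun ω =>
    (if N t ω = n then g' (offTime N t ω) else 0) - (if N s ω = n then g (offTime N s ω) else 0))
    (Eventually.of_forall fun ω => by
      have hmo : N s ω ≤ N t ω := hN.mono ω hst
      -- Without an event in `(s, t]` neither the level nor the off time moves, so only the change
      -- of test function counts. An event has probability at most the increment of `cumRate`, and
      -- there the crude bound `2 * C` is enough.
      by_cases h : 1 ≤ N t ω - N s ω
      · rw [indicator_of_mem (by exact h)]
        refine (norm_sub_le _ _).trans ?_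
        have a1 : ‖if N t ω = n then g' (offTime N t ω) else 0‖ ≤ C := by
          split_ifs
          · exact hC' _
          · simpa using hC0
        have a2 : ‖if N s ω = n then g (offTime N s ω) else 0‖ ≤ C := by
          split_ifs
          · exact hC _
          · simpa using hC0
        linarith
      · rw [indicator_of_notMem (by exact h), add_zero]
        have he : N t ω = N s ω := by omega
        rw [offTime_eq_of_eq hN.measurable hN.rightCts hN.mono hst he, he]
        split_ifs
        · exact hD _
        · simpa using hD0)
  refine h1.trans ?_
  rw [integral_add (integrable_const D) ((integrable_const (2 * C)).indicator hm),
    integral_indicator hm]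
  simp only [integral_const, probReal_univ, smul_eq_mul, measureReal_restrict_apply_univ]
  have := hN.measureReal_one_le_sub hLam h0 hst
  nlinarith

/-- The expectation is split by the number of events in `(s, t]`. With none, the value at `s`
persists; with one, level `n` moves to `n + 1` and the off time `W` becomes `s - W` up to `t - s`,
which costs `K * (t - s)`; two or more have probability of second order. Multiplication by `exp
(cumRate lam t)` absorbs the probability `exp (-r)` of seeing no event. -/
theorem IsPoissonProcess.abs_exp_mul_levelMean_sub_le (hN : IsPoissonProcess P lam N)
    (hLam : ∀ t, 0 < t → IntegrableOn lam (Ioc 0 t)) (h0 : ∀ t, 0 < t → 0 ≤ lam t) (n : ℕ)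
    {g : ℝ → ℝ} (hg : Measurable g) {C K : ℝ} (hC : ∀ x, |g x| ≤ C)
    (hK : ∀ x y, |g x - g y| ≤ K * |x - y|) {s t : ℝ≥0} (hst : s ≤ t) :
    |Real.exp (cumRate lam t) * levelMean P N (n + 1) g t
        - Real.exp (cumRate lam s) * levelMean P N (n + 1) g s
        - (cumRate lam t - cumRate lam s) *
          (Real.exp (cumRate lam s) * levelMean P N n (fun x => g (s - x)) s)|
      ≤ Real.exp (cumRate lam t) * (K * (t - s) * (cumRate lam t - cumRate lam s)
        + C * (cumRate lam t - cumRate lam s) ^ 2) := by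
  have hC0 : 0 ≤ C := (abs_nonneg _).trans (hC 0)
  have hK0 : 0 ≤ K := by simpa using (abs_nonneg _).trans (hK 1 0)
  have hts : (0 : ℝ) ≤ t - s := sub_nonneg.2 (by exact_mod_cast hst)
  have hsub := (hN.measurable t).sub (hN.measurable s)
  have hm : ∀ S : Set ℕ, MeasurableSet {ω | N t ω - N s ω ∈ S} := fun S =>
    hsub (MeasurableSet.of_discrete (s := S))
  have hg' : Measurable fun x => g (s - x) := hg.comp (by fun_prop)
  set F₀ : ℕ × ℝ → ℝ := fun p => if p.1 = n + 1 then g p.2 else 0 with hF₀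
  set F₁ : ℕ × ℝ → ℝ := fun p => if p.1 = n then g (s - p.2) else 0 with hF₁
  have hi₀ : Integrable (fun ω => F₀ (N s ω, offTime N s ω)) P := hN.integrable_level s (n + 1) hg hC
  have hi₁ : Integrable (fun ω => F₁ (N s ω, offTime N s ω)) P :=
    hN.integrable_level s n hg' (fun x => hC _)
  have e₀ := hN.setIntegral_past hst 0 (OrthogonalMotion.measurable_level (n + 1) hg)
  have e₁ := hN.setIntegral_past hst 1 (OrthogonalMotion.measurable_level n hg')
  have hA0 : MeasurableSet {ω | N t ω - N s ω = 0} := hm {0}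
  have hA1 : MeasurableSet {ω | N t ω - N s ω = 1} := hm {1}
  have hA2 : MeasurableSet {ω | 2 ≤ N t ω - N s ω} := hm {k | 2 ≤ k}
  rw [← integral_indicator hA0] at e₀
  rw [← integral_indicator hA1] at e₁
  rw [hN.measureReal_sub_eq hLam h0 hst] at e₀ e₁
  simp only [pow_zero, pow_one, mul_one, Nat.factorial_zero, Nat.factorial_one, Nat.cast_one,
    div_one] at e₀ e₁
  set r := cumRate lam t - cumRate lam s with hr
  have hr0 : 0 ≤ r := sub_nonneg.2 (cumRate_mono hLam h0 s.2 hst)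
  have key : |levelMean P N (n + 1) g t - Real.exp (-r) * levelMean P N (n + 1) g s
      - Real.exp (-r) * r * levelMean P N n (fun x => g (s - x)) s| ≤ K * (t - s) * r + C * r ^ 2 := by
    have hP1 : P.real {ω | N t ω - N s ω = 1} ≤ r := by
      refine (measureReal_mono ?_).trans (hN.measureReal_one_le_sub hLam h0 hst)
      intro ω hω
      simp only [mem_ofPred_eq] at hω ⊢
      omega
    have hP2 := hN.measureReal_two_le_sub hLam h0 hst
    have hb1 : Integrable ({ω | N t ω - N s ω = 1}.indicator (fun _ : Ω => K * ((t : ℝ) - s))) P :=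
      (integrable_const _).indicator hA1
    have hb2 : Integrable ({ω | 2 ≤ N t ω - N s ω}.indicator (fun _ : Ω => C)) P :=
      (integrable_const _).indicator hA2
    have hE : levelMean P N (n + 1) g t - Real.exp (-r) * levelMean P N (n + 1) g s
      - Real.exp (-r) * r * levelMean P N n (fun x => g (s - x)) s =
      ∫ ω, ((if N t ω = n + 1 then g (offTime N t ω) else 0)
        - {ω | N t ω - N s ω = 0}.indicator (fun ω => F₀ (N s ω, offTime N s ω)) ω
        - {ω | N t ω - N s ω = 1}.indicator (fun ω => F₁ (N s ω, offTime N s ω)) ω) ∂P := by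
      have hi₂ : Integrable (fun ω => (if N t ω = n + 1 then g (offTime N t ω) else 0)
          - {ω | N t ω - N s ω = 0}.indicator (fun ω => F₀ (N s ω, offTime N s ω)) ω) P :=
        (hN.integrable_level t (n + 1) hg hC).sub (hi₀.indicator hA0)
      rw [integral_sub hi₂ (hi₁.indicator hA1), integral_sub (hN.integrable_level t (n + 1) hg hC)
        (hi₀.indicator hA0)]
      rw [show (∫ ω, {ω | N t ω - N s ω = 0}.indicator (fun ω => F₀ (N s ω, offTime N s ω)) ω ∂P)
        = _ from e₀, show (∫ ω, {ω | N t ω - N s ω = 1}.indicator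
        (fun ω => F₁ (N s ω, offTime N s ω)) ω ∂P) = _ from e₁]
      rfl
    rw [hE]
    have h1 := norm_integral_le_of_norm_le (μ := P) (hb1.add hb2) (f := fun ω =>
      (if N t ω = n + 1 then g (offTime N t ω) else 0)
        - {ω | N t ω - N s ω = 0}.indicator (fun ω => F₀ (N s ω, offTime N s ω)) ω
        - {ω | N t ω - N s ω = 1}.indicator (fun ω => F₁ (N s ω, offTime N s ω)) ω)
      (Eventually.of_forall fun ω => by
        have hmo : N s ω ≤ N t ω := hN.mono ω hst
        simp only [Pi.add_apply, indicator, mem_ofPred_eq, hF₀, hF₁]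
        rcases (show N t ω - N s ω = 0 ∨ N t ω - N s ω = 1 ∨ 2 ≤ N t ω - N s ω by omega)
          with h | h | h
        · have he : N t ω = N s ω := by omega
          rw [offTime_eq_of_eq hN.measurable hN.rightCts hN.mono hst he, he]
          simp
        · have he : N t ω = N s ω + 1 := by omega
          have hw := abs_offTime_sub_le hN.measurable hN.rightCts hst he
          simp only [he, add_tsub_cancel_left, one_ne_zero, if_false, if_true, sub_zero,
            add_left_inj, Nat.not_ofNat_le_one, add_zero]
          split_ifs
          · exact (hK _ _).trans (mul_le_mul_of_nonneg_left hw hK0)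
          · simpa using mul_nonneg hK0 hts
        · simp only [show ¬ N t ω - N s ω = 0 by omega, show ¬ N t ω - N s ω = 1 by omega, h,
            if_false, if_true, sub_zero, zero_add]
          split_ifs
          · exact hC _
          · simpa using hC0)
    refine h1.trans ?_
    rw [show (∫ a, ({ω | N t ω - N s ω = 1}.indicator (fun _ : Ω => K * ((t : ℝ) - s))
      + {ω | 2 ≤ N t ω - N s ω}.indicator (fun _ : Ω => C)) a ∂P) = _ from integral_add hb1 hb2,
      integral_indicator hA1, integral_indicator hA2]
    simp only [integral_const, smul_eq_mul, measureReal_restrict_apply_univ]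
    have := mul_le_mul_of_nonneg_left hP1 (mul_nonneg hK0 hts)
    have := mul_le_mul_of_nonneg_left hP2 hC0
    linarith
  have hexp : Real.exp (cumRate lam s) = Real.exp (cumRate lam t) * Real.exp (-r) := by
    rw [← Real.exp_add]; congr 1; rw [hr]; ring
  have : Real.exp (cumRate lam t) * levelMean P N (n + 1) g t
        - Real.exp (cumRate lam s) * levelMean P N (n + 1) g s
        - r * (Real.exp (cumRate lam s) * levelMean P N n (fun x => g (s - x)) s) =
      Real.exp (cumRate lam t) * (levelMean P N (n + 1) g t - Real.exp (-r) * levelMean P N (n + 1) g s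
      - Real.exp (-r) * r * levelMean P N n (fun x => g (s - x)) s) := by
    rw [hexp]; ring
  rw [this, abs_mul, abs_of_pos (Real.exp_pos _)]
  exact mul_le_mul_of_nonneg_left key (Real.exp_pos _).le

end recursion

/-! ### Integrated recursion over the number of events -/

section integralEquation
variable {Ω : Type*} [MeasurableSpace Ω] {P : Measure Ω} [IsProbabilityMeasure P] {lam : ℝ → ℝ}
  {N : ℝ≥0 → Ω → ℕ}

theorem continuousOn_of_abs_sub_le {A ψ : ℝ → ℝ} {S : Set ℝ} (hA : ContinuousOn A S) {K C : ℝ}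
    (h : ∀ s ∈ S, ∀ t ∈ S, s ≤ t → |ψ t - ψ s| ≤ K * (t - s) + C * (A t - A s)) :
    ContinuousOn ψ S := by
  intro s hs
  have h1 : Tendsto (fun t => |K * (t - s) + C * (A t - A s)|) (𝓝[S] s) (𝓝 0) := by
    have : Tendsto (fun t => |K * (t - s) + C * (A t - A s)|) (𝓝[S] s)
        (𝓝 |K * (s - s) + C * (A s - A s)|) := by
      refine Tendsto.abs (Tendsto.add ?_ ?_)
      · exact ((continuous_const.mul (continuous_id.sub continuous_const)).tendsto s).mono_left
          nhdsWithin_le_nhds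
      · exact ((hA s hs).sub tendsto_const_nhds).const_mul C
    simpa using this
  rw [ContinuousWithinAt, tendsto_iff_norm_sub_tendsto_zero]
  refine squeeze_zero' (Eventually.of_forall fun _ => norm_nonneg _) ?_ h1
  filter_upwards [self_mem_nhdsWithin] with t ht
  rcases le_total s t with hst | hst
  · exact (h s hs t ht hst).trans (le_abs_self _)
  · rw [norm_sub_rev]
    refine (h t ht s hs hst).trans ?_
    rw [← abs_neg]
    exact (le_of_eq (by ring)).trans (le_abs_self _)

theorem IsPoissonProcess.continuousOn_levelMean (hN : IsPoissonProcess P lam N)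
    (hLam : ∀ t, 0 < t → IntegrableOn lam (Ioc 0 t)) (h0 : ∀ t, 0 < t → 0 ≤ lam t) (n : ℕ)
    {g : ℝ → ℝ → ℝ} (hg : ∀ s, Measurable (g s)) {C K : ℝ} (hC : ∀ s x, |g s x| ≤ C)
    (hK : ∀ s t x, |g t x - g s x| ≤ K * |t - s|) (T : ℝ) :
    ContinuousOn (fun t : ℝ => levelMean P N n (g t) t.toNNReal) (Icc 0 T) := by
  refine continuousOn_of_abs_sub_le (continuousOn_cumRate hLam T) (K := K) (C := 2 * C) ?_
  intro s hs t ht hst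
  have := hN.abs_levelMean_sub_le hLam h0 n (hg s) (hg t) (hC s) (hC t)
    (fun x => hK s t x) (Real.toNNReal_le_toNNReal hst)
  rwa [Real.coe_toNNReal _ hs.1, Real.coe_toNNReal _ ht.1, abs_of_nonneg (sub_nonneg.2 hst)] at this

/-- The remainder in the one-step estimate is a factor tending to `0` times the increment of
`cumRate`, hence `o(t - s)`. Only a right derivative results, because conditioning goes forward in
time; together with continuity this is enough to integrate. -/
theorem IsPoissonProcess.hasDerivWithinAt_levelMean (hN : IsPoissonProcess P lam N)
    (hLam : ∀ t, 0 < t → IntegrableOn lam (Ioc 0 t)) (h0 : ∀ t, 0 < t → 0 ≤ lam t)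
    (hc : ContinuousOn lam (Ioi 0)) (n : ℕ) {g : ℝ → ℝ} (hg : Measurable g) {C K : ℝ}
    (hC : ∀ x, |g x| ≤ C) (hK : ∀ x y, |g x - g y| ≤ K * |x - y|) {s : ℝ} (hs : 0 < s) :
    HasDerivWithinAt (fun t => Real.exp (cumRate lam t) * levelMean P N (n + 1) g t.toNNReal)
      (lam s * (Real.exp (cumRate lam s) * levelMean P N n (fun x => g (s - x)) s.toNNReal))
      (Ici s) s := by
  set A := cumRate lam with hA
  set a := Real.exp (A s) * levelMean P N n (fun x => g (s - x)) s.toNNReal with ha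
  have hdA : HasDerivAt A (lam s) s := hasDerivAt_cumRate hLam hc hs
  have hlin : HasDerivWithinAt (fun t => (A t - A s) * a) (lam s * a) (Ici s) s :=
    ((hdA.sub_const _).mul_const a).hasDerivWithinAt
  have hrem : HasDerivWithinAt (fun t => Real.exp (A t) * levelMean P N (n + 1) g t.toNNReal
      - Real.exp (A s) * levelMean P N (n + 1) g s.toNNReal - (A t - A s) * a) 0 (Ici s) s := by
    rw [hasDerivWithinAt_iff_isLittleO]
    simp only [sub_self, zero_mul, sub_zero, smul_zero]
    have hbig : (fun t => A t - A s) =O[𝓝[Ici s] s] fun t => t - s :=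
      hdA.isBigO_sub.mono nhdsWithin_le_nhds
    have hsmall : (fun t => Real.exp (A t) * (K * (t - s) + C * (A t - A s))) =o[𝓝[Ici s] s]
        fun _ => (1 : ℝ) := by
      rw [Asymptotics.isLittleO_one_iff]
      have hcA : ContinuousAt A s := hdA.continuousAt
      have : ContinuousAt (fun t => Real.exp (A t) * (K * (t - s) + C * (A t - A s))) s := by
        fun_prop
      have h2 := this.tendsto
      simp only [sub_self, mul_zero, add_zero] at h2
      exact h2.mono_left nhdsWithin_le_nhds
    refine Asymptotics.IsBigO.trans_isLittleO (g := fun t =>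
      (Real.exp (A t) * (K * (t - s) + C * (A t - A s))) * (A t - A s)) ?_ ?_
    · refine Asymptotics.IsBigO.of_bound 1 ?_
      filter_upwards [self_mem_nhdsWithin] with t ht
      have ht' : s ≤ t := ht
      have := hN.abs_exp_mul_levelMean_sub_le hLam h0 n hg hC hK (Real.toNNReal_le_toNNReal ht')
      rw [Real.coe_toNNReal _ hs.le, Real.coe_toNNReal _ (hs.le.trans ht')] at this
      rw [one_mul]
      refine this.trans (le_trans (le_of_eq ?_) (le_abs_self _))
      ring
    · simpa using hsmall.mul_isBigO hbig
  have := (hrem.add hlin).add_const (Real.exp (A s) * levelMean P N (n + 1) g s.toNNReal)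
  rw [zero_add] at this
  refine this.congr (fun t _ => ?_) ?_ <;> simp

/-- First-order recursion over the number of events, obtained by conditioning on the last one. -/
theorem IsPoissonProcess.levelMean_succ (hN : IsPoissonProcess P lam N)
    (hLam : ∀ t, 0 < t → IntegrableOn lam (Ioc 0 t)) (h0 : ∀ t, 0 < t → 0 ≤ lam t)
    (hc : ContinuousOn lam (Ioi 0)) (n : ℕ) {g : ℝ → ℝ} (hg : Measurable g) {C K : ℝ}
    (hC : ∀ x, |g x| ≤ C) (hK : ∀ x y, |g x - g y| ≤ K * |x - y|) {T : ℝ} (hT : 0 < T) :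
    Real.exp (cumRate lam T) * levelMean P N (n + 1) g T.toNNReal = ∫ s in (0 : ℝ)..T, lam s *
      (Real.exp (cumRate lam s) * levelMean P N n (fun x => g (s - x)) s.toNNReal) := by
  set A := cumRate lam with hA
  set b : ℝ → ℝ := fun t => Real.exp (A t) * levelMean P N (n + 1) g t.toNNReal with hb
  set a : ℝ → ℝ := fun s => Real.exp (A s) * levelMean P N n (fun x => g (s - x)) s.toNNReal with ha
  have hAc : ContinuousOn A (Icc 0 T) := continuousOn_cumRate hLam T
  have hbc : ContinuousOn b (Icc 0 T) := by
    refine (Real.continuous_exp.comp_continuousOn hAc).mul ?_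
    exact hN.continuousOn_levelMean hLam h0 (n + 1) (g := fun _ => g) (fun _ => hg)
      (fun _ => hC) (K := 0) (by simp) T
  have hac : ContinuousOn a (Icc 0 T) := by
    refine (Real.continuous_exp.comp_continuousOn hAc).mul ?_
    refine hN.continuousOn_levelMean hLam h0 n (g := fun t x => g (t - x))
      (fun t => hg.comp (by fun_prop)) (fun _ _ => hC _) (K := K) (fun s t x => ?_) T
    simpa using hK (t - x) (s - x)
  have hint : ∀ t ∈ Icc 0 T, IntervalIntegrable (fun s => lam s * a s) volume 0 t := by
    intro t ht
    refine (intervalIntegrable_rate hLam le_rfl ht.1).mul_continuousOn ?_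
    rw [uIcc_of_le ht.1]
    exact hac.mono (Icc_subset_Icc_right ht.2)
  set D : ℝ → ℝ := fun t => b t - ∫ s in (0 : ℝ)..t, lam s * a s with hD
  have hDc : ContinuousOn D (Icc 0 T) := by
    refine hbc.sub ?_
    have := intervalIntegral.continuousOn_primitive_interval (μ := volume)
      (f := fun s => lam s * a s) (a := 0) (b := T)
      (by rw [uIcc_of_le hT.le, integrableOn_Icc_iff_integrableOn_Ioc]
          exact (intervalIntegrable_iff_integrableOn_Ioc_of_le hT.le).1
            (hint T (right_mem_Icc.2 hT.le)))
    rwa [uIcc_of_le hT.le] at this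
  have hderiv : ∀ t ∈ Ioo 0 T, HasDerivWithinAt D 0 (Ici t) t := by
    intro t ht
    have hct : ContinuousOn (fun s => lam s * a s) (Ioo 0 T) :=
      (hc.mono Ioo_subset_Ioi_self).mul (hac.mono Ioo_subset_Icc_self)
    have h1 : HasDerivAt (fun t => ∫ s in (0 : ℝ)..t, lam s * a s) (lam t * a t) t :=
      intervalIntegral.integral_hasDerivAt_right (hint t (Ioo_subset_Icc_self ht))
        (hct.stronglyMeasurableAtFilter isOpen_Ioo t ht) (hct.continuousAt (isOpen_Ioo.mem_nhds ht))
    have h2 := (hN.hasDerivWithinAt_levelMean hLam h0 hc n hg hC hK ht.1).sub h1.hasDerivWithinAt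
    rwa [sub_self] at h2
  -- The derivative is known only at positive times, as `lam` may be unbounded near `0`. So `D` is
  -- first shown constant on each `[δ, T]`, and `δ → 0` then uses the continuity of `D` at `0`.
  have hconst : ∀ δ ∈ Ioo 0 T, D T = D δ := by
    intro δ hδ
    refine constant_of_has_deriv_right_zero (hDc.mono (Icc_subset_Icc_left hδ.1.le))
      (fun t ht => hderiv t ⟨hδ.1.trans_le ht.1, ht.2⟩) T (right_mem_Icc.2 hδ.2.le)
  -- There is no event at time `0`, so the level `n + 1` is empty there.
  have h00 : D 0 = 0 := by
    have : levelMean P N (n + 1) g 0 = 0 := by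
      simp [levelMean, hN.zero]
    simp [hD, hb, this]
  have hlim : Tendsto D (𝓝[Ioo 0 T] 0) (𝓝 (D 0)) :=
    (hDc 0 (left_mem_Icc.2 hT.le)).mono Ioo_subset_Icc_self
  have hlim2 : Tendsto D (𝓝[Ioo 0 T] 0) (𝓝 (D T)) := by
    refine tendsto_const_nhds.congr' ?_
    filter_upwards [self_mem_nhdsWithin] with δ hδ using hconst δ hδ
  have : (𝓝[Ioo 0 T] (0 : ℝ)).NeBot := left_nhdsWithin_Ioo_neBot hT
  have hfin := tendsto_nhds_unique hlim2 hlim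
  rw [h00] at hfin
  exact sub_eq_zero.1 hfin

end integralEquation

/-! ### The law of the off time at each level -/

theorem lintegral_Ioo_reflect (s : ℝ) (f : ℝ → ℝ≥0∞) :
    ∫⁻ w in Ioo 0 s, f (s - w) = ∫⁻ w in Ioo 0 s, f w := by
  rw [← lintegral_indicator measurableSet_Ioo, ← lintegral_indicator measurableSet_Ioo,
    ← lintegral_sub_left_eq_self _ s]
  congr 1
  ext w
  simp only [indicator, mem_Ioo, sub_sub_cancel]
  congr 1
  simp only [eq_iff_iff]
  constructor <;> rintro ⟨h1, h2⟩ <;> constructor <;> linarith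

/-- Tonelli on the triangle `0 < w < s < t`, followed by the translation `s = w + x`. -/
theorem lintegral_triangle_swap (t : ℝ) {F : ℝ → ℝ → ℝ≥0∞}
    (hF : Measurable fun p : ℝ × ℝ => F p.1 p.2) :
    ∫⁻ s in Ioo 0 t, ∫⁻ w in Ioo 0 s, F s w
      = ∫⁻ w in Ioo 0 t, ∫⁻ x in Ioo 0 (t - w), F (w + x) w := by
  have hS : MeasurableSet {p : ℝ × ℝ | 0 < p.2 ∧ p.2 < p.1 ∧ p.1 < t} :=
    (measurableSet_lt measurable_const measurable_snd).inter
      ((measurableSet_lt measurable_snd measurable_fst).inter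
        (measurableSet_lt measurable_fst measurable_const))
  have h1 : ∫⁻ s in Ioo 0 t, ∫⁻ w in Ioo 0 s, F s w
      = ∫⁻ s, ∫⁻ w, {p : ℝ × ℝ | 0 < p.2 ∧ p.2 < p.1 ∧ p.1 < t}.indicator
        (fun p => F p.1 p.2) (s, w) := by
    rw [← lintegral_indicator measurableSet_Ioo]
    refine lintegral_congr fun s => ?_
    by_cases hs : s ∈ Ioo 0 t
    · rw [indicator_of_mem hs, ← lintegral_indicator measurableSet_Ioo]
      refine lintegral_congr fun w => ?_
      simp [indicator, hs.2]
    · rw [indicator_of_notMem hs]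
      symm
      rw [lintegral_eq_zero_iff' (by
        exact ((hF.indicator hS).comp measurable_prodMk_left).aemeasurable)]
      refine Eventually.of_forall fun w => ?_
      simp only [Pi.zero_apply]
      refine indicator_of_notMem ?_ _
      rintro ⟨a, b, c⟩
      exact hs ⟨lt_trans a b, c⟩
  rw [h1, lintegral_lintegral_swap (f := fun s w =>
    {p : ℝ × ℝ | 0 < p.2 ∧ p.2 < p.1 ∧ p.1 < t}.indicator (fun p => F p.1 p.2) (s, w))
    (hF.indicator hS).aemeasurable,
    ← lintegral_indicator measurableSet_Ioo]
  refine lintegral_congr fun w => ?_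
  rw [← lintegral_add_left_eq_self _ w]
  by_cases hw : w ∈ Ioo 0 t
  · rw [indicator_of_mem hw, ← lintegral_indicator measurableSet_Ioo]
    refine lintegral_congr fun x => ?_
    simp only [indicator, mem_ofPred_eq, mem_Ioo, hw.1, true_and]
    congr 1
    simp only [eq_iff_iff]
    constructor <;> rintro ⟨h1, h2⟩ <;> constructor <;> linarith
  · rw [indicator_of_notMem hw, lintegral_eq_zero_iff' (by
        exact ((hF.indicator hS).comp (by fun_prop : Measurable fun x : ℝ => (w + x, w))).aemeasurable)]
    refine Eventually.of_forall fun x => ?_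
    simp only [Pi.zero_apply]
    refine indicator_of_notMem ?_ _
    rintro ⟨a, b, c⟩
    exact hw ⟨a, lt_trans b c⟩

theorem measurable_lintegral_Ioo {α : Type*} [MeasurableSpace α] {F : α → ℝ → ℝ≥0∞}
    (hF : Measurable fun p : α × ℝ => F p.1 p.2) {v : α → ℝ} (hv : Measurable v) :
    Measurable fun a => ∫⁻ x in Ioo 0 (v a), F a x := by
  have hS : MeasurableSet {p : α × ℝ | p.2 ∈ Ioo 0 (v p.1)} :=
    (measurableSet_lt measurable_const measurable_snd).inter
      (measurableSet_lt measurable_snd (hv.comp measurable_fst))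
  have := (hF.indicator hS).lintegral_prod_right' (ν := volume)
  convert this using 2 with a
  rw [← lintegral_indicator measurableSet_Ioo]
  rfl

/-- The rate function on `(0, ∞)`, extended by zero, with values in `[0, ∞]`. -/
def rateE (lam : ℝ → ℝ) (s : ℝ) : ℝ≥0∞ := ENNReal.ofReal ((Ioi 0).indicator lam s)

/-- `levelKernel lam n w v` is, up to the factor `exp (-cumRate lam (w + v))`, the density at `w` of
`offTime N (w + v)` on the event `N (w + v) = n + 1`. -/
def levelKernel (lam : ℝ → ℝ) : ℕ → ℝ → ℝ → ℝ≥0∞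
  | 0, w, _ => rateE lam w
  | n + 1, w, v => ∫⁻ x in Ioo 0 v, rateE lam (w + x) * levelKernel lam n x w

section kernel
variable {lam : ℝ → ℝ}

theorem measurable_rateE (hc : ContinuousOn lam (Ioi 0)) : Measurable (rateE lam) := by
  refine ENNReal.measurable_ofReal.comp ?_
  rw [← piecewise_eq_indicator]
  exact hc.measurable_piecewise continuousOn_const measurableSet_Ioi

theorem measurable_levelKernel (hc : ContinuousOn lam (Ioi 0)) (n : ℕ) :
    Measurable fun p : ℝ × ℝ => levelKernel lam n p.1 p.2 := by
  induction n with
  | zero => exact (measurable_rateE hc).comp measurable_fst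
  | succ n ih =>
    refine measurable_lintegral_Ioo (F := fun p x => rateE lam (p.1 + x) * levelKernel lam n x p.1)
      ?_ measurable_snd
    exact ((measurable_rateE hc).comp (by fun_prop)).mul
      (ih.comp (by fun_prop : Measurable fun q : (ℝ × ℝ) × ℝ => (q.2, q.1.1)))

/-- This turns the recursion for means into the recursion for densities: `s` is the time of the last
event and `w` the off time just before it, so the off time afterwards is `s - w`. Reflecting `w`
makes this new off time the variable, and exchanging the integrals leaves the integral over `s` that
defines the next kernel. -/
theorem lintegral_rateE_levelKernel (hc : ContinuousOn lam (Ioi 0)) (n : ℕ) {g : ℝ → ℝ≥0∞}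
    (hg : Measurable g) (t : ℝ) :
    ∫⁻ s in Ioo 0 t, rateE lam s * ∫⁻ w in Ioo 0 s, g (s - w) * levelKernel lam n w (s - w)
      = ∫⁻ w in Ioo 0 t, g w * levelKernel lam (n + 1) w (t - w) := by
  have hr := measurable_rateE hc
  have hk := measurable_levelKernel hc n
  have h1 : ∀ s, rateE lam s * ∫⁻ w in Ioo 0 s, g (s - w) * levelKernel lam n w (s - w)
      = ∫⁻ w in Ioo 0 s, rateE lam s * (g w * levelKernel lam n (s - w) w) := by
    intro s
    rw [← lintegral_Ioo_reflect s (fun w => rateE lam s * (g w * levelKernel lam n (s - w) w)),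
      ← lintegral_const_mul]
    · simp only [sub_sub_cancel]
    · exact (hg.comp (by fun_prop)).mul
        (hk.comp (by fun_prop : Measurable fun w : ℝ => (w, s - w)))
  simp only [h1]
  rw [lintegral_triangle_swap]
  · refine setLIntegral_congr_fun measurableSet_Ioo fun w hw => ?_
    simp only [levelKernel, add_sub_cancel_left]
    rw [← lintegral_const_mul]
    · refine lintegral_congr fun x => ?_
      ring
    · exact (hr.comp (by fun_prop)).mul (hk.comp (by fun_prop : Measurable fun x : ℝ => (x, w)))
  · exact (hr.comp measurable_fst).mul ((hg.comp measurable_snd).mul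
      (hk.comp (by fun_prop : Measurable fun p : ℝ × ℝ => (p.1 - p.2, p.2))))

end kernel

/-- The indicator of a closed set is a limit of thickened indicators, which are Lipschitz, and
closed sets form a generating π-system. Lipschitz test functions are the ones that the one-step
estimate can handle. -/
theorem ext_of_forall_lipschitz {μ ν : Measure ℝ} [IsFiniteMeasure μ]
    (h : ∀ g : ℝ → ℝ, Measurable g → (∀ x, 0 ≤ g x) → (∀ x, g x ≤ 1) →
      (∃ K, ∀ x y, |g x - g y| ≤ K * |x - y|) →
      ∫⁻ x, ENNReal.ofReal (g x) ∂μ = ∫⁻ x, ENNReal.ofReal (g x) ∂ν) : μ = ν := by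
  have huniv : μ univ = ν univ := by
    have := h (fun _ => 1) measurable_const (fun _ => zero_le_one) (fun _ => le_rfl) ⟨0, by simp⟩
    simpa using this
  have : IsFiniteMeasure ν := ⟨by rw [← huniv]; exact measure_lt_top _ _⟩
  refine ext_of_generate_finite {s | IsClosed s}
    ((BorelSpace.measurable_eq (α := ℝ)).trans borel_eq_generateFrom_isClosed) isPiSystem_isClosed
    (fun F hF => ?_) huniv
  have hpos : ∀ n : ℕ, (0 : ℝ) < 1 / ((n : ℝ) + 1) := fun n => by positivity
  refine tendsto_nhds_unique
    (tendsto_lintegral_thickenedIndicator_of_isClosed μ hF hpos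
      tendsto_one_div_add_atTop_nhds_zero_nat)
    ((tendsto_lintegral_thickenedIndicator_of_isClosed ν hF hpos
      tendsto_one_div_add_atTop_nhds_zero_nat).congr fun n => ?_)
  have h1 := h (fun x => (thickenedIndicator (hpos n) F x : ℝ))
    ((thickenedIndicator (hpos n) F).continuous.measurable.coe_nnreal_real)
    (fun x => NNReal.coe_nonneg _) (fun x => by exact_mod_cast thickenedIndicator_le_one (hpos n) F x)
    ⟨_, fun x y => by
      have := (lipschitzWith_thickenedIndicator (hpos n) F).dist_le_mul x y
      rwa [NNReal.dist_eq, Real.dist_eq] at this⟩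
  simpa using h1.symm

theorem IsPoissonProcess.measurableSet_level {Ω : Type*} [MeasurableSpace Ω] {P : Measure Ω}
    {lam : ℝ → ℝ} {N : ℝ≥0 → Ω → ℕ} (hN : IsPoissonProcess P lam N) (t : ℝ≥0) (n : ℕ) :
    MeasurableSet {ω | N t ω = n} :=
  hN.measurable t (MeasurableSet.of_discrete (s := {n}))

section law
variable {Ω : Type*} [MeasurableSpace Ω] {P : Measure Ω} [IsProbabilityMeasure P] {lam : ℝ → ℝ}
  {N : ℝ≥0 → Ω → ℕ}

theorem IsPoissonProcess.ofReal_levelMean_succ (hN : IsPoissonProcess P lam N)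
    (hLam : ∀ t, 0 < t → IntegrableOn lam (Ioc 0 t)) (h0 : ∀ t, 0 < t → 0 ≤ lam t)
    (hc : ContinuousOn lam (Ioi 0)) (n : ℕ) {g : ℝ → ℝ} (hg : Measurable g) {K : ℝ}
    (hg0 : ∀ x, 0 ≤ g x) (hg1 : ∀ x, g x ≤ 1) (hK : ∀ x y, |g x - g y| ≤ K * |x - y|) {t : ℝ}
    (ht : 0 < t) :
    ENNReal.ofReal (Real.exp (cumRate lam t) * levelMean P N (n + 1) g t.toNNReal)
      = ∫⁻ s in Ioo 0 t, rateE lam s * ENNReal.ofReal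
        (Real.exp (cumRate lam s) * levelMean P N n (fun x => g (s - x)) s.toNNReal) := by
  have hC : ∀ x, |g x| ≤ 1 := fun x => by rw [abs_of_nonneg (hg0 x)]; exact hg1 x
  have hnn : ∀ s, 0 ≤ Real.exp (cumRate lam s) * levelMean P N n (fun x => g (s - x)) s.toNNReal :=
    fun s => mul_nonneg (Real.exp_pos _).le (integral_nonneg fun ω => by
      simp only [Pi.zero_apply]
      split_ifs
      · exact hg0 _
      · exact le_rfl)
  have hac : ContinuousOn (fun s : ℝ => Real.exp (cumRate lam s) *
      levelMean P N n (fun x => g (s - x)) s.toNNReal) (Icc 0 t) := by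
    refine (Real.continuous_exp.comp_continuousOn (continuousOn_cumRate hLam t)).mul ?_
    refine hN.continuousOn_levelMean hLam h0 n (g := fun t x => g (t - x))
      (fun t => hg.comp (by fun_prop)) (fun _ _ => hC _) (K := K) (fun s t x => ?_) t
    simpa using hK (t - x) (s - x)
  have hint : IntervalIntegrable (fun s => lam s * (Real.exp (cumRate lam s) *
      levelMean P N n (fun x => g (s - x)) s.toNNReal)) volume 0 t := by
    refine (intervalIntegrable_rate hLam le_rfl ht.le).mul_continuousOn ?_
    rwa [uIcc_of_le ht.le]
  rw [hN.levelMean_succ hLam h0 hc n hg hC hK ht, intervalIntegral.integral_of_le ht.le,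
    integral_Ioc_eq_integral_Ioo, ofReal_integral_eq_lintegral_ofReal]
  · refine setLIntegral_congr_fun measurableSet_Ioo fun s hs => ?_
    simp only [rateE]
    rw [indicator_of_mem (show s ∈ Ioi 0 from hs.1), ENNReal.ofReal_mul (h0 s hs.1)]
  · exact ((intervalIntegrable_iff_integrableOn_Ioc_of_le ht.le).1 hint).mono_set Ioo_subset_Ioc_self
  · filter_upwards [ae_restrict_mem measurableSet_Ioo] with s hs
    exact mul_nonneg (h0 s hs.1) (hnn s)

theorem IsPoissonProcess.ofReal_levelMean (hN : IsPoissonProcess P lam N) (n : ℕ) {g : ℝ → ℝ}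
    (hg : Measurable g) (hg0 : ∀ x, 0 ≤ g x) (hg1 : ∀ x, g x ≤ 1) (t : ℝ≥0) :
    ENNReal.ofReal (levelMean P N n g t) =
      ∫⁻ w, ENNReal.ofReal (g w) ∂((P.restrict {ω | N t ω = n}).map (offTime N t)) := by
  have hm := hN.measurableSet_level t n
  have hW : Measurable (offTime N t) := measurable_offTime (fun s _ => hN.measurable s) hN.rightCts
  rw [lintegral_map hg.ennreal_ofReal hW, levelMean,
    ofReal_integral_eq_lintegral_ofReal, ← lintegral_indicator hm]
  · refine lintegral_congr fun ω => ?_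
    simp only [indicator, mem_ofPred_eq]
    split_ifs <;> simp
  · exact hN.integrable_level t n hg (C := 1) fun x => by rw [abs_of_nonneg (hg0 x)]; exact hg1 x
  · refine Eventually.of_forall fun ω => ?_
    simp only [Pi.zero_apply]
    split_ifs
    · exact hg0 _
    · exact le_rfl

theorem IsPoissonProcess.ofReal_exp_mul_levelMean (hN : IsPoissonProcess P lam N)
    (hLam : ∀ t, 0 < t → IntegrableOn lam (Ioc 0 t)) (h0 : ∀ t, 0 < t → 0 ≤ lam t)
    (hc : ContinuousOn lam (Ioi 0)) (n : ℕ) {g : ℝ → ℝ} (hg : Measurable g) {K : ℝ}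
    (hg0 : ∀ x, 0 ≤ g x) (hg1 : ∀ x, g x ≤ 1) (hK : ∀ x y, |g x - g y| ≤ K * |x - y|) {t : ℝ}
    (ht : 0 < t) :
    ENNReal.ofReal (Real.exp (cumRate lam t) * levelMean P N (n + 1) g t.toNNReal)
      = ∫⁻ w in Ioo 0 t, ENNReal.ofReal (g w) * levelKernel lam n w (t - w) := by
  induction n generalizing g t with
  | zero =>
    rw [hN.ofReal_levelMean_succ hLam h0 hc 0 hg hg0 hg1 hK ht]
    refine setLIntegral_congr_fun measurableSet_Ioo fun s hs => ?_
    -- Before the first event the off time is `0`, so after a first event at time `s` it is `s`: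
    -- this is why the kernel of level one is the rate itself.
    have h3 : levelMean P N 0 (fun x => g (s - x)) s.toNNReal
        = ∫ ω in {ω | N s.toNNReal ω = 0}, g s ∂P := by
      rw [levelMean, ← integral_indicator (hN.measurableSet_level _ 0)]
      refine integral_congr_ae (Eventually.of_forall fun ω => ?_)
      simp only [indicator, mem_ofPred_eq]
      split_ifs with h
      · rw [offTime_of_eq_zero hN.mono h, sub_zero]
      · rfl
    simp only [levelKernel]
    rw [h3, setIntegral_const, hN.measureReal_eq hLam h0, Real.coe_toNNReal _ hs.1.le]
    simp only [pow_zero, mul_one, Nat.factorial_zero, Nat.cast_one, div_one, smul_eq_mul]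
    rw [← mul_assoc, ← Real.exp_add, add_neg_cancel, Real.exp_zero, one_mul, mul_comm]
  | succ n ih =>
    rw [hN.ofReal_levelMean_succ hLam h0 hc (n + 1) hg hg0 hg1 hK ht,
      ← lintegral_rateE_levelKernel hc n hg.ennreal_ofReal t]
    refine setLIntegral_congr_fun measurableSet_Ioo fun s hs => ?_
    rw [ih (g := fun x => g (s - x)) (hg.comp (by fun_prop)) (fun x => hg0 _) (fun x => hg1 _)
      (fun x y => ?_) hs.1]
    have := hK (s - x) (s - y)
    rwa [sub_sub_sub_cancel_left, abs_sub_comm y x] at this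

/-- The law of `offTime N t` on the event `N t = n + 1`. -/
theorem IsPoissonProcess.map_offTime (hN : IsPoissonProcess P lam N)
    (hLam : ∀ t, 0 < t → IntegrableOn lam (Ioc 0 t)) (h0 : ∀ t, 0 < t → 0 ≤ lam t)
    (hc : ContinuousOn lam (Ioi 0)) (n : ℕ) {t : ℝ} (ht : 0 < t) :
    (P.restrict {ω | N t.toNNReal ω = n + 1}).map (offTime N t.toNNReal) =
      (volume.restrict (Ioo 0 t)).withDensity
        (fun w => ENNReal.ofReal (Real.exp (-cumRate lam t)) * levelKernel lam n w (t - w)) := by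
  refine ext_of_forall_lipschitz fun g hg hg0 hg1 ⟨K, hK⟩ => ?_
  have hkm : Measurable fun w => levelKernel lam n w (t - w) :=
    (measurable_levelKernel hc n).comp (by fun_prop : Measurable fun w : ℝ => (w, t - w))
  rw [← hN.ofReal_levelMean _ hg hg0 hg1, lintegral_withDensity_eq_lintegral_mul _
    (hkm.const_mul _) hg.ennreal_ofReal]
  have h1 := hN.ofReal_exp_mul_levelMean hLam h0 hc n hg hg0 hg1 hK ht
  have h2 : levelMean P N (n + 1) g t.toNNReal = Real.exp (-cumRate lam t) *
      (Real.exp (cumRate lam t) * levelMean P N (n + 1) g t.toNNReal) := by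
    rw [← mul_assoc, ← Real.exp_add, neg_add_cancel, Real.exp_zero, one_mul]
  rw [h2, ENNReal.ofReal_mul (Real.exp_pos _).le, h1, ← lintegral_const_mul _ (by
    exact hg.ennreal_ofReal.mul hkm)]
  refine lintegral_congr fun w => ?_
  simp only [Pi.mul_apply]
  ring

end law

/-! ### The summed kernel, its integral equation and its bounds -/

/-- The series of the level kernels, level `n` being weighted by `2⁻ⁿ`. -/
def edgeKernelE (lam : ℝ → ℝ) (u v : ℝ) : ℝ≥0∞ := ∑' n, 2⁻¹ ^ (n + 1) * levelKernel lam n u v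

section edgeKernelE
variable {lam : ℝ → ℝ}

theorem measurable_edgeKernelE (hc : ContinuousOn lam (Ioi 0)) :
    Measurable fun p : ℝ × ℝ => edgeKernelE lam p.1 p.2 :=
  Measurable.tsum fun n => (measurable_levelKernel hc n).const_mul _

/-- The recursion is summed over all levels by Tonelli; each additional event contributes one factor
`2⁻¹`, the probability of the turn that keeps the particle on the edge. -/
theorem edgeKernelE_eq (hc : ContinuousOn lam (Ioi 0)) (u v : ℝ) :
    edgeKernelE lam u v = 2⁻¹ * rateE lam u
      + ∫⁻ x in Ioo 0 v, 2⁻¹ * rateE lam (u + x) * edgeKernelE lam x u := by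
  have hr : Measurable fun x => rateE lam (u + x) := (measurable_rateE hc).comp (by fun_prop)
  have hk : ∀ n, Measurable fun x => levelKernel lam n x u := fun n =>
    (measurable_levelKernel hc n).comp (by fun_prop : Measurable fun x : ℝ => (x, u))
  rw [edgeKernelE, tsum_eq_zero_add' ENNReal.summable]
  simp only [zero_add, pow_one, levelKernel]
  congr 1
  have : ∀ x, 2⁻¹ * rateE lam (u + x) * edgeKernelE lam x u
      = ∑' n, 2⁻¹ ^ (n + 2) * (rateE lam (u + x) * levelKernel lam n x u) := by
    intro x
    rw [edgeKernelE, ← ENNReal.tsum_mul_left]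
    refine tsum_congr fun n => ?_
    ring
  simp only [this]
  have hrk : ∀ n, Measurable fun x => rateE lam (u + x) * levelKernel lam n x u := fun n =>
    hr.mul (hk n)
  rw [lintegral_tsum fun n => ((hrk n).const_mul _).aemeasurable]
  refine tsum_congr fun n => ?_
  rw [lintegral_const_mul _ (hrk n)]

theorem lintegral_rateE (hLam : ∀ t, 0 < t → IntegrableOn lam (Ioc 0 t))
    (h0 : ∀ t, 0 < t → 0 ≤ lam t) {t : ℝ} (ht : 0 ≤ t) :
    ∫⁻ s in Ioo 0 t, rateE lam s = ENNReal.ofReal (cumRate lam t) := by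
  rw [cumRate, intervalIntegral.integral_of_le ht, integral_Ioc_eq_integral_Ioo,
    ofReal_integral_eq_lintegral_ofReal]
  · refine setLIntegral_congr_fun measurableSet_Ioo fun s hs => ?_
    simp only [rateE]
    rw [indicator_of_mem (show s ∈ Ioi 0 from hs.1)]
  · exact ((intervalIntegrable_iff_integrableOn_Ioc_of_le ht).1
      (intervalIntegrable_rate hLam le_rfl ht)).mono_set Ioo_subset_Ioc_self
  · filter_upwards [ae_restrict_mem measurableSet_Ioo] with s hs using h0 s hs.1

/-- The kernel has finite mass on each diagonal. -/
theorem lintegral_edgeKernelE_le {Ω : Type*} [MeasurableSpace Ω] {P : Measure Ω}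
    [IsProbabilityMeasure P] {N : ℝ≥0 → Ω → ℕ} (hN : IsPoissonProcess P lam N)
    (hLam : ∀ t, 0 < t → IntegrableOn lam (Ioc 0 t)) (h0 : ∀ t, 0 < t → 0 ≤ lam t)
    (hc : ContinuousOn lam (Ioi 0)) {t : ℝ} (ht : 0 < t) :
    ∫⁻ w in Ioo 0 t, edgeKernelE lam w (t - w) ≤ ENNReal.ofReal (Real.exp (cumRate lam t)) := by
  have hk : ∀ n, Measurable fun w => levelKernel lam n w (t - w) := fun n =>
    (measurable_levelKernel hc n).comp (by fun_prop : Measurable fun w : ℝ => (w, t - w))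
  have hW : Measurable (offTime N t.toNNReal) :=
    measurable_offTime (fun s _ => hN.measurable s) hN.rightCts
  -- Up to the exponential factor, the kernel of index `n` is a probability density restricted to
  -- the event `N t = n + 1`. These events are disjoint and the weights are at most `1`, whence the
  -- bound.
  have hlevel : ∀ n, ∫⁻ w in Ioo 0 t, levelKernel lam n w (t - w)
      = ENNReal.ofReal (Real.exp (cumRate lam t)) * P {ω | N t.toNNReal ω = n + 1} := by
    intro n
    have := congrArg (fun m : Measure ℝ => m univ) (hN.map_offTime hLam h0 hc n ht)
    simp only [Measure.map_apply hW MeasurableSet.univ, preimage_univ, Measure.restrict_apply_univ,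
      withDensity_apply _ MeasurableSet.univ, Measure.restrict_univ] at this
    rw [this, lintegral_const_mul _ (hk n), ← mul_assoc, ← ENNReal.ofReal_mul (Real.exp_pos _).le,
      ← Real.exp_add, add_neg_cancel, Real.exp_zero, ENNReal.ofReal_one, one_mul]
  simp only [edgeKernelE]
  rw [lintegral_tsum fun n => ((hk n).const_mul _).aemeasurable]
  simp only [lintegral_const_mul _ (hk _), hlevel]
  calc ∑' n, (2⁻¹ : ℝ≥0∞) ^ (n + 1) *
        (ENNReal.ofReal (Real.exp (cumRate lam t)) * P {ω | N t.toNNReal ω = n + 1})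
      ≤ ∑' n, ENNReal.ofReal (Real.exp (cumRate lam t)) * P {ω | N t.toNNReal ω = n + 1} := by
        refine ENNReal.tsum_le_tsum fun n => mul_le_of_le_one_left zero_le ?_
        exact pow_le_one₀ zero_le (by simp)
    _ = ENNReal.ofReal (Real.exp (cumRate lam t)) * ∑' n, P {ω | N t.toNNReal ω = n + 1} :=
        ENNReal.tsum_mul_left
    _ ≤ ENNReal.ofReal (Real.exp (cumRate lam t)) * 1 := by
        gcongr
        rw [← measure_iUnion]
        · exact prob_le_one
        · intro i j hij
          rw [Function.onFun, Set.disjoint_left]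
          intro ω h1 h2
          simp only [mem_ofPred_eq] at h1 h2
          omega
        · exact fun n => hN.measurableSet_level _ _
    _ = _ := mul_one _

/-- A bound for the integral of the kernel along horizontal lines. -/
def edgeBound (lam : ℝ → ℝ) (T : ℝ) : ℝ :=
  cumRate lam T + cumRate lam T * Real.exp (cumRate lam T)

/-- The integral equation is inserted once. Its first term contributes at most `cumRate lam T`. The
second is an integral over a rectangle contained in the triangle `x + y < T`; sliced along the
diagonals `x + y = s`, each slice carries mass at most `exp (cumRate lam T)`, and integrating the
rate over `s` gives the product. No pointwise bound on the rate is used, so the estimate reaches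
down to `x = 0`. -/
theorem lintegral_edgeKernelE_left_le {Ω : Type*} [MeasurableSpace Ω] {P : Measure Ω}
    [IsProbabilityMeasure P] {N : ℝ≥0 → Ω → ℕ} (hN : IsPoissonProcess P lam N)
    (hLam : ∀ t, 0 < t → IntegrableOn lam (Ioc 0 t)) (h0 : ∀ t, 0 < t → 0 ≤ lam t)
    (hc : ContinuousOn lam (Ioi 0)) {u v T : ℝ} (hu : 0 ≤ u) (hv : 0 ≤ v) (hT : u + v ≤ T) :
    ∫⁻ x in Ioo 0 v, edgeKernelE lam x u ≤ ENNReal.ofReal (edgeBound lam T) := by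
  have hT0 : 0 ≤ T := by linarith
  have hr := measurable_rateE hc
  have hG := measurable_edgeKernelE hc
  have hA0 := cumRate_nonneg hLam h0 hT0
  simp only [edgeKernelE_eq hc _ u]
  rw [lintegral_add_left (hr.const_mul _), edgeBound,
    ENNReal.ofReal_add hA0 (mul_nonneg hA0 (Real.exp_pos _).le)]
  have half_le : ∀ a : ℝ≥0∞, 2⁻¹ * a ≤ a := fun a => mul_le_of_le_one_left zero_le (by simp)
  refine add_le_add ?_ ?_
  · rw [← lintegral_rateE hLam h0 hT0]
    refine (lintegral_mono fun x => half_le _).trans (lintegral_mono_set ?_)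
    exact Ioo_subset_Ioo_right (by linarith)
  · calc ∫⁻ x in Ioo 0 v, ∫⁻ y in Ioo 0 u, 2⁻¹ * rateE lam (x + y) * edgeKernelE lam y x
        ≤ ∫⁻ x in Ioo 0 v, ∫⁻ y in Ioo 0 u, rateE lam (y + x) * edgeKernelE lam y x := by
          refine lintegral_mono fun x => lintegral_mono fun y => ?_
          rw [add_comm y x]
          gcongr
          exact half_le _
      _ = ∫⁻ y in Ioo 0 u, ∫⁻ x in Ioo 0 v, rateE lam (y + x) * edgeKernelE lam y x := by
          refine lintegral_lintegral_swap (f := fun x y =>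
            rateE lam (y + x) * edgeKernelE lam y x) (Measurable.aemeasurable ?_)
          exact (hr.comp (by fun_prop : Measurable fun p : ℝ × ℝ => p.2 + p.1)).mul
            (hG.comp measurable_swap)
      _ ≤ ∫⁻ y in Ioo 0 T, ∫⁻ x in Ioo 0 (T - y), rateE lam (y + x) * edgeKernelE lam y x := by
          refine (setLIntegral_mono_ae' measurableSet_Ioo (Eventually.of_forall fun y hy =>
            lintegral_mono_set ?_)).trans (lintegral_mono_set ?_)
          · exact Ioo_subset_Ioo_right (by linarith [hy.2])
          · exact Ioo_subset_Ioo_right (by linarith)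
      _ = ∫⁻ s in Ioo 0 T, ∫⁻ w in Ioo 0 s, rateE lam s * edgeKernelE lam w (s - w) := by
          rw [lintegral_triangle_swap]
          · simp only [add_sub_cancel_left]
          · exact (hr.comp measurable_fst).mul
              (hG.comp (by fun_prop : Measurable fun p : ℝ × ℝ => (p.2, p.1 - p.2)))
      _ ≤ ∫⁻ s in Ioo 0 T, rateE lam s * ENNReal.ofReal (Real.exp (cumRate lam T)) := by
          refine setLIntegral_mono_ae' measurableSet_Ioo (Eventually.of_forall fun s hs => ?_)
          have hGs : Measurable fun w => edgeKernelE lam w (s - w) :=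
            hG.comp (by fun_prop : Measurable fun w : ℝ => (w, s - w))
          rw [lintegral_const_mul _ hGs]
          gcongr
          refine (lintegral_edgeKernelE_le hN hLam h0 hc hs.1).trans (ENNReal.ofReal_le_ofReal ?_)
          exact Real.exp_le_exp.2 (cumRate_mono hLam h0 hs.1.le hs.2.le)
      _ = ENNReal.ofReal (cumRate lam T * Real.exp (cumRate lam T)) := by
          rw [lintegral_mul_const _ hr, lintegral_rateE hLam h0 hT0, ENNReal.ofReal_mul hA0]

/-- For `u ≥ a > 0` the rate is only evaluated on `[a, 2 * b]`, where it is bounded; the other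
factor under the integral is covered by the `L¹` bound. -/
theorem edgeKernelE_le {Ω : Type*} [MeasurableSpace Ω] {P : Measure Ω}
    [IsProbabilityMeasure P] {N : ℝ≥0 → Ω → ℕ} (hN : IsPoissonProcess P lam N)
    (hLam : ∀ t, 0 < t → IntegrableOn lam (Ioc 0 t)) (h0 : ∀ t, 0 < t → 0 ≤ lam t)
    (hc : ContinuousOn lam (Ioi 0)) {a b M : ℝ} (ha : 0 < a)
    (hM : ∀ s ∈ Icc a (2 * b), lam s ≤ M) {u v : ℝ} (hu : u ∈ Icc a b) (hv : v ∈ Icc 0 b) :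
    edgeKernelE lam u v ≤ ENNReal.ofReal M + ENNReal.ofReal M
      * ENNReal.ofReal (edgeBound lam (2 * b)) := by
  have half_le : ∀ a : ℝ≥0∞, 2⁻¹ * a ≤ a := fun a => mul_le_of_le_one_left zero_le (by simp)
  have hrate : ∀ s ∈ Icc a (2 * b), 2⁻¹ * rateE lam s ≤ ENNReal.ofReal M := fun s hs => by
    refine (half_le _).trans ?_
    rw [rateE, indicator_of_mem (show s ∈ Ioi 0 from ha.trans_le hs.1)]
    exact ENNReal.ofReal_le_ofReal (hM s hs)
  rw [edgeKernelE_eq hc]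
  refine add_le_add (hrate u ⟨hu.1, by linarith [hu.1, hu.2]⟩) ?_
  refine le_trans ?_ (mul_le_mul_right (lintegral_edgeKernelE_left_le hN hLam h0 hc
    (ha.le.trans hu.1) hv.1 (by linarith [hu.2, hv.2])) _)
  have hGu : Measurable fun x => edgeKernelE lam x u :=
    (measurable_edgeKernelE hc).comp (by fun_prop : Measurable fun x : ℝ => (x, u))
  rw [← lintegral_const_mul _ hGu]
  refine setLIntegral_mono_ae' measurableSet_Ioo (Eventually.of_forall fun x hx => ?_)
  gcongr
  exact hrate _ ⟨by linarith [hu.1, hx.1], by linarith [hu.2, hv.2, hx.2]⟩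

theorem edgeKernelE_mono (hc : ContinuousOn lam (Ioi 0)) (u : ℝ) {v v' : ℝ} (hv : v ≤ v') :
    edgeKernelE lam u v ≤ edgeKernelE lam u v' := by
  rw [edgeKernelE_eq hc, edgeKernelE_eq hc]
  gcongr
end edgeKernelE

/-- A solution `G` of the integral equation
`G u v = m u + ∫₀ᵛ m (u + x) G x u dx` on the quadrant, with the bounds needed to study its
regularity. -/
structure IsCharacteristicSolution (m : ℝ → ℝ) (G : ℝ → ℝ → ℝ) : Prop where
  measurable : Measurable fun p : ℝ × ℝ => G p.1 p.2
  nonneg : ∀ u v, 0 ≤ G u v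
  eq : ∀ u v, 0 < u → 0 < v → G u v = m u + ∫ x in (0 : ℝ)..v, m (u + x) * G x u
  bounded : ∀ a b, 0 < a → ∃ C, ∀ u ∈ Icc a b, ∀ v ∈ Icc 0 b, G u v ≤ C
  mono : ∀ u v v', 0 < u → 0 ≤ v → v ≤ v' → G u v ≤ G u v'
  integrableOn : ∀ u v, 0 < u → IntegrableOn (fun x => G x u) (Ioc 0 v)

/-- The real-valued version of `edgeKernelE`. -/
def edgeKernel (lam : ℝ → ℝ) (u v : ℝ) : ℝ := (edgeKernelE lam u v).toReal

theorem edgeKernelE_ne_top {lam : ℝ → ℝ} {Ω : Type*} [MeasurableSpace Ω] {P : Measure Ω}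
    [IsProbabilityMeasure P] {N : ℝ≥0 → Ω → ℕ} (hN : IsPoissonProcess P lam N)
    (hLam : ∀ t, 0 < t → IntegrableOn lam (Ioc 0 t)) (h0 : ∀ t, 0 < t → 0 ≤ lam t)
    (hc : ContinuousOn lam (Ioi 0)) {u v : ℝ} (hu : 0 < u) (hv : 0 ≤ v) :
    edgeKernelE lam u v ≠ ⊤ := by
  obtain ⟨M, hM⟩ := (isCompact_Icc (a := u) (b := 2 * max u v)).bddAbove_image
    (hc.mono fun x hx => lt_of_lt_of_le hu hx.1)
  refine ne_top_of_le_ne_top ?_ (edgeKernelE_le hN hLam h0 hc (M := M) (b := max u v) hu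
    (fun s hs => hM ⟨s, hs, rfl⟩) ⟨le_rfl, le_max_left _ _⟩ ⟨hv, le_max_right _ _⟩)
  finiteness

theorem isCharacteristicSolution_edgeKernel {lam : ℝ → ℝ} {Ω : Type*} [MeasurableSpace Ω]
    {P : Measure Ω} [IsProbabilityMeasure P] {N : ℝ≥0 → Ω → ℕ} (hN : IsPoissonProcess P lam N)
    (hLam : ∀ t, 0 < t → IntegrableOn lam (Ioc 0 t)) (h0 : ∀ t, 0 < t → 0 ≤ lam t)
    (hc : ContinuousOn lam (Ioi 0)) :
    IsCharacteristicSolution (fun s => lam s / 2) (edgeKernel lam) where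
  measurable := (measurable_edgeKernelE hc).ennreal_toReal
  nonneg u v := ENNReal.toReal_nonneg
  eq u v hu hv := by
    have htop := edgeKernelE_ne_top hN hLam h0 hc hu hv.le
    have h2 : ∀ s, 0 < s → (2⁻¹ * rateE lam s).toReal = lam s / 2 := fun s hs => by
      rw [rateE, indicator_of_mem (show s ∈ Ioi 0 from hs), ENNReal.toReal_mul,
        ENNReal.toReal_ofReal (h0 s hs)]
      simp only [ENNReal.toReal_inv, ENNReal.toReal_ofNat]
      ring
    have hGu : Measurable fun x => edgeKernelE lam x u :=
      (measurable_edgeKernelE hc).comp (by fun_prop : Measurable fun x : ℝ => (x, u))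
    have hru : Measurable fun x => 2⁻¹ * rateE lam (u + x) :=
      ((measurable_rateE hc).comp (by fun_prop)).const_mul _
    have hprod : Measurable fun x => 2⁻¹ * rateE lam (u + x) * edgeKernelE lam x u := hru.mul hGu
    have h3 := htop
    rw [edgeKernelE_eq hc, ENNReal.add_ne_top] at h3
    rw [edgeKernel, edgeKernelE_eq hc, ENNReal.toReal_add h3.1 h3.2, h2 u hu,
      intervalIntegral.integral_of_le hv.le, integral_Ioc_eq_integral_Ioo,
      ← integral_toReal hprod.aemeasurable]
    · congr 1
      refine setIntegral_congr_fun measurableSet_Ioo fun x hx => ?_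
      simp only [ENNReal.toReal_mul, ← h2 (u + x) (add_pos hu hx.1), edgeKernel]
    · filter_upwards [ae_restrict_mem measurableSet_Ioo] with x hx
      refine ENNReal.mul_lt_top (ENNReal.mul_lt_top (by simp) ENNReal.ofReal_lt_top) ?_
      exact (edgeKernelE_ne_top hN hLam h0 hc hx.1 hu.le).lt_top
  bounded a b ha := by
    obtain ⟨M, hM⟩ := (isCompact_Icc (a := a) (b := 2 * b)).bddAbove_image
      (hc.mono fun x hx => lt_of_lt_of_le ha hx.1)
    refine ⟨_, fun u hu v hv => ENNReal.toReal_mono (b := _) (by finiteness)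
      (edgeKernelE_le hN hLam h0 hc (M := M) (b := b) ha (fun s hs => hM ⟨s, hs, rfl⟩) hu hv)⟩
  mono u v v' hu hv hvv := ENNReal.toReal_mono
    (edgeKernelE_ne_top hN hLam h0 hc hu (hv.trans hvv)) (edgeKernelE_mono hc u hvv)
  integrableOn u v hu := by
    rcases le_or_gt v 0 with hv | hv
    · simp [Ioc_eq_empty (not_lt.2 hv)]
    rw [integrableOn_Ioc_iff_integrableOn_Ioo]
    refine integrable_toReal_of_lintegral_ne_top ((measurable_edgeKernelE hc).comp
      (by fun_prop : Measurable fun x : ℝ => (x, u))).aemeasurable ?_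
    exact ne_top_of_le_ne_top ENNReal.ofReal_ne_top
      (lintegral_edgeKernelE_left_le hN hLam h0 hc hu.le hv.le le_rfl)

/-! ### Regularity of solutions of the integral equation -/

section partials
variable {f A B : ℝ × ℝ → ℝ} {S : Set (ℝ × ℝ)}

theorem hasFDerivAt_of_partials (hS : IsOpen S)
    (hA : ∀ p ∈ S, HasDerivAt (fun x => f (x, p.2)) (A p) p.1)
    (hB : ∀ p ∈ S, HasDerivAt (fun y => f (p.1, y)) (B p) p.2)
    (hAc : ContinuousOn A S) (hBc : ContinuousOn B S) {p : ℝ × ℝ} (hp : p ∈ S) :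
    HasFDerivAt f (A p • ContinuousLinearMap.fst ℝ ℝ ℝ + B p • ContinuousLinearMap.snd ℝ ℝ ℝ) p := by
  have h := hasStrictFDerivAt_uncurry_coprod (𝕜 := ℝ) (u := p) (f := fun x y => f (x, y))
    (f₁ := fun x y => A (x, y) • ContinuousLinearMap.id ℝ ℝ)
    (f₂ := fun x y => B (x, y) • ContinuousLinearMap.id ℝ ℝ)
    (by
      filter_upwards [hS.mem_nhds hp] with q hq
      refine (hA q hq).hasFDerivAt.congr_fderiv ?_
      ext; simp [Function.HasUncurry.uncurry])
    (by
      filter_upwards [hS.mem_nhds hp] with q hq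
      refine (hB q hq).hasFDerivAt.congr_fderiv ?_
      ext; simp [Function.HasUncurry.uncurry])
    ((hAc.continuousAt (hS.mem_nhds hp)).smul continuousAt_const)
    ((hBc.continuousAt (hS.mem_nhds hp)).smul continuousAt_const)
  refine h.hasFDerivAt.congr_fderiv ?_
  ext <;> simp [Function.HasUncurry.uncurry]

theorem contDiffOn_succ_of_partials (hS : IsOpen S) (n : ℕ)
    (hA : ∀ p ∈ S, HasDerivAt (fun x => f (x, p.2)) (A p) p.1)
    (hB : ∀ p ∈ S, HasDerivAt (fun y => f (p.1, y)) (B p) p.2)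
    (hAc : ContDiffOn ℝ n A S) (hBc : ContDiffOn ℝ n B S) : ContDiffOn ℝ (n + 1) f S := by
  have hd : ∀ p ∈ S, HasFDerivAt f
      (A p • ContinuousLinearMap.fst ℝ ℝ ℝ + B p • ContinuousLinearMap.snd ℝ ℝ ℝ) p := fun p hp =>
    hasFDerivAt_of_partials hS hA hB hAc.continuousOn hBc.continuousOn hp
  rw [contDiffOn_succ_iff_fderiv_of_isOpen hS]
  refine ⟨fun p hp => (hd p hp).differentiableAt.differentiableWithinAt, by simp, ?_⟩
  refine ContDiffOn.congr ?_ fun p hp => (hd p hp).fderiv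
  exact (hAc.smul contDiffOn_const).add (hBc.smul contDiffOn_const)

end partials

/-- The open first quadrant. -/
def quadrant : Set (ℝ × ℝ) := Ioi 0 ×ˢ Ioi 0

theorem isOpen_quadrant : IsOpen quadrant := isOpen_Ioi.prod isOpen_Ioi

/-- Kernels on the quadrant which are separately continuous in the first variable and locally
uniformly dominated by integrable functions of the second one. -/
structure IsDominated (k : ℝ → ℝ → ℝ) : Prop where
  aestronglyMeasurable : ∀ u, 0 < u → AEStronglyMeasurable (k u) (volume.restrict (Ioi 0))
  continuousOn : ∀ x, 0 < x → ContinuousOn (fun u => k u x) (Ioi 0)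
  dominated : ∀ a b, 0 < a → ∃ bound : ℝ → ℝ, IntegrableOn bound (Ioc 0 b) ∧
    ∀ u ∈ Icc a b, ∀ x ∈ Ioc 0 b, |k u x| ≤ bound x

namespace IsDominated
variable {k k' : ℝ → ℝ → ℝ}

theorem add (hk : IsDominated k) (hk' : IsDominated k') : IsDominated fun u x => k u x + k' u x where
  aestronglyMeasurable u hu := (hk.aestronglyMeasurable u hu).add (hk'.aestronglyMeasurable u hu)
  continuousOn x hx := (hk.continuousOn x hx).add (hk'.continuousOn x hx)
  dominated a b ha := by
    obtain ⟨g, hg, hgk⟩ := hk.dominated a b ha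
    obtain ⟨g', hg', hgk'⟩ := hk'.dominated a b ha
    refine ⟨fun x => g x + g' x, hg.add hg', fun u hu x hx => ?_⟩
    exact (abs_add_le _ _).trans (add_le_add (hgk u hu x hx) (hgk' u hu x hx))

theorem of_left {m : ℝ → ℝ} (hm : ContinuousOn m (Ioi 0)) : IsDominated fun u _ => m u where
  aestronglyMeasurable u hu := aestronglyMeasurable_const
  continuousOn x hx := hm
  dominated a b ha := by
    obtain ⟨M, hM⟩ := (isCompact_Icc (a := a) (b := b)).exists_bound_of_continuousOn
      (hm.mono fun x hx => lt_of_lt_of_le ha hx.1)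
    exact ⟨fun _ => M, integrableOn_const (by simp), fun u hu x _ => hM u hu⟩

theorem mul_left (hk : IsDominated k) {m : ℝ → ℝ} (hm : ContinuousOn m (Ioi 0)) :
    IsDominated fun u x => m (u + x) * k u x where
  aestronglyMeasurable u hu := by
    refine AEStronglyMeasurable.mul ?_ (hk.aestronglyMeasurable u hu)
    refine ContinuousOn.aestronglyMeasurable ?_ measurableSet_Ioi
    exact hm.comp (by fun_prop) fun x hx => add_pos hu hx
  continuousOn x hx := by
    refine ContinuousOn.mul ?_ (hk.continuousOn x hx)
    exact hm.comp (by fun_prop) fun u hu => add_pos hu hx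
  dominated a b ha := by
    obtain ⟨M, hM⟩ := (isCompact_Icc (a := a) (b := 2 * b)).exists_bound_of_continuousOn
      (hm.mono fun x hx => lt_of_lt_of_le ha hx.1)
    obtain ⟨g, hg, hgk⟩ := hk.dominated a b ha
    refine ⟨fun x => M * g x, hg.const_mul M, fun u hu x hx => ?_⟩
    have h1 := hM (u + x) ⟨by linarith [hu.1, hx.1], by linarith [hu.2, hx.2]⟩
    rw [abs_mul]
    exact mul_le_mul h1 (hgk u hu x hx) (abs_nonneg _) ((norm_nonneg _).trans h1)

theorem intervalIntegrable (hk : IsDominated k) {u v : ℝ} (hu : 0 < u) (hv : 0 < v) :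
    IntervalIntegrable (k u) volume 0 v := by
  obtain ⟨g, hg, hgk⟩ := hk.dominated u (max u v) hu
  rw [intervalIntegrable_iff_integrableOn_Ioc_of_le hv.le]
  have hg' : IntegrableOn g (Ioc 0 v) := hg.mono_set (Ioc_subset_Ioc_right (le_max_right _ _))
  refine hg'.mono' ((hk.aestronglyMeasurable u hu).mono_set Ioc_subset_Ioi_self) ?_
  filter_upwards [ae_restrict_mem measurableSet_Ioc] with x hx
  exact hgk u ⟨le_rfl, le_max_left _ _⟩ x ⟨hx.1, hx.2.trans (le_max_right _ _)⟩

/-- Dominated convergence on a fixed interval `(0, b]`, the variable endpoint being moved into an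
indicator function. -/
theorem continuousOn_integral (hk : IsDominated k) :
    ContinuousOn (fun p : ℝ × ℝ => ∫ x in (0 : ℝ)..p.2, k p.1 x) quadrant := by
  rintro ⟨u₀, v₀⟩ ⟨hu₀ : 0 < u₀, hv₀ : 0 < v₀⟩
  refine ContinuousAt.continuousWithinAt ?_
  set b := max (2 * u₀) (2 * v₀) with hb
  obtain ⟨g, hg, hgk⟩ := hk.dominated (u₀ / 2) b (by positivity)
  have hnhds : ∀ᶠ p : ℝ × ℝ in 𝓝 (u₀, v₀), p.1 ∈ Ioo (u₀ / 2) (2 * u₀) ∧ p.2 ∈ Ioo 0 (2 * v₀) :=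
    prod_mem_nhds (Ioo_mem_nhds (by linarith) (by linarith)) (Ioo_mem_nhds (by linarith) (by linarith))
  have hcongr : ∀ᶠ p : ℝ × ℝ in 𝓝 (u₀, v₀), ∫ x in Ioc 0 b, (Ioc 0 p.2).indicator (k p.1) x
      = ∫ x in (0 : ℝ)..p.2, k p.1 x := by
    filter_upwards [hnhds] with p hp
    rw [intervalIntegral.integral_of_le hp.2.1.le, setIntegral_indicator measurableSet_Ioc,
      inter_eq_right.2 (Ioc_subset_Ioc_right (hp.2.2.le.trans (le_max_right _ _)))]
  refine ContinuousAt.congr ?_ hcongr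
  refine continuousAt_of_dominated (bound := g) ?_ ?_ hg ?_
  · filter_upwards [hnhds] with p hp
    exact ((hk.aestronglyMeasurable p.1 (by linarith [hp.1.1])).mono_set
      Ioc_subset_Ioi_self).indicator measurableSet_Ioc
  · filter_upwards [hnhds] with p hp
    filter_upwards [ae_restrict_mem measurableSet_Ioc] with x hx
    refine (norm_indicator_le_norm_self _ _).trans ?_
    exact hgk p.1 ⟨hp.1.1.le, hp.1.2.le.trans (le_max_left _ _)⟩ x hx
  -- The indicator of `(0, v]` is locally constant in `v` near `v₀` except at the single point `x =
  -- v₀`, which is negligible.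
  · have hne : ∀ᵐ x ∂(volume.restrict (Ioc 0 b)), x ≠ v₀ :=
      ae_restrict_of_ae (Measure.ae_ne volume v₀)
    filter_upwards [ae_restrict_mem measurableSet_Ioc, hne] with x hx hxv
    rcases lt_or_gt_of_ne hxv with h | h
    · have : ∀ᶠ p : ℝ × ℝ in 𝓝 (u₀, v₀), k p.1 x = (Ioc 0 p.2).indicator (k p.1) x := by
        filter_upwards [continuousAt_snd.eventually (lt_mem_nhds h)] with p hp
        rw [indicator_of_mem (show x ∈ Ioc 0 p.2 from ⟨hx.1, le_of_lt hp⟩)]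
      refine ContinuousAt.congr ?_ this
      exact ((hk.continuousOn x hx.1).continuousAt (Ioi_mem_nhds hu₀)).comp
        (f := Prod.fst) (x := (u₀, v₀)) continuousAt_fst
    · have : ∀ᶠ p : ℝ × ℝ in 𝓝 (u₀, v₀), 0 = (Ioc 0 p.2).indicator (k p.1) x := by
        filter_upwards [continuousAt_snd.eventually (gt_mem_nhds h)] with p hp
        rw [indicator_of_notMem]
        exact fun h' => absurd h'.2 (not_le.2 hp)
      exact ContinuousAt.congr continuousAt_const this

theorem integral (hk : IsDominated k) : IsDominated fun u v => ∫ x in (0 : ℝ)..v, k u x where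
  aestronglyMeasurable u hu := by
    refine ContinuousOn.aestronglyMeasurable ?_ measurableSet_Ioi
    exact hk.continuousOn_integral.comp (f := fun v : ℝ => (u, v)) (by fun_prop)
      fun v hv => ⟨hu, hv⟩
  continuousOn x hx :=
    hk.continuousOn_integral.comp (f := fun u : ℝ => (u, x)) (by fun_prop) fun u hu => ⟨hu, hx⟩
  dominated a b ha := by
    obtain ⟨g, hg, hgk⟩ := hk.dominated a b ha
    refine ⟨fun _ => ∫ x in Ioc 0 b, |g x|, integrableOn_const (by simp), fun u hu v hv => ?_⟩
    rw [intervalIntegral.integral_of_le hv.1.le]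
    refine (norm_integral_le_integral_norm (k u)).trans ?_
    have hki : IntegrableOn (k u) (Ioc 0 v) :=
      (intervalIntegrable_iff_integrableOn_Ioc_of_le hv.1.le).1
        (hk.intervalIntegrable (ha.trans_le hu.1) hv.1)
    have hga : IntegrableOn (fun x => |g x|) (Ioc 0 b) := hg.abs
    refine (setIntegral_mono_on hki.norm (hga.mono_set (Ioc_subset_Ioc_right hv.2))
      measurableSet_Ioc fun x hx => ?_).trans
      (setIntegral_mono_set hga (Eventually.of_forall fun x => abs_nonneg _)
        (Ioc_subset_Ioc_right hv.2).eventuallyLE)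
    exact (hgk u hu x ⟨hx.1, hx.2.trans hv.2⟩).trans (le_abs_self _)

theorem hasDerivAt_integral_right (hk : IsDominated k)
    (hc : ContinuousOn (fun p : ℝ × ℝ => k p.1 p.2) quadrant) {u v : ℝ} (hu : 0 < u) (hv : 0 < v) :
    HasDerivAt (fun v => ∫ x in (0 : ℝ)..v, k u x) (k u v) v := by
  have hcu : ContinuousOn (k u) (Ioi 0) :=
    hc.comp (f := fun v : ℝ => (u, v)) (by fun_prop) fun v hv => ⟨hu, hv⟩
  exact intervalIntegral.integral_hasDerivAt_right (hk.intervalIntegrable hu hv)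
    (hcu.stronglyMeasurableAtFilter isOpen_Ioi v hv) (hcu.continuousAt (Ioi_mem_nhds hv))

theorem hasDerivAt_integral_left (hk : IsDominated k) (hk' : IsDominated k')
    (hd : ∀ u x, 0 < u → 0 < x → HasDerivAt (fun u => k u x) (k' u x) u) {u v : ℝ} (hu : 0 < u)
    (hv : 0 < v) :
    HasDerivAt (fun u => ∫ x in (0 : ℝ)..v, k u x) (∫ x in (0 : ℝ)..v, k' u x) u := by
  set b := max (2 * u) v with hb
  obtain ⟨g, hg, hgk⟩ := hk'.dominated (u / 2) b (by positivity)
  have hmono : uIoc 0 v ⊆ Ioi 0 := by rw [uIoc_of_le hv.le]; exact Ioc_subset_Ioi_self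
  refine (intervalIntegral.hasDerivAt_integral_of_dominated_loc_of_deriv_le
    (F := k) (F' := k') (bound := g) (s := Ioo (u / 2) (2 * u))
    (Ioo_mem_nhds (by linarith) (by linarith)) ?_ (hk.intervalIntegrable hu hv)
    ((hk'.aestronglyMeasurable u hu).mono_set hmono) ?_ ?_ ?_).2
  · filter_upwards [Ioi_mem_nhds hu] with y hy
    exact (hk.aestronglyMeasurable y hy).mono_set hmono
  · refine Eventually.of_forall fun x hx y hy => ?_
    rw [uIoc_of_le hv.le] at hx
    exact hgk y ⟨hy.1.le, hy.2.le.trans (le_max_left _ _)⟩ x ⟨hx.1, hx.2.trans (le_max_right _ _)⟩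
  · rw [intervalIntegrable_iff_integrableOn_Ioc_of_le hv.le]
    exact hg.mono_set (Ioc_subset_Ioc_right (le_max_right _ _))
  · refine Eventually.of_forall fun x hx y hy => ?_
    rw [uIoc_of_le hv.le] at hx
    exact hd y x (by linarith [hy.1]) hx.1

end IsDominated

namespace IsCharacteristicSolution
variable {m : ℝ → ℝ} {G : ℝ → ℝ → ℝ}

/-- For fixed first variable, `G` is a primitive in the second one and hence continuous.
Monotonicity in the second variable gives the dominating function `G x b`, which is integrable
although possibly unbounded at `x = 0`. -/
theorem isDominated_swap (hG : IsCharacteristicSolution m G) (hm : ContinuousOn m (Ioi 0)) :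
    IsDominated fun u x => G x u where
  aestronglyMeasurable u hu :=
    (hG.measurable.comp (by fun_prop : Measurable fun x : ℝ => (x, u))).aestronglyMeasurable
  continuousOn x hx := by
    have hint : ∀ b, 0 < b → IntegrableOn (fun y => m (x + y) * G y x) (Ioc 0 b) := by
      intro b hb
      have hc : ContinuousOn (fun y => m (x + y)) (Icc 0 b) :=
        hm.comp (by fun_prop) fun y hy => lt_of_lt_of_le hx (le_add_of_nonneg_right hy.1)
      exact (hG.integrableOn x b hx).continuousOn_mul_of_subset hc isCompact_Icc
        measurableSet_Ioc Ioc_subset_Icc_self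
    have h1 : ContinuousOn (fun u => m x + ∫ y in (0 : ℝ)..u, m (x + y) * G y x) (Ioi 0) := by
      refine continuousOn_const.add fun u hu => ?_
      have hu' : (0 : ℝ) < u := hu
      have h2 := intervalIntegral.continuousOn_primitive_interval (μ := volume)
        (f := fun y => m (x + y) * G y x) (a := 0) (b := u + 1)
        (by rw [uIcc_of_le (by linarith), integrableOn_Icc_iff_integrableOn_Ioc]
            exact hint _ (by linarith))
      rw [uIcc_of_le (by linarith)] at h2
      exact (h2.continuousAt (Icc_mem_nhds hu' (by linarith))).continuousWithinAt
    exact h1.congr fun u hu => hG.eq x u hx hu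
  dominated a b ha := by
    rcases le_or_gt b 0 with hb | hb
    · exact ⟨fun _ => 0, integrableOn_zero, fun u hu => by linarith [hu.1, hu.2]⟩
    refine ⟨fun x => G x b, hG.integrableOn b b hb, fun u hu x hx => ?_⟩
    rw [abs_of_nonneg (hG.nonneg _ _)]
    exact hG.mono x u b hx.1 (ha.le.trans hu.1) hu.2

/-- A first bootstrap: the integral equation turns separate continuity with domination into joint
continuity. -/
theorem continuousOn_quadrant (hG : IsCharacteristicSolution m G) (hm : ContinuousOn m (Ioi 0)) :
    ContinuousOn (fun p : ℝ × ℝ => G p.1 p.2) quadrant := by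
  have h1 := ((hG.isDominated_swap hm).mul_left hm).continuousOn_integral
  have h2 : ContinuousOn (fun p : ℝ × ℝ => m p.1) quadrant :=
    hm.comp continuousOn_fst fun _ hp => hp.1
  exact (h2.add h1).congr fun p hp => hG.eq p.1 p.2 hp.1 hp.2

theorem continuousOn_swap (hG : IsCharacteristicSolution m G) (hm : ContinuousOn m (Ioi 0)) :
    ContinuousOn (fun p : ℝ × ℝ => G p.2 p.1) quadrant :=
  (hG.continuousOn_quadrant hm).comp (f := Prod.swap) continuous_swap.continuousOn
    fun _ hp => ⟨hp.2, hp.1⟩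

theorem add_mem_Ioi {p : ℝ × ℝ} (hp : p ∈ quadrant) : p.1 + p.2 ∈ Ioi (0 : ℝ) :=
  add_pos (mem_Ioi.1 hp.1) (mem_Ioi.1 hp.2)

theorem continuousOn_rate_add {m : ℝ → ℝ} (hm : ContinuousOn m (Ioi 0)) :
    ContinuousOn (fun p : ℝ × ℝ => m (p.1 + p.2)) quadrant :=
  hm.comp (by fun_prop) fun _ hp => add_mem_Ioi hp

theorem isDominated (hG : IsCharacteristicSolution m G) (hm : ContinuousOn m (Ioi 0)) :
    IsDominated G where
  aestronglyMeasurable u hu :=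
    (hG.measurable.comp (by fun_prop : Measurable fun x : ℝ => (u, x))).aestronglyMeasurable
  continuousOn x hx :=
    (hG.continuousOn_quadrant hm).comp (f := fun u : ℝ => (u, x)) (by fun_prop) fun u hu => ⟨hu, hx⟩
  dominated a b ha := by
    obtain ⟨C, hC⟩ := hG.bounded a b ha
    refine ⟨fun _ => C, integrableOn_const (by simp), fun u hu x hx => ?_⟩
    rw [abs_of_nonneg (hG.nonneg _ _)]
    exact hC u hu x (Ioc_subset_Icc_self hx)

theorem hasDerivAt_right (hG : IsCharacteristicSolution m G) (hm : ContinuousOn m (Ioi 0))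
    {u v : ℝ} (hu : 0 < u) (hv : 0 < v) :
    HasDerivAt (fun v => G u v) (m (u + v) * G v u) v := by
  have h1 := ((hG.isDominated_swap hm).mul_left hm).hasDerivAt_integral_right
    ((continuousOn_rate_add hm).mul (hG.continuousOn_swap hm)) hu hv
  refine (h1.const_add (m u)).congr_of_eventuallyEq ?_
  filter_upwards [Ioi_mem_nhds hv] with v hv using hG.eq u v hu hv

/-- The kernel of the partial derivative in the first variable. -/
def leftKernel (m m' : ℝ → ℝ) (G : ℝ → ℝ → ℝ) (u x : ℝ) : ℝ :=
  m' (u + x) * G x u + m (u + x) * (m (u + x) * G u x)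

/-- The partial derivative in the first variable. -/
def leftDeriv (m m' : ℝ → ℝ) (G : ℝ → ℝ → ℝ) (u v : ℝ) : ℝ :=
  m' u + ∫ x in (0 : ℝ)..v, leftKernel m m' G u x

variable {m' m'' : ℝ → ℝ}

theorem isDominated_leftKernel (hG : IsCharacteristicSolution m G) (hm : ContinuousOn m (Ioi 0))
    (hm' : ContinuousOn m' (Ioi 0)) : IsDominated (leftKernel m m' G) :=
  ((hG.isDominated_swap hm).mul_left hm').add (((hG.isDominated hm).mul_left hm).mul_left hm)

theorem isDominated_leftDeriv (hG : IsCharacteristicSolution m G) (hm : ContinuousOn m (Ioi 0))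
    (hm' : ContinuousOn m' (Ioi 0)) : IsDominated (leftDeriv m m' G) :=
  (IsDominated.of_left hm').add (hG.isDominated_leftKernel hm hm').integral

theorem continuousOn_leftDeriv (hG : IsCharacteristicSolution m G) (hm : ContinuousOn m (Ioi 0))
    (hm' : ContinuousOn m' (Ioi 0)) :
    ContinuousOn (fun p : ℝ × ℝ => leftDeriv m m' G p.1 p.2) quadrant :=
  (hm'.comp continuousOn_fst fun _ hp => hp.1).add
    (hG.isDominated_leftKernel hm hm').continuousOn_integral

/-- There is no circularity: differentiating the integrand `m (u + x) * G x u` in `u` requires only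
the partial derivative of `G` in its second variable, which the fundamental theorem of calculus has
already supplied. -/
theorem hasDerivAt_left (hG : IsCharacteristicSolution m G)
    (hm : ∀ s, 0 < s → HasDerivAt m (m' s) s) (hm' : ContinuousOn m' (Ioi 0))
    {u v : ℝ} (hu : 0 < u) (hv : 0 < v) :
    HasDerivAt (fun u => G u v) (leftDeriv m m' G u v) u := by
  have hmc : ContinuousOn m (Ioi 0) := fun s hs => (hm s hs).continuousAt.continuousWithinAt
  have h1 := ((hG.isDominated_swap hmc).mul_left hmc).hasDerivAt_integral_left
    (hG.isDominated_leftKernel hmc hm') (fun u x hu hx => by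
      have h2 := (hm (u + x) (add_pos hu hx)).comp_add_const u x
      refine (h2.mul (hG.hasDerivAt_right hmc hx hu)).congr_deriv ?_
      rw [leftKernel, add_comm x u]) hu hv
  refine ((hm u hu).add h1).congr_of_eventuallyEq ?_
  filter_upwards [Ioi_mem_nhds hu] with u hu using hG.eq u v hu hv

theorem contDiffOn_one (hG : IsCharacteristicSolution m G)
    (hm : ∀ s, 0 < s → HasDerivAt m (m' s) s) (hm' : ContinuousOn m' (Ioi 0)) :
    ContDiffOn ℝ 1 (fun p : ℝ × ℝ => G p.1 p.2) quadrant := by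
  have hmc : ContinuousOn m (Ioi 0) := fun s hs => (hm s hs).continuousAt.continuousWithinAt
  have := contDiffOn_succ_of_partials isOpen_quadrant 0 (f := fun p : ℝ × ℝ => G p.1 p.2)
    (A := fun p => leftDeriv m m' G p.1 p.2) (B := fun p => m (p.1 + p.2) * G p.2 p.1)
    (fun p hp => hG.hasDerivAt_left hm hm' hp.1 hp.2)
    (fun p hp => hG.hasDerivAt_right hmc hp.1 hp.2)
    (contDiffOn_zero.2 (hG.continuousOn_leftDeriv hmc hm'))
    (contDiffOn_zero.2 ((continuousOn_rate_add hmc).mul (hG.continuousOn_swap hmc)))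
  simpa using this

/-- A second bootstrap: `leftKernel` contains `G x u` and `G u x`, whose derivatives in `u` are now
both known and dominated, so `leftDeriv` is itself `C¹`. The other partial derivative is a product
of `C¹` functions. -/
theorem contDiffOn_two (hG : IsCharacteristicSolution m G)
    (hm : ∀ s, 0 < s → HasDerivAt m (m' s) s) (hm' : ∀ s, 0 < s → HasDerivAt m' (m'' s) s)
    (hm'' : ContinuousOn m'' (Ioi 0)) :
    ContDiffOn ℝ 2 (fun p : ℝ × ℝ => G p.1 p.2) quadrant := by
  have hmc : ContinuousOn m (Ioi 0) := fun s hs => (hm s hs).continuousAt.continuousWithinAt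
  have hmc' : ContinuousOn m' (Ioi 0) := fun s hs => (hm' s hs).continuousAt.continuousWithinAt
  have hG1 := hG.contDiffOn_one hm hmc'
  have hGs1 : ContDiffOn ℝ 1 (fun p : ℝ × ℝ => G p.2 p.1) quadrant :=
    hG1.comp (f := Prod.swap) (contDiff_snd.prodMk contDiff_fst).contDiffOn fun _ hp => ⟨hp.2, hp.1⟩
  have hm1 : ContDiffOn ℝ 1 m (Ioi 0) := by
    have h : ContDiffOn ℝ (0 + 1) m (Ioi 0) := by
      rw [contDiffOn_succ_iff_deriv_of_isOpen isOpen_Ioi]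
      refine ⟨fun s hs => (hm s hs).differentiableAt.differentiableWithinAt, by simp, ?_⟩
      rw [contDiffOn_zero]
      exact hmc'.congr fun s hs => (hm s hs).deriv
    simpa using h
  have hB : ContDiffOn ℝ 1 (fun p : ℝ × ℝ => m (p.1 + p.2) * G p.2 p.1) quadrant :=
    (hm1.comp (f := fun p : ℝ × ℝ => p.1 + p.2) (contDiff_fst.add contDiff_snd).contDiffOn
      fun _ hp => add_mem_Ioi hp).mul hGs1
  have hk := hG.isDominated_leftKernel hmc hmc'
  have hkc : ContinuousOn (fun p : ℝ × ℝ => leftKernel m m' G p.1 p.2) quadrant :=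
    ((continuousOn_rate_add hmc').mul (hG.continuousOn_swap hmc)).add
      ((continuousOn_rate_add hmc).mul
        ((continuousOn_rate_add hmc).mul (hG.continuousOn_quadrant hmc)))
  set k' : ℝ → ℝ → ℝ := fun u x =>
    (m'' (u + x) * G x u + m' (u + x) * (m (u + x) * G u x))
      + (m' (u + x) * (m (u + x) * G u x)
        + m (u + x) * (m' (u + x) * G u x + m (u + x) * leftDeriv m m' G u x)) with hk'def
  have hGd := hG.isDominated hmc
  have hk' : IsDominated k' :=
    (((hG.isDominated_swap hmc).mul_left hm'').add ((hGd.mul_left hmc).mul_left hmc')).add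
      (((hGd.mul_left hmc).mul_left hmc').add (((hGd.mul_left hmc').add
        ((hG.isDominated_leftDeriv hmc hmc').mul_left hmc)).mul_left hmc))
  have hkd : ∀ u x, 0 < u → 0 < x → HasDerivAt (fun u => leftKernel m m' G u x) (k' u x) u := by
    intro u x hu hx
    have e1 := (hm (u + x) (add_pos hu hx)).comp_add_const u x
    have e2 := (hm' (u + x) (add_pos hu hx)).comp_add_const u x
    refine ((e2.mul (hG.hasDerivAt_right hmc hx hu)).add
      (e1.mul (e1.mul (hG.hasDerivAt_left hm hmc' hu hx)))).congr_deriv ?_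
    simp only [hk'def, add_comm x u, Pi.mul_apply]
  have hA : ContDiffOn ℝ 1 (fun p : ℝ × ℝ => leftDeriv m m' G p.1 p.2) quadrant := by
    have := contDiffOn_succ_of_partials isOpen_quadrant 0
      (f := fun p : ℝ × ℝ => leftDeriv m m' G p.1 p.2)
      (A := fun p => m'' p.1 + ∫ x in (0 : ℝ)..p.2, k' p.1 x)
      (B := fun p => leftKernel m m' G p.1 p.2)
      (fun p hp => (hm' p.1 hp.1).add (hk.hasDerivAt_integral_left hk' hkd hp.1 hp.2))
      (fun p hp => (hk.hasDerivAt_integral_right hkc hp.1 hp.2).const_add (m' p.1))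
      (contDiffOn_zero.2 ((hm''.comp continuousOn_fst fun _ hp => hp.1).add
        hk'.continuousOn_integral))
      (contDiffOn_zero.2 hkc)
    simpa using this
  have := contDiffOn_succ_of_partials isOpen_quadrant 1 (f := fun p : ℝ × ℝ => G p.1 p.2)
    (A := fun p => leftDeriv m m' G p.1 p.2) (B := fun p => m (p.1 + p.2) * G p.2 p.1)
    (fun p hp => hG.hasDerivAt_left hm hmc' hp.1 hp.2)
    (fun p hp => hG.hasDerivAt_right hmc hp.1 hp.2) (by simpa using hA) (by simpa using hB)
  refine this.of_le ?_
  norm_num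

end IsCharacteristicSolution

/-! ### Second-order partial derivatives in one and in two variables -/

section secondOrder
variable {F : ℝ × ℝ → ℝ} {p : ℝ × ℝ}

theorem _root_.DifferentiableAt.hasDerivAt_snd (hF : DifferentiableAt ℝ F p) :
    HasDerivAt (fun s => F (p.1, s)) (fderiv ℝ F p (0, 1)) p.2 := by
  have h1 : HasDerivAt (fun s : ℝ => (p.1, s)) ((0 : ℝ), (1 : ℝ)) p.2 :=
    (hasDerivAt_const _ _).prodMk (hasDerivAt_id _)
  exact hF.hasFDerivAt.comp_hasDerivAt (f := fun s : ℝ => (p.1, s)) p.2 h1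

theorem _root_.DifferentiableAt.hasDerivAt_fst (hF : DifferentiableAt ℝ F p) :
    HasDerivAt (fun x => F (x, p.2)) (fderiv ℝ F p (1, 0)) p.1 := by
  have h1 : HasDerivAt (fun x : ℝ => (x, p.2)) ((1 : ℝ), (0 : ℝ)) p.1 :=
    (hasDerivAt_id _).prodMk (hasDerivAt_const _ _)
  exact hF.hasFDerivAt.comp_hasDerivAt (f := fun x : ℝ => (x, p.2)) p.1 h1

theorem _root_.ContDiffAt.fderiv_apply_const {n : ℕ} (hF : ContDiffAt ℝ (n + 1) F p) (v : ℝ × ℝ) :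
    ContDiffAt ℝ n (fun q => fderiv ℝ F q v) p :=
  (hF.fderiv_right (m := n) le_rfl).clm_apply contDiffAt_const

theorem _root_.ContDiffAt.fderiv_fderiv_comm (hF : ContDiffAt ℝ 2 F p) (v w : ℝ × ℝ) :
    fderiv ℝ (fun q => fderiv ℝ F q v) p w = fderiv ℝ (fun q => fderiv ℝ F q w) p v := by
  have hd : DifferentiableAt ℝ (fderiv ℝ F) p :=
    (hF.fderiv_right (m := 1) (by norm_num)).differentiableAt (by norm_num)
  have hs : ∀ v w, fderiv ℝ (fun q => fderiv ℝ F q v) p w = fderiv ℝ (fderiv ℝ F) p w v := by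
    intro v w
    rw [fderiv_clm_apply hd (differentiableAt_const v)]
    simp
  rw [hs, hs]
  exact (hF.isSymmSndFDerivAt (by simp)) w v

theorem _root_.ContDiffAt.iteratedDeriv_two_snd (hF : ContDiffAt ℝ 2 F p) :
    iteratedDeriv 2 (fun s => F (p.1, s)) p.2
      = fderiv ℝ (fun q => fderiv ℝ F q (0, 1)) p (0, 1) := by
  have h1 : ∀ᶠ q in 𝓝 p, DifferentiableAt ℝ F q := by
    filter_upwards [hF.eventually (by norm_num)] with q hq using hq.differentiableAt (by norm_num)
  have h2 : ContinuousAt (fun s : ℝ => (p.1, s)) p.2 := by fun_prop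
  have h3 : deriv (fun s => F (p.1, s)) =ᶠ[𝓝 p.2] fun s => fderiv ℝ F (p.1, s) (0, 1) := by
    filter_upwards [h2.eventually h1] with s hs using hs.hasDerivAt_snd.deriv
  rw [iteratedDeriv_succ, iteratedDeriv_one, h3.deriv_eq]
  exact ((hF.fderiv_apply_const (n := 1) (0, 1)).differentiableAt (by norm_num)).hasDerivAt_snd.deriv

theorem _root_.ContDiffAt.iteratedDeriv_two_fst (hF : ContDiffAt ℝ 2 F p) :
    iteratedDeriv 2 (fun x => F (x, p.2)) p.1
      = fderiv ℝ (fun q => fderiv ℝ F q (1, 0)) p (1, 0) := by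
  have h1 : ∀ᶠ q in 𝓝 p, DifferentiableAt ℝ F q := by
    filter_upwards [hF.eventually (by norm_num)] with q hq using hq.differentiableAt (by norm_num)
  have h2 : ContinuousAt (fun x : ℝ => (x, p.2)) p.1 := by fun_prop
  have h3 : deriv (fun x => F (x, p.2)) =ᶠ[𝓝 p.1] fun x => fderiv ℝ F (x, p.2) (1, 0) := by
    filter_upwards [h2.eventually h1] with s hs using hs.hasDerivAt_fst.deriv
  rw [iteratedDeriv_succ, iteratedDeriv_one, h3.deriv_eq]
  exact ((hF.fderiv_apply_const (n := 1) (1, 0)).differentiableAt (by norm_num)).hasDerivAt_fst.deriv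

end secondOrder

/-! ### From the first-order system to the second-order equation -/

theorem isOpen_frontRegion (c : ℝ) : IsOpen (frontRegion c) :=
  isOpen_lt (by fun_prop) (by fun_prop)

theorem pos_of_mem_frontRegion {c : ℝ} (hc : 0 < c) {p : ℝ × ℝ} (hp : p ∈ frontRegion c) :
    0 < p.2 := by
  have h : |p.1| < c * p.2 := hp
  exact pos_of_mul_pos_right ((abs_nonneg _).trans_lt h) hc.le

/-- `F` and `H` are `C¹` solutions on the region `|η| < c t` of the first-order system
`F_t + c H_η = - (lam / 2) F`, `H_t + c F_η = - (3 lam / 2) H`. -/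
structure IsTelegraphPair (c : ℝ) (lam : ℝ → ℝ) (F H : ℝ × ℝ → ℝ) : Prop where
  contDiffOn_left : ContDiffOn ℝ 1 F (frontRegion c)
  contDiffOn_right : ContDiffOn ℝ 1 H (frontRegion c)
  left : ∀ p ∈ frontRegion c,
    fderiv ℝ F p (0, 1) = -c * fderiv ℝ H p (1, 0) - lam p.2 / 2 * F p
  right : ∀ p ∈ frontRegion c,
    fderiv ℝ H p (0, 1) = -c * fderiv ℝ F p (1, 0) - 3 * lam p.2 / 2 * H p

namespace IsTelegraphPair
variable {c : ℝ} {lam : ℝ → ℝ} {F H : ℝ × ℝ → ℝ}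

theorem congr (h : IsTelegraphPair c lam F H) {F' : ℝ × ℝ → ℝ} (he : EqOn F' F (frontRegion c)) :
    IsTelegraphPair c lam F' H := by
  have hf : ∀ p ∈ frontRegion c, fderiv ℝ F' p = fderiv ℝ F p := fun p hp =>
    (he.eventuallyEq_of_mem ((isOpen_frontRegion c).mem_nhds hp)).fderiv_eq
  refine ⟨h.contDiffOn_left.congr he, h.contDiffOn_right, fun p hp => ?_, fun p hp => ?_⟩
  · rw [hf p hp, he hp, h.left p hp]
  · rw [hf p hp, h.right p hp]

/-- The first equation is differentiated in `t` and the second in `η`; symmetry of second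
derivatives eliminates the mixed derivative of `H`. -/
theorem solvesAt (h : IsTelegraphPair c lam F H) (hc : 0 < c)
    (hlam : DifferentiableOn ℝ lam (Ioi 0))
    (hF : ContDiffOn ℝ 2 F (frontRegion c)) (hH : ContDiffOn ℝ 2 H (frontRegion c)) {η t : ℝ}
    (hηt : |η| < c * t) : SolvesAt c lam (fun x s => F (x, s)) η t := by
  have hp : (η, t) ∈ frontRegion c := hηt
  have hnhds := (isOpen_frontRegion c).mem_nhds hp
  have ht : 0 < t := pos_of_mem_frontRegion hc hp
  have hFp := hF.contDiffAt hnhds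
  have hHp := hH.contDiffAt hnhds
  have hFd : DifferentiableAt ℝ F (η, t) := hFp.differentiableAt (by norm_num)
  have hHd : DifferentiableAt ℝ H (η, t) := hHp.differentiableAt (by norm_num)
  have hl : HasDerivAt lam (deriv lam t) t :=
    (hlam.differentiableAt (Ioi_mem_nhds ht)).hasDerivAt
  have hHη := ((hHp.fderiv_apply_const (n := 1) (1, 0)).differentiableAt (by norm_num))
  have hHt := ((hHp.fderiv_apply_const (n := 1) (0, 1)).differentiableAt (by norm_num))
  have hFη := ((hFp.fderiv_apply_const (n := 1) (1, 0)).differentiableAt (by norm_num))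
  have hFt := ((hFp.fderiv_apply_const (n := 1) (0, 1)).differentiableAt (by norm_num))
  have e1 := hFp.iteratedDeriv_two_snd
  have e2 := hFp.iteratedDeriv_two_fst
  have e3 := hFd.hasDerivAt_snd.deriv
  have ec := hHp.fderiv_fderiv_comm (1, 0) (0, 1)
  simp only at e1 e2 e3
  have c1 : ContinuousAt (fun s : ℝ => (η, s)) t := by fun_prop
  have c2 : ContinuousAt (fun x : ℝ => (x, t)) η := by fun_prop
  have d1 : fderiv ℝ (fun q => fderiv ℝ F q (0, 1)) (η, t) (0, 1) =
      -c * fderiv ℝ (fun q => fderiv ℝ H q (1, 0)) (η, t) (0, 1)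
        - (deriv lam t / 2 * F (η, t) + lam t / 2 * fderiv ℝ F (η, t) (0, 1)) := by
    have r := (hHη.hasDerivAt_snd.const_mul (-c)).sub ((hl.div_const 2).mul hFd.hasDerivAt_snd)
    refine hFt.hasDerivAt_snd.unique (r.congr_of_eventuallyEq ?_)
    filter_upwards [c1.eventually hnhds] with s hs using h.left (η, s) hs
  have d2 : fderiv ℝ (fun q => fderiv ℝ H q (0, 1)) (η, t) (1, 0) =
      -c * fderiv ℝ (fun q => fderiv ℝ F q (1, 0)) (η, t) (1, 0)
        - 3 * lam t / 2 * fderiv ℝ H (η, t) (1, 0) := by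
    have r := (hFη.hasDerivAt_fst.const_mul (-c)).sub (hHd.hasDerivAt_fst.const_mul (3 * lam t / 2))
    refine hHt.hasDerivAt_fst.unique (r.congr_of_eventuallyEq ?_)
    filter_upwards [c2.eventually hnhds] with x hx using h.right (x, t) hx
  have hl1 := h.left (η, t) hp
  simp only at hl1
  rw [SolvesAt, e1, e2, e3, d1, ec, d2]
  -- What remains of `H` is the term `(3 / 2) * lam * c * H_η`, which the first equation itself
  -- expresses through `F`.
  linear_combination (3 / 2 * lam t) * hl1

end IsTelegraphPair

theorem integral_fderiv_apply_eq_zero {A : ℝ × ℝ → ℝ} (hA : ContDiff ℝ 1 A)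
    (hs : HasCompactSupport A) (v : ℝ × ℝ) : Integrable (fun p => fderiv ℝ A p v) ∧
      ∫ p, fderiv ℝ A p v = 0 := by
  have hd : Continuous fun p => fderiv ℝ A p v :=
    (hA.continuous_fderiv (by norm_num)).clm_apply continuous_const
  have hi : Integrable (fun p => fderiv ℝ A p v) :=
    hd.integrable_of_hasCompactSupport (hs.fderiv_apply (𝕜 := ℝ) v)
  refine ⟨hi, ?_⟩
  have := integral_mul_fderiv_eq_neg_fderiv_mul_of_integrable (𝕜 := ℝ) (μ := volume)
    (f := fun _ : ℝ × ℝ => (1 : ℝ)) (g := A) (v := v) (by simp) (by simpa using hi)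
    (by simpa using hA.continuous.integrable_of_hasCompactSupport hs)
    (fun _ _ => differentiableAt_const _) (fun p _ => hA.differentiable (by norm_num) p)
  simpa using this

theorem contDiff_of_contDiffOn_of_tsupport {A φ : ℝ × ℝ → ℝ} {S : Set (ℝ × ℝ)} (hS : IsOpen S)
    (hA : ContDiffOn ℝ 1 A S) (hφ : tsupport φ ⊆ S) (h0 : ∀ p ∉ tsupport φ, A p = 0) :
    ContDiff ℝ 1 A := by
  rw [contDiff_iff_contDiffAt]
  intro p
  by_cases hp : p ∈ tsupport φ
  · exact hA.contDiffAt (hS.mem_nhds (hφ hp))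
  · refine contDiffAt_const (c := (0 : ℝ)) |>.congr_of_eventuallyEq ?_
    filter_upwards [(isClosed_tsupport φ).isOpen_compl.mem_nhds hp] with q hq using h0 q hq

theorem fderiv_of_notMem_tsupport' {φ : ℝ × ℝ → ℝ} {p : ℝ × ℝ} (hp : p ∉ tsupport φ) :
    fderiv ℝ φ p = 0 := by
  by_contra h
  exact hp (support_fderiv_subset ℝ h)

namespace IsTelegraphPair
variable {c : ℝ} {lam : ℝ → ℝ} {F H : ℝ × ℝ → ℝ}

/-- With `C¹` data the elimination cannot be done pointwise. Instead, the integrand is the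
divergence `A_t + B_η` of a compactly supported `C¹` field, whose integral vanishes. -/
theorem solvesWeakly (h : IsTelegraphPair c lam F H) (hc : 0 < c)
    (hlam : ContDiffOn ℝ 1 lam (Ioi 0)) : SolvesWeakly c lam (fun x s => F (x, s)) := by
  intro φ hφ hcs hsub
  have hR := isOpen_frontRegion c
  set φt : ℝ × ℝ → ℝ := fun q => fderiv ℝ φ q (0, 1) with hφt
  set φx : ℝ × ℝ → ℝ := fun q => fderiv ℝ φ q (1, 0) with hφx
  set L : ℝ × ℝ → ℝ := fun q => lam q.2 with hL
  have hφ2 : ∀ p, ContDiffAt ℝ 2 φ p := fun p =>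
    hφ.contDiffAt.of_le (WithTop.coe_le_coe.2 (le_top : (2 : ℕ∞) ≤ ⊤))
  have hφ1 : ContDiff ℝ 1 φ := hφ.of_le (by exact_mod_cast le_top)
  have hφt1 : ContDiff ℝ 1 φt := contDiff_iff_contDiffAt.2 fun p =>
    (hφ2 p).fderiv_apply_const (n := 1) (0, 1)
  have hφx1 : ContDiff ℝ 1 φx := contDiff_iff_contDiffAt.2 fun p =>
    (hφ2 p).fderiv_apply_const (n := 1) (1, 0)
  have hL1 : ContDiffOn ℝ 1 L (frontRegion c) :=
    hlam.comp contDiff_snd.contDiffOn fun p hp => pos_of_mem_frontRegion hc hp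
  -- The first two terms of `A` and `B` are the integrations by parts for the wave operator, in
  -- which the mixed terms `H φ_tη` cancel. The terms with `3 / 2` are forced by the damping: that
  -- of `B` cancels the `H φ_η` left by the second equation, and that of `A` completes the
  -- coefficients of `φ_t` and `φ`.
  set A : ℝ × ℝ → ℝ := fun p => F p * φt p - c * (H p * φx p) - 3 / 2 * (L p * (F p * φ p)) with hA
  set B : ℝ × ℝ → ℝ := fun p => c * (H p * φt p) - c ^ 2 * (F p * φx p)
    - 3 / 2 * c * (L p * (H p * φ p)) with hB
  have hzero : ∀ p ∉ tsupport φ, φ p = 0 ∧ φt p = 0 ∧ φx p = 0 := fun p hp => by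
    refine ⟨image_eq_zero_of_notMem_tsupport hp, ?_, ?_⟩ <;>
    simp [hφt, hφx, fderiv_of_notMem_tsupport' hp]
  have hA0 : ∀ p ∉ tsupport φ, A p = 0 := fun p hp => by
    obtain ⟨h1, h2, h3⟩ := hzero p hp
    simp [hA, h1, h2, h3]
  have hB0 : ∀ p ∉ tsupport φ, B p = 0 := fun p hp => by
    obtain ⟨h1, h2, h3⟩ := hzero p hp
    simp [hB, h1, h2, h3]
  have hFc := h.contDiffOn_left
  have hHc := h.contDiffOn_right
  have hAc : ContDiff ℝ 1 A := contDiff_of_contDiffOn_of_tsupport hR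
    (((hFc.mul hφt1.contDiffOn).sub (contDiffOn_const.mul (hHc.mul hφx1.contDiffOn))).sub
      (contDiffOn_const.mul (hL1.mul (hFc.mul hφ1.contDiffOn)))) hsub hA0
  have hBc : ContDiff ℝ 1 B := contDiff_of_contDiffOn_of_tsupport hR
    (((contDiffOn_const.mul (hHc.mul hφt1.contDiffOn)).sub
      (contDiffOn_const.mul (hFc.mul hφx1.contDiffOn))).sub
      (contDiffOn_const.mul (hL1.mul (hHc.mul hφ1.contDiffOn)))) hsub hB0
  have hAs : HasCompactSupport A := HasCompactSupport.intro hcs hA0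
  have hBs : HasCompactSupport B := HasCompactSupport.intro hcs hB0
  obtain ⟨hAi, hAz⟩ := integral_fderiv_apply_eq_zero hAc hAs (0, 1)
  obtain ⟨hBi, hBz⟩ := integral_fderiv_apply_eq_zero hBc hBs (1, 0)
  have hoff : ∀ p ∉ frontRegion c, fderiv ℝ A p (0, 1) + fderiv ℝ B p (1, 0) = 0 := fun p hp => by
    have hpA : p ∉ tsupport A := fun hp' => hp (hsub (closure_minimal
      (show Function.support A ⊆ tsupport φ from
        fun q hq => by_contra fun hq' => hq (hA0 q hq')) (isClosed_tsupport φ) hp'))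
    have hpB : p ∉ tsupport B := fun hp' => hp (hsub (closure_minimal
      (show Function.support B ⊆ tsupport φ from
        fun q hq => by_contra fun hq' => hq (hB0 q hq')) (isClosed_tsupport φ) hp'))
    simp [fderiv_of_notMem_tsupport' hpA, fderiv_of_notMem_tsupport' hpB]
  have hmain : ∀ p ∈ frontRegion c, F p *
      (iteratedDeriv 2 (fun s => φ (p.1, s)) p.2
        - 2 * deriv (fun s => lam s * φ (p.1, s)) p.2
        + 1 / 2 * (3 / 2 * lam p.2 ^ 2 + deriv lam p.2) * φ p
        - c ^ 2 * iteratedDeriv 2 (fun x => φ (x, p.2)) p.1)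
      = fderiv ℝ A p (0, 1) + fderiv ℝ B p (1, 0) := by
    intro p hp
    have hpos := pos_of_mem_frontRegion hc hp
    have hl : HasDerivAt lam (deriv lam p.2) p.2 :=
      ((hlam.differentiableOn (by norm_num)).differentiableAt (Ioi_mem_nhds hpos)).hasDerivAt
    have hFd := ((hFc.contDiffAt (hR.mem_nhds hp)).differentiableAt (by norm_num))
    have hHd := ((hHc.contDiffAt (hR.mem_nhds hp)).differentiableAt (by norm_num))
    have hφd := hφ1.differentiable (by norm_num) p
    have hφtd := hφt1.differentiable (by norm_num) p
    have hφxd := hφx1.differentiable (by norm_num) p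
    have hAd := hAc.differentiable (by norm_num) p
    have hBd := hBc.differentiable (by norm_num) p
    have eA := hAd.hasDerivAt_snd.unique
      (((hFd.hasDerivAt_snd.mul hφtd.hasDerivAt_snd).sub
        ((hHd.hasDerivAt_snd.mul hφxd.hasDerivAt_snd).const_mul c)).sub
        ((hl.mul (hFd.hasDerivAt_snd.mul hφd.hasDerivAt_snd)).const_mul (3 / 2)))
    have eB := hBd.hasDerivAt_fst.unique
      ((((hHd.hasDerivAt_fst.mul hφtd.hasDerivAt_fst).const_mul c).sub
        ((hFd.hasDerivAt_fst.mul hφxd.hasDerivAt_fst).const_mul (c ^ 2))).sub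
        (((hHd.hasDerivAt_fst.mul hφd.hasDerivAt_fst).const_mul (lam p.2)).const_mul (3 / 2 * c)))
    have e1 := (hφ2 p).iteratedDeriv_two_snd
    have e2 := (hφ2 p).iteratedDeriv_two_fst
    have e3 := (hl.mul hφd.hasDerivAt_snd).deriv
    have ec : fderiv ℝ φt p (1, 0) = fderiv ℝ φx p (0, 1) := (hφ2 p).fderiv_fderiv_comm (0, 1) (1, 0)
    have h1 := h.left p hp
    have h2 := h.right p hp
    simp only [Pi.mul_apply] at eA
    rw [e1, e2, show (deriv (fun s => lam s * φ (p.1, s)) p.2) = _ from e3, eA, eB, ec, h1, h2]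
    simp only [hφt, hφx]
    ring
  calc ∫ p in frontRegion c, F p *
      (iteratedDeriv 2 (fun s => φ (p.1, s)) p.2
        - 2 * deriv (fun s => lam s * φ (p.1, s)) p.2
        + 1 / 2 * (3 / 2 * lam p.2 ^ 2 + deriv lam p.2) * φ p
        - c ^ 2 * iteratedDeriv 2 (fun x => φ (x, p.2)) p.1)
      = ∫ p in frontRegion c, (fderiv ℝ A p (0, 1) + fderiv ℝ B p (1, 0)) :=
        setIntegral_congr_fun hR.measurableSet hmain
    _ = ∫ p, (fderiv ℝ A p (0, 1) + fderiv ℝ B p (1, 0)) :=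
        setIntegral_eq_integral_of_forall_compl_eq_zero hoff
    _ = 0 := by rw [integral_add hAi hBi, hAz, hBz, add_zero]

end IsTelegraphPair

/-! ### Characteristic coordinates and the two halves of the density -/

/-- The characteristic coordinates `((t - η / c) / 2, (t + η / c) / 2)` of `(η, t)`. -/
def charCoord (c : ℝ) (p : ℝ × ℝ) : ℝ × ℝ := ((p.2 - p.1 / c) / 2, (p.2 + p.1 / c) / 2)

theorem charCoord_mem_quadrant {c : ℝ} (hc : 0 < c) {p : ℝ × ℝ} (hp : p ∈ frontRegion c) :
    charCoord c p ∈ quadrant := by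
  have h : |p.1| < c * p.2 := hp
  rw [abs_lt] at h
  have e : p.1 / c * c = p.1 := div_mul_cancel₀ _ hc.ne'
  constructor
  · have : p.1 / c < p.2 := by rw [div_lt_iff₀ hc]; linarith
    change 0 < (p.2 - p.1 / c) / 2
    linarith
  · have : -p.2 < p.1 / c := by rw [lt_div_iff₀ hc]; linarith
    change 0 < (p.2 + p.1 / c) / 2
    linarith

theorem contDiff_charCoord (c : ℝ) {n : WithTop ℕ∞} : ContDiff ℝ n (charCoord c) := by
  unfold charCoord
  fun_prop

/-- The part of the edge density carried by the particles whose current direction gives `X - Y`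
the velocity `c`. -/
def rightPart (c : ℝ) (lam : ℝ → ℝ) (G : ℝ → ℝ → ℝ) (p : ℝ × ℝ) : ℝ :=
  Real.exp (-cumRate lam p.2) / (8 * c) * G (charCoord c p).1 (charCoord c p).2

/-- The part of the edge density carried by the particles whose current direction gives `X - Y`
the velocity `-c`. -/
def leftPart (c : ℝ) (lam : ℝ → ℝ) (G : ℝ → ℝ → ℝ) (p : ℝ × ℝ) : ℝ :=
  Real.exp (-cumRate lam p.2) / (8 * c) * G (charCoord c p).2 (charCoord c p).1

section parts
variable {c : ℝ} {lam : ℝ → ℝ} {G : ℝ → ℝ → ℝ}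

theorem contDiffOn_cumRate_succ (hLam : ∀ t, 0 < t → IntegrableOn lam (Ioc 0 t)) (n : ℕ)
    (hlam : ContDiffOn ℝ n lam (Ioi 0)) : ContDiffOn ℝ (n + 1) (cumRate lam) (Ioi 0) := by
  have hd : ∀ t ∈ Ioi (0 : ℝ), HasDerivAt (cumRate lam) (lam t) t := fun t ht =>
    hasDerivAt_cumRate hLam hlam.continuousOn ht
  rw [contDiffOn_succ_iff_deriv_of_isOpen isOpen_Ioi]
  exact ⟨fun t ht => (hd t ht).differentiableAt.differentiableWithinAt, by simp,
    hlam.congr fun t ht => (hd t ht).deriv⟩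

theorem contDiffOn_exp_cumRate (hc : 0 < c) (hLam : ∀ t, 0 < t → IntegrableOn lam (Ioc 0 t))
    (n : ℕ) (hlam : ContDiffOn ℝ n lam (Ioi 0)) :
    ContDiffOn ℝ n (fun p : ℝ × ℝ => Real.exp (-cumRate lam p.2) / (8 * c)) (frontRegion c) := by
  have h1 : ContDiffOn ℝ n (cumRate lam) (Ioi 0) :=
    (contDiffOn_cumRate_succ hLam n hlam).of_le (by exact_mod_cast Nat.le_succ n)
  have h2 : ContDiffOn ℝ n (fun p : ℝ × ℝ => cumRate lam p.2) (frontRegion c) :=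
    h1.comp contDiff_snd.contDiffOn fun p hp => pos_of_mem_frontRegion hc hp
  exact h2.neg.exp.div_const _

theorem contDiffOn_rightPart (hc : 0 < c) (hLam : ∀ t, 0 < t → IntegrableOn lam (Ioc 0 t))
    (n : ℕ) (hlam : ContDiffOn ℝ n lam (Ioi 0))
    (hG : ContDiffOn ℝ n (fun p : ℝ × ℝ => G p.1 p.2) quadrant) :
    ContDiffOn ℝ n (rightPart c lam G) (frontRegion c) :=
  (contDiffOn_exp_cumRate hc hLam n hlam).mul
    (hG.comp (contDiff_charCoord c).contDiffOn fun _ hp => charCoord_mem_quadrant hc hp)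

theorem contDiffOn_leftPart (hc : 0 < c) (hLam : ∀ t, 0 < t → IntegrableOn lam (Ioc 0 t))
    (n : ℕ) (hlam : ContDiffOn ℝ n lam (Ioi 0))
    (hG : ContDiffOn ℝ n (fun p : ℝ × ℝ => G p.1 p.2) quadrant) :
    ContDiffOn ℝ n (leftPart c lam G) (frontRegion c) := by
  have hs : ContDiffOn ℝ n (fun p : ℝ × ℝ => G p.2 p.1) quadrant :=
    hG.comp (f := Prod.swap) (contDiff_snd.prodMk contDiff_fst).contDiffOn
      fun _ hp => ⟨hp.2, hp.1⟩
  exact (contDiffOn_exp_cumRate hc hLam n hlam).mul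
    (hs.comp (contDiff_charCoord c).contDiffOn fun _ hp => charCoord_mem_quadrant hc hp)

theorem hasDerivAt_exp_cumRate (hLam : ∀ t, 0 < t → IntegrableOn lam (Ioc 0 t))
    (hlam : ContinuousOn lam (Ioi 0)) {t : ℝ} (ht : 0 < t) :
    HasDerivAt (fun s => Real.exp (-cumRate lam s) / (8 * c))
      (-lam t * (Real.exp (-cumRate lam t) / (8 * c))) t := by
  refine ((hasDerivAt_cumRate hLam hlam ht).neg.exp.div_const (8 * c)).congr_deriv ?_
  simp only [Pi.neg_apply]
  ring

theorem charCoord_right {c : ℝ} (hc : c ≠ 0) (p : ℝ × ℝ) (s : ℝ) :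
    charCoord c (p + s • (c, 1)) = ((charCoord c p).1, (charCoord c p).2 + s) := by
  simp only [charCoord, Prod.fst_add, Prod.snd_add, Prod.smul_fst, Prod.smul_snd, smul_eq_mul,
    mul_one, Prod.mk.injEq]
  constructor <;> (field_simp; ring)

theorem charCoord_left {c : ℝ} (hc : c ≠ 0) (p : ℝ × ℝ) (s : ℝ) :
    charCoord c (p + s • (-c, 1)) = ((charCoord c p).1 + s, (charCoord c p).2) := by
  simp only [charCoord, Prod.fst_add, Prod.snd_add, Prod.smul_fst, Prod.smul_snd, smul_eq_mul,
    mul_one, Prod.mk.injEq]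
  constructor <;> (field_simp; ring)

theorem charCoord_add (c : ℝ) (p : ℝ × ℝ) : (charCoord c p).1 + (charCoord c p).2 = p.2 := by
  simp only [charCoord]; ring

/-- Along `(c, 1)` the first characteristic coordinate is fixed and the second grows at unit speed,
so only `∂_v G` enters. The coordinates add up to `t`, which makes the coefficient `lam t / 2`; the
exponential factor contributes `-lam t`. -/
theorem fderiv_rightPart (hc : 0 < c) (hLam : ∀ t, 0 < t → IntegrableOn lam (Ioc 0 t))
    (hlam : ContDiffOn ℝ 1 lam (Ioi 0)) (hG : IsCharacteristicSolution (fun s => lam s / 2) G)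
    (hG1 : ContDiffOn ℝ 1 (fun p : ℝ × ℝ => G p.1 p.2) quadrant) {p : ℝ × ℝ}
    (hp : p ∈ frontRegion c) :
    fderiv ℝ (rightPart c lam G) p (c, 1)
      = -lam p.2 * rightPart c lam G p + lam p.2 / 2 * leftPart c lam G p := by
  have hd : DifferentiableAt ℝ (rightPart c lam G) p :=
    ((contDiffOn_rightPart hc hLam 1 hlam hG1).contDiffAt
      ((isOpen_frontRegion c).mem_nhds hp)).differentiableAt (by norm_num)
  have hpos := pos_of_mem_frontRegion hc hp
  have hq := charCoord_mem_quadrant hc hp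
  have h1 := hd.hasFDerivAt.hasLineDerivAt (c, 1)
  have h2 : HasDerivAt (fun s : ℝ => rightPart c lam G (p + s • (c, 1)))
      (-lam p.2 * rightPart c lam G p + lam p.2 / 2 * leftPart c lam G p) 0 := by
    have e1 : HasDerivAt (fun s : ℝ => Real.exp (-cumRate lam (p.2 + s)) / (8 * c))
        (-lam p.2 * (Real.exp (-cumRate lam p.2) / (8 * c))) 0 := by
      have := hasDerivAt_exp_cumRate (c := c) hLam hlam.continuousOn hpos
      rw [← add_zero p.2] at this
      simpa using this.comp_const_add p.2 0
    have e2 := hG.hasDerivAt_right (hlam.continuousOn.div_const 2) hq.1 hq.2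
    have e3 : HasDerivAt (fun s : ℝ => G (charCoord c p).1 ((charCoord c p).2 + s))
        (lam p.2 / 2 * G (charCoord c p).2 (charCoord c p).1) 0 := by
      rw [charCoord_add] at e2
      rw [← add_zero (charCoord c p).2] at e2
      simpa using e2.comp_const_add (charCoord c p).2 0
    refine ((e1.mul e3).congr_deriv ?_).congr_of_eventuallyEq (Eventually.of_forall fun s => ?_)
    · simp only [rightPart, leftPart, add_zero]; ring
    · simp only [rightPart, charCoord_right hc.ne', Pi.mul_apply]
      simp
  exact h1.unique h2

theorem fderiv_leftPart (hc : 0 < c) (hLam : ∀ t, 0 < t → IntegrableOn lam (Ioc 0 t))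
    (hlam : ContDiffOn ℝ 1 lam (Ioi 0)) (hG : IsCharacteristicSolution (fun s => lam s / 2) G)
    (hG1 : ContDiffOn ℝ 1 (fun p : ℝ × ℝ => G p.1 p.2) quadrant) {p : ℝ × ℝ}
    (hp : p ∈ frontRegion c) :
    fderiv ℝ (leftPart c lam G) p (-c, 1)
      = -lam p.2 * leftPart c lam G p + lam p.2 / 2 * rightPart c lam G p := by
  have hd : DifferentiableAt ℝ (leftPart c lam G) p :=
    ((contDiffOn_leftPart hc hLam 1 hlam hG1).contDiffAt
      ((isOpen_frontRegion c).mem_nhds hp)).differentiableAt (by norm_num)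
  have hpos := pos_of_mem_frontRegion hc hp
  have hq := charCoord_mem_quadrant hc hp
  have h1 := hd.hasFDerivAt.hasLineDerivAt (-c, 1)
  have h2 : HasDerivAt (fun s : ℝ => leftPart c lam G (p + s • (-c, 1)))
      (-lam p.2 * leftPart c lam G p + lam p.2 / 2 * rightPart c lam G p) 0 := by
    have e1 : HasDerivAt (fun s : ℝ => Real.exp (-cumRate lam (p.2 + s)) / (8 * c))
        (-lam p.2 * (Real.exp (-cumRate lam p.2) / (8 * c))) 0 := by
      have := hasDerivAt_exp_cumRate (c := c) hLam hlam.continuousOn hpos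
      rw [← add_zero p.2] at this
      simpa using this.comp_const_add p.2 0
    have e2 := hG.hasDerivAt_right (hlam.continuousOn.div_const 2) hq.2 hq.1
    have e3 : HasDerivAt (fun s : ℝ => G (charCoord c p).2 ((charCoord c p).1 + s))
        (lam p.2 / 2 * G (charCoord c p).1 (charCoord c p).2) 0 := by
      rw [add_comm (charCoord c p).2, charCoord_add] at e2
      rw [← add_zero (charCoord c p).1] at e2
      simpa using e2.comp_const_add (charCoord c p).1 0
    refine ((e1.mul e3).congr_deriv ?_).congr_of_eventuallyEq (Eventually.of_forall fun s => ?_)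
    · simp only [rightPart, leftPart, add_zero]; ring
    · simp only [leftPart, charCoord_left hc.ne', Pi.mul_apply]
      simp
  exact h1.unique h2

/-- The coupling matrix of the two halves, with diagonal `-lam` and off-diagonal `lam / 2`, acts on
their sum by `-lam / 2` and on their difference by `-3 * lam / 2`. -/
theorem isTelegraphPair (hc : 0 < c) (hLam : ∀ t, 0 < t → IntegrableOn lam (Ioc 0 t))
    (hlam : ContDiffOn ℝ 1 lam (Ioi 0)) (hG : IsCharacteristicSolution (fun s => lam s / 2) G)
    (hG1 : ContDiffOn ℝ 1 (fun p : ℝ × ℝ => G p.1 p.2) quadrant) :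
    IsTelegraphPair c lam (fun p => rightPart c lam G p + leftPart c lam G p)
      (fun p => rightPart c lam G p - leftPart c lam G p) := by
  have hr := contDiffOn_rightPart hc hLam 1 hlam hG1
  have hl := contDiffOn_leftPart hc hLam 1 hlam hG1
  have hrd : ∀ p ∈ frontRegion c, DifferentiableAt ℝ (rightPart c lam G) p := fun p hp =>
    (hr.contDiffAt ((isOpen_frontRegion c).mem_nhds hp)).differentiableAt (by norm_num)
  have hld : ∀ p ∈ frontRegion c, DifferentiableAt ℝ (leftPart c lam G) p := fun p hp =>
    (hl.contDiffAt ((isOpen_frontRegion c).mem_nhds hp)).differentiableAt (by norm_num)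
  have v1 : ((c, 1) : ℝ × ℝ) = c • (1, 0) + (0, 1) := by simp
  have v2 : ((-c, 1) : ℝ × ℝ) = (-c) • (1, 0) + (0, 1) := by simp
  refine ⟨hr.add hl, hr.sub hl, fun p hp => ?_, fun p hp => ?_⟩
  all_goals
    have h1 := fderiv_rightPart hc hLam hlam hG hG1 hp
    have h2 := fderiv_leftPart hc hLam hlam hG hG1 hp
    rw [v1, map_add, map_smul, smul_eq_mul] at h1
    rw [v2, map_add, map_smul, smul_eq_mul] at h2
    rw [fderiv_fun_add (hrd p hp) (hld p hp), fderiv_fun_sub (hrd p hp) (hld p hp)]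
    simp only [_root_.add_apply, _root_.sub_apply]
  · linear_combination h1 + h2
  · linear_combination h1 - h2

end parts

/-! ### Paths that stay on the edge -/

/-- The direction after `j` turns. -/
def heading {Ω : Type*} (D₀ : Ω → ZMod 4) (ε : ℕ → Ω → ZMod 4) (j : ℕ) (ω : Ω) : ZMod 4 :=
  D₀ ω + ∑ i ∈ Finset.range j, ε i ω

theorem exists_eq_of_le_add_one {a : ℕ → ℕ} (h0 : a 0 = 0) {M j : ℕ}
    (h : ∀ i < M, a (i + 1) ≤ a i + 1) (hj : j ≤ a M) : ∃ i ≤ M, a i = j := by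
  induction M with
  | zero => exact ⟨0, le_rfl, by omega⟩
  | succ M ih =>
    rcases le_or_gt j (a M) with h1 | h1
    · obtain ⟨i, hi, rfl⟩ := ih (fun i hi => h i (hi.trans M.lt_succ_self)) h1
      exact ⟨i, by omega, rfl⟩
    · have := h M M.lt_succ_self
      exact ⟨M + 1, le_rfl, by omega⟩

/-- Almost surely, all levels up to the current one have been visited before the current time. -/
theorem IsPoissonProcess.ae_exists_lt_eq {Ω : Type*} [MeasurableSpace Ω] {P : Measure Ω}
    [IsProbabilityMeasure P] {lam : ℝ → ℝ} {N : ℝ≥0 → Ω → ℕ} (hN : IsPoissonProcess P lam N)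
    (hLam : ∀ t, 0 < t → IntegrableOn lam (Ioc 0 t)) (h0 : ∀ t, 0 < t → 0 ≤ lam t)
    {t : ℝ≥0} (ht : 0 < t) : ∀ᵐ ω ∂P, ∀ j ≤ N t ω, ∃ s < t, N s ω = j := by
  rw [ae_iff]
  set bad := {ω | ¬ ∀ j ≤ N t ω, ∃ s < t, N s ω = j} with hbad
  have hA0 : 0 ≤ cumRate lam t := cumRate_nonneg hLam h0 t.2
  -- A level is missed only if `N` jumps by at least two or has an event exactly at time `t`. The
  -- interval is cut so finely that every cell has cumulative rate at most `δ`: two events in a cell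
  -- then have probability at most `δ` times the rate of the cell, which telescopes to `δ * cumRate
  -- lam t`, and an event in the last cell adds at most `δ`.
  have key : ∀ δ > 0, P.real bad ≤ δ * (cumRate lam t + 1) := by
    intro δ hδ
    have hu := isCompact_Icc.uniformContinuousOn_of_continuous (continuousOn_cumRate hLam (t : ℝ))
    obtain ⟨r, hr, hru⟩ := Metric.uniformContinuousOn_iff.1 hu δ hδ
    obtain ⟨M, hM⟩ := exists_nat_gt ((t : ℝ) / r)
    let τ : ℕ → ℝ≥0 := fun i => t * ((i : ℝ≥0) / (M + 1))
    have hτ0 : τ 0 = 0 := by simp [τ]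
    have hτM : τ (M + 1) = t := by
      simp only [τ, Nat.cast_add, Nat.cast_one]
      rw [div_self (by positivity), mul_one]
    have hτlt : ∀ i ≤ M, τ i < t := by
      intro i hi
      have : ((i : ℝ≥0) / (M + 1)) < 1 := by
        rw [div_lt_one (by positivity)]
        exact_mod_cast Nat.lt_succ_of_le hi
      simpa only [mul_one] using mul_lt_mul_of_pos_left this ht
    have hτm : ∀ i, τ i ≤ τ (i + 1) := by
      intro i
      simp only [τ]
      gcongr
      exact Nat.le_succ i
    have hd : ∀ i, ((τ (i + 1) : ℝ≥0) : ℝ) - τ i = t / (M + 1) := by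
      intro i
      simp only [τ]
      push_cast
      ring
    have hsmall : (t : ℝ) / (M + 1) < r := by
      rw [div_lt_iff₀ hr] at hM
      rw [div_lt_iff₀ (by positivity)]
      nlinarith
    have hle : ∀ i ≤ M + 1, τ i ≤ t := fun i hi => by
      rcases Nat.lt_or_ge M i with h | h
      · rw [show i = M + 1 by omega, hτM]
      · exact (hτlt i h).le
    have hinc0 : ∀ i, 0 ≤ cumRate lam (τ (i + 1)) - cumRate lam (τ i) := fun i =>
      sub_nonneg.2 (cumRate_mono hLam h0 (τ i).2 (by exact_mod_cast hτm i))
    have hinc : ∀ i ≤ M, cumRate lam (τ (i + 1)) - cumRate lam (τ i) ≤ δ := by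
      intro i hi
      have := hru (τ (i + 1)) ⟨(τ _).2, by exact_mod_cast hle _ (by omega)⟩ (τ i)
        ⟨(τ _).2, by exact_mod_cast hle _ (by omega)⟩ (by
          rw [Real.dist_eq, hd, abs_of_nonneg (by positivity)]; exact hsmall)
      rw [Real.dist_eq] at this
      exact (le_abs_self _).trans this.le
    -- If every cell but the last sees at most one event and the last sees none, the grid values
    -- climb by steps of at most one and already reach `N t` at a grid time before `t`.
    have hsub : bad ⊆ (⋃ i ∈ Finset.range M, {ω | 2 ≤ N (τ (i + 1)) ω - N (τ i) ω}) ∪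
        {ω | 1 ≤ N (τ (M + 1)) ω - N (τ M) ω} := by
      intro ω hω
      by_contra hcon
      apply hω
      simp only [mem_union, mem_iUnion, mem_ofPred_eq, not_or, not_exists, Finset.mem_range,
        not_le] at hcon
      intro j hj
      have h1 : j ≤ N (τ M) ω := by
        have := hcon.2
        rw [hτM] at this
        omega
      obtain ⟨i, hi, hij⟩ := exists_eq_of_le_add_one (a := fun i => N (τ i) ω)
        (by simp only [hτ0, hN.zero]) (fun i hi => by have := hcon.1 i hi; omega) h1
      exact ⟨τ i, hτlt i hi, hij⟩
    calc P.real bad ≤ P.real ((⋃ i ∈ Finset.range M, {ω | 2 ≤ N (τ (i + 1)) ω - N (τ i) ω}) ∪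
        {ω | 1 ≤ N (τ (M + 1)) ω - N (τ M) ω}) := measureReal_mono hsub
      _ ≤ (∑ i ∈ Finset.range M, P.real {ω | 2 ≤ N (τ (i + 1)) ω - N (τ i) ω}) +
          P.real {ω | 1 ≤ N (τ (M + 1)) ω - N (τ M) ω} :=
        (measureReal_union_le _ _).trans
          (add_le_add_left (measureReal_biUnion_finset_le _ _) _)
      _ ≤ (∑ i ∈ Finset.range M, δ * (cumRate lam (τ (i + 1)) - cumRate lam (τ i))) + δ := by
        refine add_le_add (Finset.sum_le_sum fun i hi => ?_) ?_
        · refine (hN.measureReal_two_le_sub hLam h0 (hτm i)).trans ?_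
          rw [sq]
          exact mul_le_mul_of_nonneg_right (hinc i (Finset.mem_range.1 hi).le) (hinc0 i)
        · exact (hN.measureReal_one_le_sub hLam h0 (hτm M)).trans (hinc M le_rfl)
      _ ≤ δ * (cumRate lam t + 1) := by
        rw [← Finset.mul_sum, Finset.sum_range_sub (fun i => cumRate lam (τ i)), hτ0]
        simp only [NNReal.coe_zero, cumRate_zero, sub_zero, mul_add, mul_one]
        gcongr
        exact cumRate_mono hLam h0 (τ M).2 (by exact_mod_cast hle M (by omega))
  have hz : P.real bad ≤ 0 := by
    have ht0 : Tendsto (fun δ : ℝ => δ * (cumRate lam t + 1)) (𝓝[>] 0) (𝓝 0) := by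
      have : Tendsto (fun δ : ℝ => δ * (cumRate lam t + 1)) (𝓝 0) (𝓝 (0 * (cumRate lam t + 1))) :=
        tendsto_id.mul_const _
      rw [zero_mul] at this
      exact this.mono_left nhdsWithin_le_nhds
    exact ge_of_tendsto ht0 (eventually_nhdsWithin_of_forall key)
  exact (measureReal_eq_zero_iff).1 (le_antisymm hz measureReal_nonneg)

theorem cos_add_sin_quarter (k : ZMod 4) :
    Real.cos (k.val * (Real.pi / 2)) + Real.sin (k.val * (Real.pi / 2)) =
      if k = 0 ∨ k = 1 then 1 else -1 := by
  have h3 : (3 : ℝ) * (Real.pi / 2) = Real.pi / 2 + Real.pi := by ring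
  have h2 : (2 : ℝ) * (Real.pi / 2) = Real.pi := by ring
  have hk : k = 0 ∨ k = 1 ∨ k = 2 ∨ k = 3 := by revert k; decide
  rcases hk with rfl | rfl | rfl | rfl
  · simp
  · simp [show (1 : ZMod 4).val = 1 from rfl]
  · simp [show (2 : ZMod 4).val = 2 from rfl, h2, show (2 : ZMod 4) ≠ 0 by decide,
      show (2 : ZMod 4) ≠ 1 by decide]
  · simp [show (3 : ZMod 4).val = 3 from rfl, h3, Real.sin_add, Real.cos_add,
      show (3 : ZMod 4) ≠ 0 by decide, show (3 : ZMod 4) ≠ 1 by decide]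

theorem cos_sub_sin_quarter (k : ZMod 4) :
    Real.cos (k.val * (Real.pi / 2)) - Real.sin (k.val * (Real.pi / 2)) =
      if k = 0 ∨ k = 3 then 1 else -1 := by
  have h3 : (3 : ℝ) * (Real.pi / 2) = Real.pi / 2 + Real.pi := by ring
  have h2 : (2 : ℝ) * (Real.pi / 2) = Real.pi := by ring
  have hk : k = 0 ∨ k = 1 ∨ k = 2 ∨ k = 3 := by revert k; decide
  rcases hk with rfl | rfl | rfl | rfl
  · simp
  · simp [show (1 : ZMod 4).val = 1 from rfl, show (1 : ZMod 4) ≠ 3 by decide,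
      show (1 : ZMod 4) ≠ 0 by decide]
  · simp [show (2 : ZMod 4).val = 2 from rfl, h2, show (2 : ZMod 4) ≠ 0 by decide,
      show (2 : ZMod 4) ≠ 3 by decide]
  · simp [show (3 : ZMod 4).val = 3 from rfl, h3, Real.sin_add, Real.cos_add]

theorem dir_eq_heading {Ω : Type*} (N : ℝ≥0 → Ω → ℕ) (D₀ : Ω → ZMod 4) (ε : ℕ → Ω → ZMod 4)
    (s : ℝ≥0) (ω : Ω) : dir N D₀ ε s ω = heading D₀ ε (N s ω) ω := rfl

section paths
variable {Ω : Type*} [MeasurableSpace Ω] {N : ℝ≥0 → Ω → ℕ} {D₀ : Ω → ZMod 4}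
  {ε : ℕ → Ω → ZMod 4} {c : ℝ}

theorem intervalIntegrable_dir (hmeas : ∀ s, Measurable (N s))
    (hright : ∀ ω t, ContinuousWithinAt (fun s => N s ω) (Ici t) t) (ω : Ω)
    (F : ZMod 4 → ℝ) (a b : ℝ) :
    IntervalIntegrable (fun s : ℝ => F (dir N D₀ ε s.toNNReal ω)) volume a b := by
  have hm : Measurable (fun s : ℝ => F (dir N D₀ ε s.toNNReal ω)) :=
    (Measurable.of_discrete (f := fun m : ℕ => F (heading D₀ ε m ω))).comp
      (measurable_real_path hmeas hright ω)
  refine (intervalIntegrable_const (c := ∑ k, |F k|)).mono_fun hm.aestronglyMeasurable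
    (Eventually.of_forall fun s => ?_)
  simp only [Real.norm_eq_abs]
  exact (Finset.single_le_sum (f := fun k => |F k|) (fun k _ => abs_nonneg _)
    (Finset.mem_univ _)).trans (le_abs_self _)

theorem posX_add_posY (hmeas : ∀ s, Measurable (N s))
    (hright : ∀ ω t, ContinuousWithinAt (fun s => N s ω) (Ici t) t) (t : ℝ≥0) (ω : Ω) :
    posX c N D₀ ε t ω + posY c N D₀ ε t ω = ∫ s in (0 : ℝ)..t,
      c * if dir N D₀ ε s.toNNReal ω = 0 ∨ dir N D₀ ε s.toNNReal ω = 1 then 1 else -1 := by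
  rw [posX, posY, ← intervalIntegral.integral_add
    (intervalIntegrable_dir hmeas hright ω (fun k => c * Real.cos (k.val * (Real.pi / 2))) _ _)
    (intervalIntegrable_dir hmeas hright ω (fun k => c * Real.sin (k.val * (Real.pi / 2))) _ _)]
  simp only [← mul_add, cos_add_sin_quarter]

theorem posX_sub_posY (hmeas : ∀ s, Measurable (N s))
    (hright : ∀ ω t, ContinuousWithinAt (fun s => N s ω) (Ici t) t) (t : ℝ≥0) (ω : Ω) :
    posX c N D₀ ε t ω - posY c N D₀ ε t ω = ∫ s in (0 : ℝ)..t,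
      c * if dir N D₀ ε s.toNNReal ω = 0 ∨ dir N D₀ ε s.toNNReal ω = 3 then 1 else -1 := by
  rw [posX, posY, ← intervalIntegral.integral_sub
    (intervalIntegrable_dir hmeas hright ω (fun k => c * Real.cos (k.val * (Real.pi / 2))) _ _)
    (intervalIntegrable_dir hmeas hright ω (fun k => c * Real.sin (k.val * (Real.pi / 2))) _ _)]
  simp only [← mul_sub, cos_sub_sin_quarter]

/-- The particle is on the edge if and only if all its directions so far are `0` or `1`. -/
theorem posX_add_posY_eq_iff (hc : 0 < c) (hmeas : ∀ s, Measurable (N s))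
    (hright : ∀ ω t, ContinuousWithinAt (fun s => N s ω) (Ici t) t) (t : ℝ≥0) (ω : Ω) :
    posX c N D₀ ε t ω + posY c N D₀ ε t ω = c * t ↔
      ∀ s < t, dir N D₀ ε s ω = 0 ∨ dir N D₀ ε s ω = 1 := by
  have hint : ∀ a b : ℝ, IntervalIntegrable (fun s : ℝ => c * if dir N D₀ ε s.toNNReal ω = 0 ∨
      dir N D₀ ε s.toNNReal ω = 1 then (1 : ℝ) else -1) volume a b := fun a b =>
    intervalIntegrable_dir hmeas hright ω (fun k => c * if k = 0 ∨ k = 1 then (1 : ℝ) else -1) a b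
  rw [posX_add_posY hmeas hright]
  constructor
  · intro h s hst
    by_contra hs
    have hle : ∀ a b : ℝ, a ≤ b → (∫ s in a..b, c * if dir N D₀ ε s.toNNReal ω = 0 ∨
      dir N D₀ ε s.toNNReal ω = 1 then (1 : ℝ) else -1) ≤ c * (b - a) := by
      intro a b hab
      have := intervalIntegral.integral_mono_on hab (hint a b)
        (intervalIntegrable_const (c := c)) (fun x _ => by split_ifs <;> linarith)
      rw [intervalIntegral.integral_const, smul_eq_mul] at this
      linarith
    -- By right continuity a wrong direction persists on some `[s, b)`. There the integrand is `-c`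
    -- instead of `c`, a loss that cannot be made up elsewhere.
    have hev : ∀ᶠ r in 𝓝[≥] s, N r ω = N s ω :=
      (hright ω s).eventually (IsOpen.mem_nhds (isOpen_discrete {N s ω}) rfl)
    obtain ⟨u, hu, hu2⟩ := (mem_nhdsGE_iff_exists_Ico_subset' hst).1 hev
    set b := min u t with hb
    have hsb : s < b := lt_min hu hst
    have hbt : b ≤ t := min_le_right _ _
    have hsb' : (s : ℝ) < b := by exact_mod_cast hsb
    have hbt' : (b : ℝ) ≤ t := by exact_mod_cast hbt
    have h2 : (∫ s in (s : ℝ)..b, c * if dir N D₀ ε s.toNNReal ω = 0 ∨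
      dir N D₀ ε s.toNNReal ω = 1 then (1 : ℝ) else -1) = (b - s) * (-c) := by
      rw [← smul_eq_mul, ← intervalIntegral.integral_const,
        intervalIntegral.integral_of_le hsb'.le, intervalIntegral.integral_of_le hsb'.le,
        integral_Ioc_eq_integral_Ioo, integral_Ioc_eq_integral_Ioo]
      refine setIntegral_congr_fun measurableSet_Ioo fun x hx => ?_
      have hx1 : N x.toNNReal ω = N s ω := hu2
        ⟨NNReal.le_toNNReal_of_coe_le hx.1.le, lt_of_lt_of_le
          ((Real.toNNReal_lt_iff_lt_coe (s.2.trans hx.1.le)).2 hx.2) (min_le_left _ _)⟩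
      simp only [dir_eq_heading, hx1]
      rw [dir_eq_heading] at hs
      rw [if_neg hs]
      ring
    have h3 := hle 0 s s.2
    have h4 := hle b t hbt'
    rw [← intervalIntegral.integral_add_adjacent_intervals (hint 0 s) (hint s t),
      ← intervalIntegral.integral_add_adjacent_intervals (hint s b) (hint b t), h2] at h
    nlinarith
  · intro h
    rw [intervalIntegral.integral_of_le t.coe_nonneg, integral_Ioc_eq_integral_Ioo]
    rw [setIntegral_congr_fun (g := fun _ => c) measurableSet_Ioo fun x hx => ?_]
    · simp [mul_comm]
    · have := h x.toNNReal ((Real.toNNReal_lt_iff_lt_coe hx.1.le).2 hx.2)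
      simp only
      rw [if_pos this, mul_one]

end paths

/-! ### Alternating directions -/

/-- The directions `0` and `1`, alternating with the parity of the index. -/
def altHeading (m : ℕ) : ZMod 4 := if Even m then 0 else 1

/-- The velocity of `X - Y`, divided by the speed, in the direction `altHeading m`. -/
def altSign (m : ℕ) : ℝ := if Even m then 1 else -1

/-- The event that the first `n` turns, starting from the direction `altHeading d`, alternate
between the directions `0` and `1`. -/
def altEvent {Ω : Type*} (D₀ : Ω → ZMod 4) (ε : ℕ → Ω → ZMod 4) (d n : ℕ) : Set Ω :=
  {ω | D₀ ω = altHeading d ∧ ∀ i < n, ε i ω = altHeading (d + i + 1) - altHeading (d + i)}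

theorem altHeading_mem (m : ℕ) : altHeading m = 0 ∨ altHeading m = 1 := by
  unfold altHeading
  split_ifs <;> simp

theorem altHeading_sub_mem (m : ℕ) :
    altHeading (m + 1) - altHeading m = 1 ∨ altHeading (m + 1) - altHeading m = -1 := by
  simp only [altHeading, Nat.even_add_one]
  by_cases h : Even m <;> simp [h]

theorem altSign_eq_mul (m n : ℕ) :
    altSign m = altSign n * (1 - 2 * if Even (m + n) then (0 : ℝ) else 1) := by
  simp only [altSign, Nat.even_add]
  by_cases h : Even m <;> by_cases h' : Even n <;> simp [h, h'] <;> norm_num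

theorem ite_altHeading (m : ℕ) :
    (if altHeading m = 0 ∨ altHeading m = 3 then (1 : ℝ) else -1) = altSign m := by
  unfold altHeading altSign
  by_cases h : Even m
  · simp [h]
  · simp [h, show (1 : ZMod 4) ≠ 0 by decide, show (1 : ZMod 4) ≠ 3 by decide]

theorem add_eq_altHeading {m : ℕ} {e : ZMod 4} (he : e = 1 ∨ e = -1)
    (h : altHeading m + e = 0 ∨ altHeading m + e = 1) :
    altHeading m + e = altHeading (m + 1) := by
  simp only [altHeading, Nat.even_add_one] at *
  by_cases hm : Even m
  · simp only [hm, if_true, not_true_eq_false, if_false] at *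
    revert e; decide
  · simp only [hm, if_true, not_false_eq_true, if_false] at *
    revert e; decide

section paths
variable {Ω : Type*} {D₀ : Ω → ZMod 4} {ε : ℕ → Ω → ZMod 4}

theorem heading_eq_of_mem_altEvent {d n : ℕ} {ω : Ω} (h : ω ∈ altEvent D₀ ε d n) {j : ℕ}
    (hj : j ≤ n) : heading D₀ ε j ω = altHeading (d + j) := by
  induction j with
  | zero => simpa [heading] using h.1
  | succ j ih =>
    have h1 : heading D₀ ε (j + 1) ω = heading D₀ ε j ω + ε j ω := by
      simp [heading, Finset.sum_range_succ, add_assoc]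
    rw [h1, ih (by omega), h.2 j (by omega), ← add_assoc]
    ring

theorem exists_mem_altEvent {n : ℕ} {ω : Ω} (hε : ∀ i, ε i ω = 1 ∨ ε i ω = -1)
    (h : ∀ j ≤ n, heading D₀ ε j ω = 0 ∨ heading D₀ ε j ω = 1) :
    ∃ d : Fin 2, ω ∈ altEvent D₀ ε d n := by
  have h1 : ∀ j, heading D₀ ε (j + 1) ω = heading D₀ ε j ω + ε j ω := fun j => by
    simp [heading, Finset.sum_range_succ, add_assoc]
  obtain ⟨d, hd⟩ : ∃ d : Fin 2, heading D₀ ε 0 ω = altHeading d := by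
    rcases h 0 (Nat.zero_le _) with h | h
    · exact ⟨0, by simpa [altHeading] using h⟩
    · exact ⟨1, by simpa [altHeading] using h⟩
  have h2 : ∀ j ≤ n, heading D₀ ε j ω = altHeading (d + j) := by
    intro j
    induction j with
    | zero => intro _; exact hd
    | succ j ih =>
      intro hj
      have h3 := h (j + 1) hj
      rw [h1, ih (by omega)] at h3 ⊢
      exact add_eq_altHeading (hε j) h3
  refine ⟨d, by simpa [heading] using hd, fun i hi => ?_⟩
  rw [← h2 i hi.le, add_assoc, ← h2 (i + 1) hi, h1]
  ring

variable [MeasurableSpace Ω] {N : ℝ≥0 → Ω → ℕ} {c : ℝ}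

/-- The velocity of `X - Y` is the current one whenever `N` has its current parity and the opposite
one during the off time, hence the factor `t - 2 * offTime N t`. -/
theorem posX_sub_posY_of_mem_altEvent (hmeas : ∀ s, Measurable (N s))
    (hright : ∀ ω t, ContinuousWithinAt (fun s => N s ω) (Ici t) t)
    (hmono : ∀ ω, Monotone fun t => N t ω) {t : ℝ≥0} {d : ℕ} {ω : Ω}
    (h : ω ∈ altEvent D₀ ε d (N t ω)) :
    posX c N D₀ ε t ω - posY c N D₀ ε t ω
      = altSign (d + N t ω) * (c * (t - 2 * offTime N t ω)) := by
  rw [posX_sub_posY hmeas hright, offTime]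
  have h1 : ∀ x ∈ uIcc (0 : ℝ) t,
      (c * if dir N D₀ ε x.toNNReal ω = 0 ∨ dir N D₀ ε x.toNNReal ω = 3 then (1 : ℝ) else -1)
      = altSign (d + N t ω) * (c *
        (1 - 2 * if Even (N x.toNNReal ω + N t ω) then (0 : ℝ) else 1)) := by
    intro x hx
    rw [uIcc_of_le t.coe_nonneg] at hx
    have hle : N x.toNNReal ω ≤ N t ω := hmono ω (Real.toNNReal_le_iff_le_coe.2 hx.2)
    rw [dir_eq_heading, heading_eq_of_mem_altEvent h hle, ite_altHeading,
      altSign_eq_mul _ (d + N t ω)]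
    have : Even (d + N x.toNNReal ω + (d + N t ω)) ↔ Even (N x.toNNReal ω + N t ω) := by
      rw [show d + N x.toNNReal ω + (d + N t ω) = (d + d) + (N x.toNNReal ω + N t ω) by ring,
        Nat.even_add]
      simp [Even.add_self]
    simp only [this]
    ring
  rw [intervalIntegral.integral_congr h1, intervalIntegral.integral_const_mul,
    intervalIntegral.integral_const_mul, intervalIntegral.integral_sub (by simp)
      ((intervalIntegrable_of_measurable_of_mem_Icc
        (measurable_parity_path hmeas hright ω (N t ω)) (fun s => (ite_mem_Icc _).1)
        (fun s => (ite_mem_Icc _).2) 0 t).const_mul 2), intervalIntegral.integral_const_mul]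
  simp

/-- The particle is on the edge if and only if its directions alternate between `0` and `1`. -/
theorem posX_add_posY_eq_iff_exists (hc : 0 < c) (hmeas : ∀ s, Measurable (N s))
    (hright : ∀ ω t, ContinuousWithinAt (fun s => N s ω) (Ici t) t)
    (hmono : ∀ ω, Monotone fun t => N t ω) {t : ℝ≥0} {ω : Ω}
    (hε : ∀ i, ε i ω = 1 ∨ ε i ω = -1) (hvisit : ∀ j ≤ N t ω, ∃ s < t, N s ω = j) :
    posX c N D₀ ε t ω + posY c N D₀ ε t ω = c * t ↔
      ∃ d : Fin 2, ω ∈ altEvent D₀ ε d (N t ω) := by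
  rw [posX_add_posY_eq_iff hc hmeas hright]
  constructor
  · intro h
    refine exists_mem_altEvent hε fun j hj => ?_
    -- A heading that is held for no time before `t` would leave no trace in the position; here each
    -- one is the direction at some `s < t`.
    obtain ⟨s, hst, rfl⟩ := hvisit j hj
    exact h s hst
  · rintro ⟨d, hd⟩ s hst
    rw [dir_eq_heading, heading_eq_of_mem_altEvent hd (hmono ω hst.le)]
    exact altHeading_mem _

end paths

/-! ### The law of `X - Y` on the edge -/

section law
variable {Ω : Type*} [MeasurableSpace Ω] {P : Measure Ω} {lam : ℝ → ℝ}
  {N : ℝ≥0 → Ω → ℕ} {D₀ : Ω → ZMod 4} {ε : ℕ → Ω → ZMod 4} {c : ℝ}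

theorem IsStandardMotion.measure_altEvent (hM : IsStandardMotion P lam N D₀ ε) (d n : ℕ) :
    P (altEvent D₀ ε d n) = 1 / 4 * 2⁻¹ ^ n := by
  have hS : MeasurableSet {e : ℕ → ZMod 4 |
      ∀ i ∈ Finset.range n, e i = altHeading (d + i + 1) - altHeading (d + i)} := by
    simp only [ofPred_forall]
    exact MeasurableSet.biInter (Finset.range n).countable_toSet fun i _ =>
      measurable_pi_apply i (MeasurableSet.of_discrete (s := {_}))
  have h1 := hM.indep_init.measure_inter_preimage_eq_mul _ _
    (MeasurableSet.of_discrete (s := {altHeading d})) hS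
  have h2 := hM.indep_turn.measure_inter_preimage_eq_mul (Finset.range n)
    (sets := fun i => {altHeading (d + i + 1) - altHeading (d + i)})
    (fun i _ => MeasurableSet.of_discrete)
  have h3 : (fun ω i => ε i ω) ⁻¹' {e : ℕ → ZMod 4 |
      ∀ i ∈ Finset.range n, e i = altHeading (d + i + 1) - altHeading (d + i)} =
      ⋂ i ∈ Finset.range n, ε i ⁻¹' {altHeading (d + i + 1) - altHeading (d + i)} := by
    ext ω; simp
  have h4 : altEvent D₀ ε d n = D₀ ⁻¹' {altHeading d} ∩ (fun ω i => ε i ω) ⁻¹'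
      {e : ℕ → ZMod 4 |
        ∀ i ∈ Finset.range n, e i = altHeading (d + i + 1) - altHeading (d + i)} := by
    ext ω; simp [altEvent]
  rw [h4, h1, h3, h2, show P (D₀ ⁻¹' {altHeading d}) = 1 / 4 from hM.init _]
  congr 1
  rw [Finset.prod_congr rfl (g := fun _ => (2⁻¹ : ℝ≥0∞)), Finset.prod_const, Finset.card_range]
  intro i _
  rcases altHeading_sub_mem (d + i) with h | h
  · rw [h, ← one_div]; exact hM.turn_left i
  · rw [h, ← one_div]; exact hM.turn_right i

theorem IsStandardMotion.measurableSet_altEvent (hM : IsStandardMotion P lam N D₀ ε) (d n : ℕ) :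
    MeasurableSet (altEvent D₀ ε d n) := by
  have : altEvent D₀ ε d n = D₀ ⁻¹' {altHeading d} ∩
      ⋂ i ∈ Finset.range n, ε i ⁻¹' {altHeading (d + i + 1) - altHeading (d + i)} := by
    ext ω; simp [altEvent]
  rw [this]
  exact (hM.measurable_init MeasurableSet.of_discrete).inter
    (MeasurableSet.biInter (Finset.range n).countable_toSet fun i _ =>
      hM.measurable_turn i MeasurableSet.of_discrete)

theorem IsStandardMotion.measure_inter_altEvent (hM : IsStandardMotion P lam N D₀ ε) (t : ℝ≥0)
    (d n : ℕ) {S : Set (ℕ × ℝ)} (hS : MeasurableSet S) :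
    P ({ω | (N t ω, offTime N t ω) ∈ S} ∩ altEvent D₀ ε d n)
      = P {ω | (N t ω, offTime N t ω) ∈ S} * (1 / 4 * 2⁻¹ ^ n) := by
  rw [← hM.measure_altEvent d n]
  have hpair := @measurable_pair_offTime Ω N
    (MeasurableSpace.comap (fun ω s => N s ω) inferInstance) t
    (fun s' _ => (measurable_pi_apply (X := fun _ => ℕ) s').comp
      (comap_measurable (fun ω s => N s ω))) hM.poisson.rightCts
  refine (Indep_iff _ _ _).1 hM.indep_poisson _ _ (hpair hS) ?_
  refine ⟨{q | q.1 = altHeading d ∧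
    ∀ i < n, q.2 i = altHeading (d + i + 1) - altHeading (d + i)}, ?_, rfl⟩
  have h1 : MeasurableSet {q : ZMod 4 × (ℕ → ZMod 4) |
      ∀ i < n, q.2 i = altHeading (d + i + 1) - altHeading (d + i)} := by
    simp only [ofPred_forall]
    exact MeasurableSet.iInter fun i => MeasurableSet.iInter fun _ =>
      (measurable_pi_apply i).comp measurable_snd (MeasurableSet.of_discrete (s := {_}))
  exact (measurable_fst (MeasurableSet.of_discrete (s := {altHeading d}))).inter h1

theorem IsStandardMotion.ae_turn (hM : IsStandardMotion P lam N D₀ ε) [IsProbabilityMeasure P] :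
    ∀ᵐ ω ∂P, ∀ i, ε i ω = 1 ∨ ε i ω = -1 := by
  rw [ae_all_iff]
  intro i
  have h1 : MeasurableSet {ω | ε i ω = 1} :=
    hM.measurable_turn i (MeasurableSet.of_discrete (s := {1}))
  have h2 : MeasurableSet {ω | ε i ω = -1} :=
    hM.measurable_turn i (MeasurableSet.of_discrete (s := {-1}))
  have hd : Disjoint {ω | ε i ω = 1} {ω | ε i ω = -1} := by
    rw [Set.disjoint_left]
    intro ω h h'
    simp only [mem_ofPred_eq] at h h'
    rw [h] at h'
    exact absurd h' (by decide)
  have := measure_union hd h2 (μ := P)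
  rw [hM.turn_left, hM.turn_right, ENNReal.add_halves] at this
  exact (prob_compl_eq_zero_iff (h1.union h2)).2 this

/-- The law of `X - Y` on the edge, as a mixture over the number of turns. -/
theorem IsStandardMotion.measure_edge (hM : IsStandardMotion P lam N D₀ ε)
    [IsProbabilityMeasure P]
    (hLam : ∀ t, 0 < t → IntegrableOn lam (Ioc 0 t)) (h0 : ∀ t, 0 < t → 0 ≤ lam t)
    (hc : 0 < c) {t : ℝ≥0} (ht : 0 < t) {B : Set ℝ} (hB : MeasurableSet B) :
    P {ω | posX c N D₀ ε t ω + posY c N D₀ ε t ω = c * t ∧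
        posX c N D₀ ε t ω - posY c N D₀ ε t ω ∈ B} =
      ∑' n, ∑ d : Fin 2, P {ω | N t ω = n ∧
        altSign (d + n) * (c * (t - 2 * offTime N t ω)) ∈ B} * (1 / 4 * 2⁻¹ ^ n) := by
  have hN := hM.poisson
  let S : ℕ × Fin 2 → Set (ℕ × ℝ) := fun p =>
    {q | q.1 = p.1 ∧ altSign (p.2 + p.1) * (c * (t - 2 * q.2)) ∈ B}
  have hS : ∀ p, MeasurableSet (S p) := fun p =>
    (measurable_fst (MeasurableSet.of_discrete (s := {p.1}))).inter
      ((by fun_prop : Measurable fun q : ℕ × ℝ => altSign (p.2 + p.1) * (c * (t - 2 * q.2))) hB)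
  have hpair := measurable_pair_offTime (t := t) (fun s _ => hN.measurable s) hN.rightCts
  -- Up to a null set, the edge event decomposes according to the number of turns `p.1` and the
  -- initial direction `p.2`, each piece being an event of the Poisson process intersected with an
  -- event of the turns.
  have hae : {ω | posX c N D₀ ε t ω + posY c N D₀ ε t ω = c * t ∧
        posX c N D₀ ε t ω - posY c N D₀ ε t ω ∈ B} =ᵐ[P]
      ⋃ p, {ω | (N t ω, offTime N t ω) ∈ S p} ∩ altEvent D₀ ε p.2 p.1 := by
    filter_upwards [hM.ae_turn, hN.ae_exists_lt_eq hLam h0 ht] with ω hε hvisit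
    refine propext (Iff.trans (b := _ ∧ _) Iff.rfl ?_)
    rw [posX_add_posY_eq_iff_exists hc hN.measurable hN.rightCts hN.mono hε hvisit]
    refine Iff.trans ?_ mem_iUnion.symm
    constructor
    · rintro ⟨⟨d, hd⟩, h⟩
      rw [posX_sub_posY_of_mem_altEvent hN.measurable hN.rightCts hN.mono hd] at h
      exact ⟨(N t ω, d), ⟨rfl, h⟩, hd⟩
    · rintro ⟨⟨n, d⟩, ⟨hn, h⟩, hd⟩
      obtain rfl : N t ω = n := hn
      refine ⟨⟨d, hd⟩, ?_⟩
      rw [posX_sub_posY_of_mem_altEvent hN.measurable hN.rightCts hN.mono hd]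
      exact h
  rw [measure_congr hae, measure_iUnion, ENNReal.tsum_prod (f := fun n (d : Fin 2) =>
    P ({ω | (N t ω, offTime N t ω) ∈ S (n, d)} ∩ altEvent D₀ ε d n))]
  · refine tsum_congr fun n => ?_
    rw [tsum_fintype]
    refine Finset.sum_congr rfl fun d _ => ?_
    exact hM.measure_inter_altEvent t d n (hS (n, d))
  -- The pieces are disjoint because `N t` determines `n` and `D₀` determines `d`.
  · rintro ⟨n, d⟩ ⟨n', d'⟩ hne
    refine Set.disjoint_left.2 ?_
    rintro ω ⟨⟨h1, -⟩, h2⟩ ⟨⟨h3, -⟩, h4⟩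
    apply hne
    have hd : altHeading d = altHeading d' := h2.1.symm.trans h4.1
    have hdd : d = d' := by
      revert hd; revert d d'
      simp [Fin.forall_fin_two, altHeading, show (1 : ZMod 4) ≠ 0 by decide,
        show (0 : ZMod 4) ≠ 1 by decide]
    rw [hdd, show n = n' from h1.symm.trans h3]
  · exact fun p => (hpair (hS p)).inter (hM.measurableSet_altEvent _ _)

end law

section law
variable {Ω : Type*} [MeasurableSpace Ω] {P : Measure Ω} {lam : ℝ → ℝ}
  {N : ℝ≥0 → Ω → ℕ} {D₀ : Ω → ZMod 4} {ε : ℕ → Ω → ZMod 4} {c : ℝ}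

theorem IsPoissonProcess.measure_level_inter [IsProbabilityMeasure P]
    (hN : IsPoissonProcess P lam N)
    (hLam : ∀ t, 0 < t → IntegrableOn lam (Ioc 0 t)) (h0 : ∀ t, 0 < t → 0 ≤ lam t)
    (hcont : ContinuousOn lam (Ioi 0)) (n : ℕ) {t : ℝ≥0} (ht : 0 < t) {S : Set ℝ}
    (hS : MeasurableSet S) :
    P {ω | N t ω = n + 1 ∧ offTime N t ω ∈ S} = ENNReal.ofReal (Real.exp (-cumRate lam t)) *
      ∫⁻ w in Ioo 0 (t : ℝ) ∩ S, levelKernel lam n w (t - w) := by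
  have hm := hN.map_offTime hLam h0 hcont n (NNReal.coe_pos.2 ht)
  have hoff := measurable_offTime (t := t) (fun s _ => hN.measurable s) hN.rightCts
  have hk : Measurable fun w : ℝ => levelKernel lam n w (t - w) :=
    (measurable_levelKernel hcont n).comp (by fun_prop : Measurable fun w : ℝ => (w, t - w))
  have := congrArg (fun μ => μ S) hm
  simp only [Real.toNNReal_coe] at this
  rw [Measure.map_apply hoff hS, Measure.restrict_apply (hoff hS), withDensity_apply _ hS,
    Measure.restrict_restrict hS, lintegral_const_mul _ hk, inter_comm S] at this
  rw [← this]
  congr 1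
  ext ω
  exact and_comm

theorem IsStandardMotion.measure_edge_eq_lintegral (hM : IsStandardMotion P lam N D₀ ε)
    [IsProbabilityMeasure P]
    (hLam : ∀ t, 0 < t → IntegrableOn lam (Ioc 0 t)) (h0 : ∀ t, 0 < t → 0 ≤ lam t)
    (hcont : ContinuousOn lam (Ioi 0))
    (hc : 0 < c) {t : ℝ≥0} (ht : 0 < t) {B : Set ℝ} (hB : MeasurableSet B)
    (hBt : B ⊆ Ioo (-(c * t)) (c * t)) :
    P {ω | posX c N D₀ ε t ω + posY c N D₀ ε t ω = c * t ∧
        posX c N D₀ ε t ω - posY c N D₀ ε t ω ∈ B} =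
      ENNReal.ofReal (Real.exp (-cumRate lam t) / 4) *
        ((∫⁻ w in Ioo 0 (t : ℝ) ∩ {w | c * (t - 2 * w) ∈ B}, edgeKernelE lam w (t - w)) +
          ∫⁻ w in Ioo 0 (t : ℝ) ∩ {w | -(c * (t - 2 * w)) ∈ B}, edgeKernelE lam w (t - w)) := by
  have hN := hM.poisson
  have hk : ∀ n, Measurable fun w : ℝ => levelKernel lam n w (t - w) := fun n =>
    (measurable_levelKernel hcont n).comp (by fun_prop : Measurable fun w : ℝ => (w, t - w))
  have hS1 : MeasurableSet {w : ℝ | c * (t - 2 * w) ∈ B} :=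
    (by fun_prop : Measurable fun w : ℝ => c * (t - 2 * w)) hB
  have hS2 : MeasurableSet {w : ℝ | -(c * (t - 2 * w)) ∈ B} :=
    (by fun_prop : Measurable fun w : ℝ => -(c * (t - 2 * w))) hB
  have hsum : ∀ S : Set ℝ, ∫⁻ w in S, edgeKernelE lam w (t - w) =
      ∑' n, 2⁻¹ ^ (n + 1) * ∫⁻ w in S, levelKernel lam n w (t - w) := by
    intro S
    simp only [edgeKernelE]
    rw [lintegral_tsum fun n => ((hk n).const_mul _).aemeasurable]
    exact tsum_congr fun n => lintegral_const_mul _ (hk n)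
  rw [hM.measure_edge hLam h0 hc ht hB, tsum_eq_zero_add' ENNReal.summable, hsum, hsum,
    ← ENNReal.tsum_add, ← ENNReal.tsum_mul_left]
  -- Without a turn, `X - Y` is an endpoint `± c t`, which the open interval excludes; the law has
  -- atoms there that are not part of the density.
  have hzero : ∀ d : Fin 2, P {ω | N t ω = 0 ∧
      altSign (d + 0) * (c * (t - 2 * offTime N t ω)) ∈ B} = 0 := by
    intro d
    rw [show {ω | N t ω = 0 ∧ altSign (d + 0) * (c * (t - 2 * offTime N t ω)) ∈ B} = ∅ from ?_,
      measure_empty]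
    refine eq_empty_of_forall_notMem fun ω hω => ?_
    obtain ⟨h1, h2⟩ := hω
    rw [offTime_of_eq_zero hN.mono h1] at h2
    have h3 := hBt h2
    unfold altSign at h3
    split_ifs at h3
    · have := h3.2; linarith
    · have := h3.1; linarith
  simp only [hzero, zero_mul, Finset.sum_const_zero, zero_add]
  refine tsum_congr fun n => ?_
  have hpos := hN.measure_level_inter hLam h0 hcont n ht hS1
  have hneg := hN.measure_level_inter hLam h0 hcont n ht hS2
  have hE : ENNReal.ofReal (Real.exp (-cumRate lam t) / 4)
      = ENNReal.ofReal (Real.exp (-cumRate lam t)) * (1 / 4) := by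
    rw [div_eq_mul_one_div, ENNReal.ofReal_mul (Real.exp_pos _).le,
      ENNReal.ofReal_div_of_pos (by norm_num)]
    simp
  -- For each number of turns the two initial directions end with opposite signs; the parity of `n`
  -- only decides which one gets which.
  have hsplit : ∑ d : Fin 2, P {ω | N t ω = n + 1 ∧
      altSign (d + (n + 1)) * (c * (t - 2 * offTime N t ω)) ∈ B} * (1 / 4 * 2⁻¹ ^ (n + 1)) =
      (P {ω | N t ω = n + 1 ∧ offTime N t ω ∈ {w : ℝ | c * (t - 2 * w) ∈ B}} +
        P {ω | N t ω = n + 1 ∧ offTime N t ω ∈ {w : ℝ | -(c * (t - 2 * w)) ∈ B}}) *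
          (1 / 4 * 2⁻¹ ^ (n + 1)) := by
    rw [Fin.sum_univ_two, add_mul]
    by_cases hn : Even n
    · simp [altSign, Nat.even_add_one, hn, parity_simps]
      rw [add_comm]
    · simp [altSign, Nat.even_add_one, hn, parity_simps]
  rw [hsplit, hpos, hneg, hE]
  ring

end law

/-- Change of variables `w = (t - σ η / c) / 2`, with Jacobian `1 / (2 * c)`. As `B` lies in the
open interval, its image lies in `(0, t)`. -/
theorem lintegral_affine_preimage {c t : ℝ} (hc : 0 < c) {B : Set ℝ} (hB : MeasurableSet B)
    (hBt : B ⊆ Ioo (-(c * t)) (c * t)) {σ : ℝ} (hσ : σ = 1 ∨ σ = -1) (g : ℝ → ℝ≥0∞) :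
    ∫⁻ w in Ioo 0 t ∩ {w | σ * (c * (t - 2 * w)) ∈ B}, g w =
      ∫⁻ η in B, ENNReal.ofReal (1 / (2 * c)) * g ((t - σ * (η / c)) / 2) := by
  have hσ2 : σ * σ = 1 := by rcases hσ with rfl | rfl <;> norm_num
  have himg : (fun η => (t - σ * (η / c)) / 2) '' B =
      Ioo 0 t ∩ {w | σ * (c * (t - 2 * w)) ∈ B} := by
    have e : ∀ η, σ * (c * (t - 2 * ((t - σ * (η / c)) / 2))) = η := fun η => by
      have : c * (η / c) = η := mul_div_cancel₀ _ hc.ne'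
      linear_combination σ * σ * this + η * hσ2
    ext w
    constructor
    · rintro ⟨η, hη, rfl⟩
      have h := hBt hη
      refine ⟨?_, ?_⟩
      · have h1 : η / c < t := by rw [div_lt_iff₀ hc]; linarith [h.2]
        have h2 : -t < η / c := by rw [lt_div_iff₀ hc]; linarith [h.1]
        rcases hσ with rfl | rfl
        · constructor <;> linarith
        · constructor <;> linarith
      · change σ * (c * (t - 2 * ((t - σ * (η / c)) / 2))) ∈ B
        rwa [e]
    · rintro ⟨-, h⟩
      refine ⟨_, h, ?_⟩
      have : σ * (c * (t - 2 * w)) / c = σ * (t - 2 * w) := by field_simp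
      simp only [this]
      linear_combination (-(t - 2 * w) / 2) * hσ2
  rw [← himg, lintegral_image_eq_lintegral_abs_deriv_mul hB (f' := fun _ => (0 - σ * (1 / c)) / 2)]
  · refine lintegral_congr fun η => ?_
    congr 2
    rw [zero_sub, neg_div, abs_neg, abs_div, abs_mul, show |σ| = 1 by
      rcases hσ with rfl | rfl <;> norm_num, abs_of_pos (by positivity : 0 < 1 / c)]
    norm_num
    ring
  · intro η _
    have h := ((((hasDerivAt_id η).div_const c).const_mul σ).const_sub t).div_const 2
    exact (h.congr_deriv (by ring)).hasDerivWithinAt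
  · intro x _ y _ hxy
    have h1 : σ * (x / c) = σ * (y / c) := by
      simp only at hxy
      linarith
    have h2 : x / c = y / c := by
      linear_combination σ * h1 - (x / c - y / c) * hσ2
    exact (div_left_inj' hc.ne').1 h2

/-! ### The edge density: existence, uniqueness, regularity and mass -/

section density
variable {Ω : Type*} [MeasurableSpace Ω] {P : Measure Ω} {lam : ℝ → ℝ}
  {N : ℝ≥0 → Ω → ℕ} {D₀ : Ω → ZMod 4} {ε : ℕ → Ω → ZMod 4} {c : ℝ}

/-- The density of `X - Y` on the edge. -/
def edgeDensity (c : ℝ) (lam : ℝ → ℝ) (p : ℝ × ℝ) : ℝ :=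
  rightPart c lam (edgeKernel lam) p + leftPart c lam (edgeKernel lam) p

theorem edgeDensity_nonneg (hc : 0 < c) (p : ℝ × ℝ) : 0 ≤ edgeDensity c lam p := by
  have h : ∀ u v, 0 ≤ edgeKernel lam u v := fun u v => ENNReal.toReal_nonneg
  have h1 := h (charCoord c p).1 (charCoord c p).2
  have h2 := h (charCoord c p).2 (charCoord c p).1
  unfold edgeDensity rightPart leftPart
  positivity

theorem IsStandardMotion.measure_edge_eq_lintegral_edgeDensity
    (hM : IsStandardMotion P lam N D₀ ε) [IsProbabilityMeasure P]
    (hLam : ∀ t, 0 < t → IntegrableOn lam (Ioc 0 t)) (h0 : ∀ t, 0 < t → 0 ≤ lam t)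
    (hcont : ContinuousOn lam (Ioi 0))
    (hc : 0 < c) {t : ℝ≥0} (ht : 0 < t) {B : Set ℝ} (hB : MeasurableSet B)
    (hBt : B ⊆ Ioo (-(c * t)) (c * t)) :
    P {ω | posX c N D₀ ε t ω + posY c N D₀ ε t ω = c * t ∧
        posX c N D₀ ε t ω - posY c N D₀ ε t ω ∈ B} =
      ∫⁻ η in B, ENNReal.ofReal (edgeDensity c lam (η, t)) := by
  have hk := measurable_edgeKernelE hcont
  have e1 := lintegral_affine_preimage hc hB hBt (Or.inl rfl)
    (fun w => edgeKernelE lam w (t - w))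
  have e2 := lintegral_affine_preimage hc hB hBt (Or.inr rfl)
    (fun w => edgeKernelE lam w (t - w))
  simp only [one_mul, neg_mul] at e1 e2
  rw [hM.measure_edge_eq_lintegral hLam h0 hcont hc ht hB hBt, e1, e2, ← lintegral_add_left,
    ← lintegral_const_mul]
  · refine setLIntegral_congr_fun hB fun η hη => ?_
    have hq := charCoord_mem_quadrant hc (p := (η, (t : ℝ))) (abs_lt.2 (hBt hη))
    have hu : (t : ℝ) - (t - η / c) / 2 = (t + η / c) / 2 := by ring
    have hv : (t : ℝ) - (t + η / c) / 2 = (t - η / c) / 2 := by ring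
    have hv' : ((t : ℝ) - -(η / c)) / 2 = (t + η / c) / 2 := by ring
    have ne1 := edgeKernelE_ne_top hM.poisson hLam h0 hcont hq.1 (le_of_lt hq.2)
    have ne2 := edgeKernelE_ne_top hM.poisson hLam h0 hcont hq.2 (le_of_lt hq.1)
    simp only [edgeDensity, rightPart, leftPart, edgeKernel, hu, hv', hv]
    simp only [charCoord] at ne1 ne2 ⊢
    have he := Real.exp_pos (-cumRate lam t)
    rw [← mul_add (Real.exp _ / (8 * c)), ENNReal.ofReal_mul (by positivity),
      ← ENNReal.toReal_add ne1 ne2, ENNReal.ofReal_toReal (ENNReal.add_ne_top.2 ⟨ne1, ne2⟩),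
      ← mul_add, ← mul_assoc, ← ENNReal.ofReal_mul (by positivity)]
    -- The constant: `1 / 4` for the initial direction times the Jacobian `1 / (2 * c)` is the `1 /
    -- (8 * c)` of the two halves.
    congr 2
    field_simp
    norm_num
  · fun_prop
  · exact (hk.comp (by fun_prop : Measurable fun η : ℝ => ((t - η / c) / 2,
      (t : ℝ) - (t - η / c) / 2))).const_mul _
end density

/-- For each `t` both functions have the same integrals over all Borel subsets, so they agree almost
everywhere on the open interval, and everywhere by continuity. -/
theorem IsEdgeDensity.eqOn {Ω : Type*} [MeasurableSpace Ω] {P : Measure Ω} {c : ℝ} (hc : 0 < c)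
    {X Y : ℝ≥0 → Ω → ℝ} {f g : ℝ → ℝ → ℝ} (hf : IsEdgeDensity P c X Y f)
    (hg : IsEdgeDensity P c X Y g) :
    EqOn (fun p : ℝ × ℝ => f p.1 p.2) (fun p => g p.1 p.2) (frontRegion c) := by
  rintro ⟨η, t⟩ hp
  have ht : 0 < t := pos_of_mem_frontRegion hc hp
  lift t to ℝ≥0 using ht.le
  have ht' : 0 < t := NNReal.coe_pos.1 ht
  have hcont : ∀ {F : ℝ → ℝ → ℝ}, IsEdgeDensity P c X Y F →
      ContinuousOn (fun x => F x t) (Ioo (-(c * t)) (c * t)) := fun {F} hF =>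
    hF.continuousOn.comp (f := fun x : ℝ => (x, (t : ℝ))) (by fun_prop)
      fun x hx => (abs_lt.2 hx : |x| < c * t)
  have hae : (fun x => f x t) =ᵐ[volume.restrict (Ioo (-(c * t)) (c * t))] fun x => g x t := by
    refine Integrable.ae_eq_of_forall_setIntegral_eq _ _ (hf.integrableOn t ht')
      (hg.integrableOn t ht') fun s hs _ => ?_
    rw [Measure.restrict_restrict hs,
      ← hf.prob_eq t ht' _ (hs.inter measurableSet_Ioo) inter_subset_right,
      ← hg.prob_eq t ht' _ (hs.inter measurableSet_Ioo) inter_subset_right]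
  exact Measure.eqOn_open_of_ae_eq hae isOpen_Ioo (hcont hf) (hcont hg) (abs_lt.1 hp)

section density
variable {Ω : Type*} [MeasurableSpace Ω] {P : Measure Ω} [IsProbabilityMeasure P] {lam : ℝ → ℝ}
  {N : ℝ≥0 → Ω → ℕ} {D₀ : Ω → ZMod 4} {ε : ℕ → Ω → ZMod 4} {c : ℝ}

theorem hasDerivAt_deriv_half {g : ℝ → ℝ} (hg : ContDiffOn ℝ 1 g (Ioi 0)) {s : ℝ} (hs : 0 < s) :
    HasDerivAt (fun s => g s / 2) (deriv g s / 2) s :=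
  (((hg.contDiffAt (Ioi_mem_nhds hs)).differentiableAt (by norm_num)).hasDerivAt).div_const 2

theorem continuousOn_deriv_half {g : ℝ → ℝ} (hg : ContDiffOn ℝ 1 g (Ioi 0)) :
    ContinuousOn (fun s => deriv g s / 2) (Ioi 0) :=
  (hg.continuousOn_deriv_of_isOpen isOpen_Ioi le_rfl).div_const 2

theorem IsPoissonProcess.contDiffOn_edgeKernel_one (hN : IsPoissonProcess P lam N)
    (hLam : ∀ t, 0 < t → IntegrableOn lam (Ioc 0 t)) (h0 : ∀ t, 0 < t → 0 ≤ lam t)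
    (hlam : ContDiffOn ℝ 1 lam (Ioi 0)) :
    ContDiffOn ℝ 1 (fun p : ℝ × ℝ => edgeKernel lam p.1 p.2) quadrant :=
  (isCharacteristicSolution_edgeKernel hN hLam h0 hlam.continuousOn).contDiffOn_one
    (fun _ hs => hasDerivAt_deriv_half hlam hs) (continuousOn_deriv_half hlam)

theorem IsPoissonProcess.contDiffOn_edgeKernel_two (hN : IsPoissonProcess P lam N)
    (hLam : ∀ t, 0 < t → IntegrableOn lam (Ioc 0 t)) (h0 : ∀ t, 0 < t → 0 ≤ lam t)
    (hlam : ContDiffOn ℝ 2 lam (Ioi 0)) :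
    ContDiffOn ℝ 2 (fun p : ℝ × ℝ => edgeKernel lam p.1 p.2) quadrant := by
  have hd : ContDiffOn ℝ 1 (deriv lam) (Ioi 0) :=
    hlam.deriv_of_isOpen isOpen_Ioi (by norm_num)
  exact (isCharacteristicSolution_edgeKernel hN hLam h0 hlam.continuousOn).contDiffOn_two
    (fun _ hs => hasDerivAt_deriv_half (hlam.of_le (by norm_num)) hs)
    (fun _ hs => hasDerivAt_deriv_half hd hs) (continuousOn_deriv_half hd)

theorem IsPoissonProcess.isTelegraphPair_edgeDensity (hN : IsPoissonProcess P lam N)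
    (hc : 0 < c) (hLam : ∀ t, 0 < t → IntegrableOn lam (Ioc 0 t)) (h0 : ∀ t, 0 < t → 0 ≤ lam t)
    (hlam : ContDiffOn ℝ 1 lam (Ioi 0)) :
    IsTelegraphPair c lam (edgeDensity c lam)
      (fun p => rightPart c lam (edgeKernel lam) p - leftPart c lam (edgeKernel lam) p) :=
  isTelegraphPair hc hLam hlam
    (isCharacteristicSolution_edgeKernel hN hLam h0 hlam.continuousOn)
    (hN.contDiffOn_edgeKernel_one hLam h0 hlam)

theorem IsStandardMotion.isEdgeDensity (hM : IsStandardMotion P lam N D₀ ε) (hc : 0 < c)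
    (hLam : ∀ t, 0 < t → IntegrableOn lam (Ioc 0 t)) (h0 : ∀ t, 0 < t → 0 ≤ lam t)
    (hlam : ContDiffOn ℝ 1 lam (Ioi 0)) :
    IsEdgeDensity P c (posX c N D₀ ε) (posY c N D₀ ε) (fun η t => edgeDensity c lam (η, t)) := by
  have hcont : ContinuousOn (edgeDensity c lam) (frontRegion c) :=
    (hM.poisson.isTelegraphPair_edgeDensity hc hLam h0 hlam).contDiffOn_left.continuousOn
  have hct : ∀ t : ℝ≥0, ContinuousOn (fun x => edgeDensity c lam (x, t))
      (Ioo (-(c * t)) (c * t)) := fun t =>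
    hcont.comp (f := fun x : ℝ => (x, (t : ℝ))) (by fun_prop)
      fun x hx => (abs_lt.2 hx : |x| < c * t)
  refine ⟨hcont, fun t ht => ?_, fun t ht B hB hBt => ?_⟩
  · refine ⟨(hct t).aestronglyMeasurable measurableSet_Ioo, ?_⟩
    rw [hasFiniteIntegral_iff_ofReal (Eventually.of_forall fun x => edgeDensity_nonneg hc _),
      ← hM.measure_edge_eq_lintegral_edgeDensity hLam h0 hlam.continuousOn hc ht
        measurableSet_Ioo Subset.rfl]
    exact measure_lt_top _ _
  · rw [Measure.real, hM.measure_edge_eq_lintegral_edgeDensity hLam h0 hlam.continuousOn hc ht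
      hB hBt, integral_eq_lintegral_of_nonneg_ae
        (Eventually.of_forall fun x => edgeDensity_nonneg hc _)
        (((hct t).mono hBt).aestronglyMeasurable hB)]

/-- The probability of being in the interior of the edge. -/
theorem IsStandardMotion.measureReal_edge (hM : IsStandardMotion P lam N D₀ ε) (hc : 0 < c)
    (hLam : ∀ t, 0 < t → IntegrableOn lam (Ioc 0 t)) (h0 : ∀ t, 0 < t → 0 ≤ lam t)
    (hcont : ContinuousOn lam (Ioi 0)) {t : ℝ≥0} (ht : 0 < t) :
    P.real {ω | posX c N D₀ ε t ω + posY c N D₀ ε t ω = c * t ∧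
        posX c N D₀ ε t ω - posY c N D₀ ε t ω ∈ Ioo (-(c * t)) (c * t)} =
      1 / 2 * (Real.exp (-cumRate lam t / 2) - Real.exp (-cumRate lam t)) := by
  have hN := hM.poisson
  set A := cumRate lam t with hA
  have hA0 : 0 ≤ A := cumRate_nonneg hLam h0 t.2
  -- The interval is symmetric, so the sign of the last direction does not matter.
  have hmem : ∀ (m : ℕ) (w : ℝ),
      altSign m * (c * (t - 2 * w)) ∈ Ioo (-(c * t)) (c * t) ↔ w ∈ Ioo (0 : ℝ) t := by
    intro m w
    have h1 : 0 < w ↔ 0 < c * w := (mul_pos_iff_of_pos_left hc).symm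
    have h2 : w < t ↔ c * w < c * t := (mul_lt_mul_iff_right₀ hc).symm
    unfold altSign
    simp only [mem_Ioo, h1, h2]
    split_ifs <;> constructor <;> rintro ⟨h3, h4⟩ <;> constructor <;> linarith
  have hterm : ∀ n, ∑ d : Fin 2, P {ω | N t ω = n + 1 ∧ altSign (d + (n + 1)) *
      (c * (t - 2 * offTime N t ω)) ∈ Ioo (-(c * t)) (c * t)} * (1 / 4 * 2⁻¹ ^ (n + 1)) =
      ENNReal.ofReal (1 / 2 * Real.exp (-A) * ((A / 2) ^ (n + 1) / (n + 1).factorial)) := by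
    intro n
    -- On a level with at least one event the law of the off time is carried by `(0, t)`, so the
    -- level contributes its full Poisson probability.
    have h1 : P {ω | N t ω = n + 1 ∧ offTime N t ω ∈ Ioo (0 : ℝ) t} = P {ω | N t ω = n + 1} := by
      have h2 := hN.measure_level_inter hLam h0 hcont n ht (MeasurableSet.univ)
      rw [hN.measure_level_inter hLam h0 hcont n ht measurableSet_Ioo, inter_self]
      simpa using h2.symm
    simp only [hmem, h1]
    rw [Finset.sum_const, Finset.card_univ, Fintype.card_fin, nsmul_eq_mul,
      ← ofReal_measureReal, hN.measureReal_eq hLam h0 t (n + 1)]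
    rw [show ((2 : ℕ) : ℝ≥0∞) = ENNReal.ofReal 2 by simp,
      show (1 / 4 * 2⁻¹ ^ (n + 1) : ℝ≥0∞) = ENNReal.ofReal (1 / 4 * 2⁻¹ ^ (n + 1)) by
        rw [ENNReal.ofReal_mul (by norm_num), ENNReal.ofReal_pow (by norm_num),
          ENNReal.ofReal_div_of_pos (by norm_num), ENNReal.ofReal_inv_of_pos (by norm_num)]
        simp,
      ← ENNReal.ofReal_mul (by positivity), ← ENNReal.ofReal_mul (by norm_num)]
    congr 1
    rw [div_pow, inv_pow]
    ring
  have hzero : ∀ d : Fin 2, P {ω | N t ω = 0 ∧ altSign (d + 0) *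
      (c * (t - 2 * offTime N t ω)) ∈ Ioo (-(c * t)) (c * t)} = 0 := by
    intro d
    simp only [hmem]
    rw [show {ω | N t ω = 0 ∧ offTime N t ω ∈ Ioo (0 : ℝ) t} = ∅ from ?_, measure_empty]
    refine eq_empty_of_forall_notMem fun ω hω => ?_
    have := hω.2.1
    rw [offTime_of_eq_zero hN.mono hω.1] at this
    exact lt_irrefl _ this
  -- The exponential series at `A / 2` without its term of index `0`, which belongs to the endpoints
  -- of the edge.
  have hexp : HasSum (fun n : ℕ => (A / 2) ^ (n + 1) / (n + 1).factorial)
      (Real.exp (A / 2) - 1) := by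
    have := (hasSum_nat_add_iff' 1).2 (NormedSpace.expSeries_div_hasSum_exp (A / 2))
    simpa [Real.exp_eq_exp_ℝ] using this
  rw [Measure.real, hM.measure_edge hLam h0 hc ht measurableSet_Ioo,
    tsum_eq_zero_add' ENNReal.summable]
  simp only [hzero, zero_mul, Finset.sum_const_zero, zero_add, hterm]
  rw [← ENNReal.ofReal_tsum_of_nonneg (fun n => by positivity) (hexp.mul_left _).summable,
    (hexp.mul_left _).tsum_eq, ENNReal.toReal_ofReal, mul_assoc, mul_sub, ← Real.exp_add]
  · congr 3
    · ring
    · ring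
  · have := Real.add_one_le_exp (A / 2)
    have : 0 ≤ Real.exp (A / 2) - 1 := by linarith
    positivity

end density

end

end OrthogonalMotion

theorem mainTheorem3 {Ω : Type*} [MeasurableSpace Ω] (P : Measure Ω) [IsProbabilityMeasure P]
    (c : ℝ) (hc : 0 < c) (lam : ℝ → ℝ)
    (hlam : ContDiffOn ℝ 1 lam (Ioi 0)) (hlam_nonneg : ∀ t, 0 < t → 0 ≤ lam t)
    (hLam : ∀ t, 0 < t → IntegrableOn lam (Ioc 0 t))
    (N : ℝ≥0 → Ω → ℕ) (D₀ : Ω → ZMod 4) (ε : ℕ → Ω → ZMod 4)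
    (hM : IsStandardMotion P lam N D₀ ε) :
    (∃ f, IsEdgeDensity P c (posX c N D₀ ε) (posY c N D₀ ε) f) ∧
    ∀ f, IsEdgeDensity P c (posX c N D₀ ε) (posY c N D₀ ε) f →
      ContDiffOn ℝ 1 (fun p : ℝ × ℝ => f p.1 p.2) (frontRegion c) ∧
      SolvesWeakly c lam f ∧
      (ContDiffOn ℝ 2 lam (Ioi 0) →
        ContDiffOn ℝ 2 (fun p : ℝ × ℝ => f p.1 p.2) (frontRegion c) ∧
        ∀ η t, |η| < c * t → SolvesAt c lam f η t) ∧
      (∀ η t, |η| < c * t → 0 ≤ f η t) ∧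
      (∀ t, 0 < t → ∫ η in (-(c * t))..(c * t), f η t
        = 1 / 2 * (Real.exp (-(∫ s in (0 : ℝ)..t, lam s) / 2)
            - Real.exp (-(∫ s in (0 : ℝ)..t, lam s)))) := by
  have hN := hM.poisson
  have h₀ := hM.isEdgeDensity hc hLam hlam_nonneg hlam
  refine ⟨⟨_, h₀⟩, fun f hf => ?_⟩
  -- Any continuous density coincides with the explicit one on the region, which transfers the
  -- first-order system, the regularity and the sign to `f`. The mass is computed directly from the
  -- probability that `f` represents.
  have he : EqOn (fun p : ℝ × ℝ => f p.1 p.2) (edgeDensity c lam) (frontRegion c) :=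
    hf.eqOn hc h₀
  have hpair := (hN.isTelegraphPair_edgeDensity hc hLam hlam_nonneg hlam).congr he
  refine ⟨hpair.contDiffOn_left, hpair.solvesWeakly hc hlam, fun hlam2 => ?_, fun η t hηt => ?_,
    fun t ht => ?_⟩
  · have hG2 := hN.contDiffOn_edgeKernel_two hLam hlam_nonneg hlam2
    have hr := contDiffOn_rightPart hc hLam 2 hlam2 hG2
    have hl := contDiffOn_leftPart hc hLam 2 hlam2 hG2
    have hf2 : ContDiffOn ℝ 2 (fun p : ℝ × ℝ => f p.1 p.2) (frontRegion c) :=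
      (hr.add hl).congr he
    exact ⟨hf2, fun η t hηt =>
      hpair.solvesAt hc (hlam.differentiableOn (by norm_num)) hf2 (hr.sub hl) hηt⟩
  · rw [show f η t = edgeDensity c lam (η, t) from he (show (η, t) ∈ frontRegion c from hηt)]
    exact edgeDensity_nonneg hc _
  · lift t to ℝ≥0 using ht.le
    have ht' : 0 < t := NNReal.coe_pos.1 ht
    have hct : -(c * t) ≤ c * t := by have := mul_pos hc ht; linarith
    rw [intervalIntegral.integral_of_le hct, integral_Ioc_eq_integral_Ioo,
      ← hf.prob_eq t ht' _ measurableSet_Ioo Subset.rfl]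
    exact hM.measureReal_edge hc hLam hlam_nonneg hlam.continuousOn ht'
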